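/- Let $n\ge 0$. A *permutation chart* $\Gamma$ of degree $n$ is a finite graph embedded in the square $D^2=[0,1]\times[0,1]\subset\mathbb{R}^2$ whose edges carry labels in $\{1,\dots,n-1\}$; loops at a vertex and simple closed curves without vertices are allowed as edges. The graph is tame: near each of its points it is carried onto a star of equally spaced radii of the open unit disc by an orientation preserving homeomorphism that is a $C^1$ diffeomorphism away from that point (as for piecewise linear graphs, and for smooth graphs whose edges leave each vertex in distinct directions). Each vertex is of one of three types: a *black vertex*, of valence $1$; a *crossing*, of valence $4$, with labels $i,j,i,j$ in cyclic order, $|i-j|>1$; a *white vertex*, of valence $6$, with labels $i,i+1,i,i+1,i,i+1$ in cyclic order. $\Gamma$ is *consistently oriented as a braid chart* if its edges are oriented so that at each crossing the two opposite edges of the same label are oriented consistently (one incoming, one outgoing), and at each white vertex three cyclically consecutive edges are outgoing and the other three are incoming. Let $D^2\subset S^2$ through an embedding of the disk that extends to an open embedding $\iota:\mathbb{R}^2\to S^2$ of the plane. The *$n$-fold irregular simple branched cover* $F:\hat M(\Gamma)\to S^2$ *associated with* $\Gamma$ is obtained from $n$ copies of $S^2$, numbered $1,\dots,n$, by cutting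 them along the edges of $\Gamma$ and gluing them again so that across an edge with label $i$ sheet $i$ is joined to sheet $i+1$, sheet $i+1$ is joined to sheet $i$, and every other sheet is joined to itself; $F$ is the evident map to $S^2$. **Theorem.** If the permutation chart $\Gamma$ of degree $n$ can be consistently oriented as a braid chart, then there is a topological embedding $\tilde F:\hat M(\Gamma)\to S^2\times[0,1]\times[0,1]$ such that $p\circ\tilde F=F$, where $p:S^2\times[0,1]\times[0,1]\to S^2$ is the projection onto the first factor. -/

import Mathlib

open scoped unitInterval
open TopologicalSpace

/-- The unit sphere `S²` in `ℝ³`. -/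
abbrev Sphere2 : Type := Metric.sphere (0 : EuclideanSpace ℝ (Fin 3)) 1

/-! ### Permutation charts

A chart of degree `n` is a finite labelled graph in the square `[0,1] × [0,1] ⊆ ℂ`. The sheets are
numbered `0, …, n - 1`, so the labels are `0, …, n - 2`; the label `i` stands for the transposition
of the sheets `i` and `i + 1`. -/

/-- The underlying labelled finite family of curves of a chart. The curves are the edges; an edge is
allowed to be a loop at a vertex, or a simple closed curve without vertices. -/
structure PreChart (n : ℕ) where
  /-- the vertices -/
  vertex : Finset ℂ
  /-- the number of edges -/
  numEdges : ℕ
  /-- the edges, as parametrized curves -/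
  curve : Fin numEdges → C(I, ℂ)
  /-- the labels of the edges -/
  label : Fin numEdges → ℕ

namespace PreChart

variable {n : ℕ} (Γ : PreChart n)

/-- The graph as a subset of the plane. -/
def support : Set ℂ := {z | ∃ e t, Γ.curve e t = z}

/-- The union of the open edges with label `i`. -/
def openEdges (i : ℕ) : Set ℂ := {z | ∃ e t, Γ.label e = i ∧ 0 < t ∧ t < 1 ∧ Γ.curve e t = z}

/-- Half-edges: `(e, false)` is the initial end of the curve `e`, `(e, true)` its terminal end. -/
abbrev HalfEdge : Type := Fin Γ.numEdges × Bool

/-- The curve of a half-edge, parametrized so that it starts at the end in question. -/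
noncomputable def halfCurve (h : Γ.HalfEdge) (t : I) : ℂ :=
  if h.2 then Γ.curve h.1 (unitInterval.symm t) else Γ.curve h.1 t

/-- `φ` is a picture of the graph near `z` as a star with `d` legs: an orientation preserving
homeomorphism from a neighbourhood of `z` onto the open unit disc that takes `z` to the centre, is
continuously differentiable with positive Jacobian away from `z`, and takes the graph to the union
of the `d` radii in the directions `exp (2 π i j / d)`. -/
def IsStarPicture (z : ℂ) (d : ℕ) (φ : OpenPartialHomeomorph ℂ ℂ) : Prop :=
  z ∈ φ.source ∧ φ z = 0 ∧ φ.target = Metric.ball 0 1 ∧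
  ContDiffOn ℝ 1 φ (φ.source \ {z}) ∧
  (∀ w ∈ φ.source \ {z}, 0 < (fderiv ℝ φ w).det) ∧
  ∀ w ∈ φ.source, w ∈ Γ.support ↔ ∃ (j : Fin d) (r : ℝ), 0 ≤ r ∧
    φ w = r * Complex.exp (2 * Real.pi * Complex.I * (j : ℕ) / d)

/-- `v` is a point of valence `d`, and `half 0, …, half (d - 1)` are the half-edges at `v`, listed
in their cyclic order around `v`. -/
def IsCyclicOrder (v : ℂ) {d : ℕ} (half : Fin d → Γ.HalfEdge) : Prop :=
  Set.BijOn half Set.univ {h | Γ.halfCurve h 0 = v} ∧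
  ∃ φ : OpenPartialHomeomorph ℂ ℂ, Γ.IsStarPicture v d φ ∧
    ∀ j : Fin d, ∀ᶠ t in nhdsWithin (0 : I) (Set.Ioi 0),
      Γ.halfCurve (half j) t ∈ φ.source ∧
      ∃ r : ℝ, 0 < r ∧ φ (Γ.halfCurve (half j) t) =
        r * Complex.exp (2 * Real.pi * Complex.I * (j : ℕ) / d)

/-- A black vertex, with its half-edge: valence one, any label. -/
def IsBlack (v : ℂ) (half : Fin 1 → Γ.HalfEdge) : Prop := Γ.IsCyclicOrder v half

/-- A crossing, with its half-edges: valence four, labels `a, b, a, b` with `|a - b| > 1`. -/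
def IsCrossing (v : ℂ) (half : Fin 4 → Γ.HalfEdge) : Prop :=
  Γ.IsCyclicOrder v half ∧ ∃ a b : ℕ, (a + 1 < b ∨ b + 1 < a) ∧
    ∀ j : Fin 4, Γ.label (half j).1 = if (j : ℕ) % 2 = 0 then a else b

/-- A white vertex, with its half-edges: valence six, labels `a, b, a, b, a, b` with
`|a - b| = 1`. -/
def IsWhite (v : ℂ) (half : Fin 6 → Γ.HalfEdge) : Prop :=
  Γ.IsCyclicOrder v half ∧ ∃ a b : ℕ, (a + 1 = b ∨ b + 1 = a) ∧
    ∀ j : Fin 6, Γ.label (half j).1 = if (j : ℕ) % 2 = 0 then a else b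

end PreChart

/-- A permutation chart of degree `n`. -/
structure PermutationChart (n : ℕ) extends PreChart n where
  label_lt : ∀ e, label e + 1 < n
  /-- The graph lies in the square `[0,1] × [0,1]`. -/
  curve_mem : ∀ e t, 0 ≤ (curve e t).re ∧ (curve e t).re ≤ 1 ∧
    0 ≤ (curve e t).im ∧ (curve e t).im ≤ 1
  /-- The open edges are embedded, pairwise disjoint, and disjoint from all ends of edges. -/
  curve_inj : ∀ e e' (t t' : I), 0 < t → t < 1 → curve e t = curve e' t' → e = e' ∧ t = t'
  /-- An edge joins two (possibly equal) vertices, or is a closed curve without vertices. -/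
  curve_ends : ∀ e, (curve e 0 ∈ vertex ∧ curve e 1 ∈ vertex) ∨
    (curve e 0 = curve e 1 ∧ curve e 0 ∉ vertex)
  /-- Away from the vertices the graph is locally a line. -/
  locally_line : ∀ z ∈ toPreChart.support, z ∉ vertex → ∃ φ, toPreChart.IsStarPicture z 2 φ
  vertex_type : ∀ v ∈ vertex, (∃ half, toPreChart.IsBlack v half) ∨
    (∃ half, toPreChart.IsCrossing v half) ∨ (∃ half, toPreChart.IsWhite v half)

/-! ### Cutting a space along a subset -/

/-- A point of the space obtained from `X` by cutting along `S`: a point `pt` of `X` together with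
a side of `S` at `pt`, that is, a compatible choice, for all open neighbourhoods `U` of `pt`, of a
connected component of `U \ S`. -/
structure CutPoint {X : Type*} [TopologicalSpace X] (S : Set X) where
  pt : X
  part : OpenNhdsOf pt → Set X
  isComponent : ∀ U : OpenNhdsOf pt, ∃ y ∈ (U : Set X) \ S, part U = connectedComponentIn ((U : Set X) \ S) y
  mono : ∀ U V : OpenNhdsOf pt, U ≤ V → part U ⊆ part V

namespace CutPoint

variable {X : Type*} [TopologicalSpace X] {S : Set X}

/-- `p` lies over `U`, on the side given by the component `W` of `U \ S`. -/
def LiesIn (p : CutPoint S) (U : Opens X) (W : Set X) : Prop :=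
  ∃ h : p.pt ∈ U, p.part ⟨U, h⟩ = W

/-- The topology of the cut space: a basic open set consists of the points over an open set `U`
that lie on the side of one component of `U \ S`. -/
instance : TopologicalSpace (CutPoint S) :=
  generateFrom {A | ∃ (U : Opens X) (W : Set X), A = {p | p.LiesIn U W}}

end CutPoint

namespace PermutationChart

variable {n : ℕ} (Γ : PermutationChart n)

/-! ### Orientations -/

/-- An orientation of the edges: `o e = true` if the edge `e` is oriented in the direction of its
parametrization, and `o e = false` if it is oriented in the opposite direction.
The half-edge `h` is outgoing (points away from its end) for `o`. -/
def IsOutgoing (o : Fin Γ.numEdges → Bool) (h : Γ.HalfEdge) : Prop := o h.1 ≠ h.2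

/-- The orientation `o` makes the permutation chart a braid chart: there is a flow through each
crossing (opposite edges, which have the same label, are oriented consistently) and through each
white vertex (three consecutive edges are outgoing and the other three are incoming). -/
def IsBraidOrientation (o : Fin Γ.numEdges → Bool) : Prop :=
  ∀ v ∈ Γ.vertex,
    (∃ half, Γ.IsBlack v half) ∨
    (∃ half, Γ.IsCrossing v half ∧
      (Γ.IsOutgoing o (half 0) ↔ ¬ Γ.IsOutgoing o (half 2)) ∧
      (Γ.IsOutgoing o (half 1) ↔ ¬ Γ.IsOutgoing o (half 3))) ∨
    (∃ half, Γ.IsWhite v half ∧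
      Γ.IsOutgoing o (half 0) ∧ Γ.IsOutgoing o (half 1) ∧ Γ.IsOutgoing o (half 2) ∧
      ¬ Γ.IsOutgoing o (half 3) ∧ ¬ Γ.IsOutgoing o (half 4) ∧ ¬ Γ.IsOutgoing o (half 5))

/-! ### The branched cover of the sphere induced by a chart

The plane, and with it the square that contains the chart, is placed in `S²` by `ι`. Take `n`
copies of `S²`, cut them along the graph, and glue: whenever two points of the cut sphere face each
other across an edge with label `i`, glue sheet `i` at one of them to sheet `i + 1` at the other,
sheet `i + 1` to sheet `i`, and every other sheet to itself. -/

variable (ι : ℂ → Sphere2)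

/-- The sphere cut along the graph of the chart. -/
abbrev CutSphere : Type := CutPoint (ι '' Γ.support)

/-- `p` and `q` are points of the cut sphere over the same point of `S²` that face each other across
an edge with label `i`: arbitrarily close to that point there are the two copies `a`, `b` of a
point of an open edge with label `i`, with `a` on the side of `p` and `b` on the side of `q`. (At
a point of an open edge `p` and `q` are these two copies themselves; at a crossing or a white vertex
they are neighbouring sectors; at a black vertex `p = q`.) -/
def Facing (i : ℕ) (p q : Γ.CutSphere ι) : Prop :=
  p.pt = q.pt ∧ ∀ U : Opens Sphere2, p.pt ∈ U →
    ∃ a b : Γ.CutSphere ι, a ≠ b ∧ a.pt = b.pt ∧ a.pt ∈ ι '' Γ.openEdges i ∧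
      (∃ W, p.LiesIn U W ∧ a.LiesIn U W) ∧ (∃ W, q.LiesIn U W ∧ b.LiesIn U W)

/-- The gluing of the `n` cut spheres. -/
def Glued (x y : Γ.CutSphere ι × Fin n) : Prop :=
  ∃ (i : ℕ) (hi : i + 1 < n), Γ.Facing ι i x.1 y.1 ∧
    y.2 = Equiv.swap (⟨i, Nat.lt_of_succ_lt hi⟩ : Fin n) ⟨i + 1, hi⟩ x.2

/-- The total space of the branched cover, with the quotient topology. -/
abbrev Cover : Type := Quot (Γ.Glued ι)

/-- The covering map. -/
def coverMap : Γ.Cover ι → Sphere2 :=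
  Quot.lift (fun x => x.1.pt) (fun _ _ ⟨_, _, h, _⟩ => h.1)

end PermutationChart

/-! The embedding is `x ↦ (F x, sigmoid (g x), sigmoid (f x))` for two real functions `g` and `f` on
the sheets that respect the gluing and together separate the points of each fibre. The cover is a
quotient of finitely many copies of the cut sphere. The cut sphere is compact because the graph
locally has finitely many sides (`compactSpace_cutPoint`). So a continuous injection into a
Hausdorff space is automatically an embedding.

The function `g` needs no orientation. Let `D i ≥ 0` vanish exactly on the closure of the open edges
with label `i`, and let `g` on sheet `l` be the sum of `D i` over `i < l`. Sheets `i` and `i + 1`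
are interchanged only where `D i = 0`, so `g` descends. Sheets `k < l` have equal values over a
point only if every label `i` with `k ≤ i < l` occurs there. Hence only sheets that meet at an edge
or a vertex remain to be separated.

The function `f` separates these and uses the orientation: on the left of an edge with label `i`
sheet `i` lies above sheet `i + 1`, on the right it lies below. This is compatible with the gluing,
which interchanges both the sheets and the sides. Near a crossing or a white vertex such an `f` can
be chosen constant on each sector and sheet exactly because of the flow condition
(`exists_isWeight_crossing`, `exists_isWeight_white`). The conditions on `f` survive averaging, so a
partition of unity glues the local choices over the complement of the black vertices. A factor
vanishing exactly at the black vertices extends the result continuously (`exists_isHeight`). Nothing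
is lost there, since the two sheets in question are glued together at a black vertex.

For injectivity (`mk_eq_of_eq`), all points of a fibre are moved into one sector. At most two labels
occur there. At a white vertex the sector between an incoming and an outgoing leg lies to the right
of both, so the three sheets involved are strictly ordered by `f`, and no two of them agree.

The geometric work is to show that the left of an edge is well defined: charts with positive
Jacobian that send the edge into the real axis in the positive direction agree about the upper side
(`IsEdgeChart.exists_upper`). The star charts must also be shrunk until each leg belongs to a single
germ of an edge (`IsStarChart.exists_isModel`). -/

namespace ChartCover

open Filter Topology

/-! ### Sectors of the punctured plane -/

/-- The angle of the `k`-th of `d` equally spaced directions. -/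
noncomputable def dirAngle (d : ℕ) (k : ℤ) : ℝ := 2 * Real.pi * k / d

/-- The open sector between the directions `k` and `k + 1`. -/
def sector (d : ℕ) (k : ℤ) : Set ℂ :=
  {w | ∃ s θ : ℝ, dirAngle d k < θ ∧ θ < dirAngle d (k + 1) ∧ w = Complex.exp (s + θ * Complex.I)}

/-- The union of the `d` radii in equally spaced directions. -/
def starSet (d : ℕ) : Set ℂ :=
  {w | ∃ (j : Fin d) (r : ℝ), 0 ≤ r ∧ w = r * Complex.exp (2 * Real.pi * Complex.I * (j : ℕ) / d)}

theorem dirAngle_lt {d : ℕ} (hd : 0 < d) {k l : ℤ} : dirAngle d k < dirAngle d l ↔ k < l := by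
  have hd' : (0 : ℝ) < d := by exact_mod_cast hd
  unfold dirAngle
  rw [div_lt_div_iff_of_pos_right hd', mul_lt_mul_iff_right₀ (by positivity)]
  exact_mod_cast Iff.rfl

theorem dirAngle_le {d : ℕ} (hd : 0 < d) {k l : ℤ} : dirAngle d k ≤ dirAngle d l ↔ k ≤ l := by
  rw [← not_lt, dirAngle_lt hd, not_lt]

theorem dirAngle_add_mul {d : ℕ} (hd : 0 < d) (k m : ℤ) :
    dirAngle d (k + m * d) = dirAngle d k + m * (2 * Real.pi) := by
  have hd' : (d : ℝ) ≠ 0 := by exact_mod_cast hd.ne'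
  unfold dirAngle
  push_cast
  field_simp

theorem exp_add_two_pi_mul (s θ : ℝ) (m : ℤ) :
    Complex.exp (s + (θ + m * (2 * Real.pi) : ℝ) * Complex.I) = Complex.exp (s + θ * Complex.I) := by
  rw [Complex.exp_eq_exp_iff_exists_int]
  exact ⟨m, by push_cast; ring⟩

theorem sector_add_mul {d : ℕ} (hd : 0 < d) (k m : ℤ) : sector d (k + m * d) = sector d k := by
  have key : ∀ k m : ℤ, sector d k ⊆ sector d (k + m * d) := by
    rintro k m w ⟨s, θ, h1, h2, rfl⟩
    refine ⟨s, θ + m * (2 * Real.pi), ?_, ?_, (exp_add_two_pi_mul s θ m).symm⟩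
    · rw [dirAngle_add_mul hd]; linarith
    · rw [show k + m * d + 1 = (k + 1) + m * d by ring, dirAngle_add_mul hd]; linarith
  refine Set.Subset.antisymm ?_ (key k m)
  have := key (k + m * d) (-m)
  rwa [show k + m * d + -m * d = k by ring] at this

theorem sector_congr {d : ℕ} (hd : 0 < d) {k l : ℤ} (h : (d : ℤ) ∣ l - k) :
    sector d k = sector d l := by
  obtain ⟨m, hm⟩ := h
  rw [show l = k + m * d by linarith, sector_add_mul hd]

/-- Two arguments of one point differ by a multiple of `2π`, which is a multiple of `d` steps. After
this shift two open intervals of one step overlap, so they coincide. -/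
theorem sector_disjoint {d : ℕ} (hd : 0 < d) {k l : ℤ} {w : ℂ} (h : w ∈ sector d k)
    (h' : w ∈ sector d l) : (d : ℤ) ∣ l - k := by
  obtain ⟨s, θ, h1, h2, rfl⟩ := h
  obtain ⟨s', θ', h1', h2', h3⟩ := h'
  obtain ⟨m, hm⟩ := Complex.exp_eq_exp_iff_exists_int.1 h3
  have him := congrArg Complex.im hm
  simp at him
  have e1 : dirAngle d (l + m * d) < θ := by rw [dirAngle_add_mul hd]; linarith
  have e2 : θ < dirAngle d (l + 1 + m * d) := by rw [dirAngle_add_mul hd]; linarith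
  have f1 := (dirAngle_lt hd).1 (e1.trans h2)
  have f2 := (dirAngle_lt hd).1 (h1.trans e2)
  refine ⟨-m, ?_⟩
  have : k = l + m * d := by omega
  rw [this]; ring

theorem sector_fin_injective {d : ℕ} {k l : Fin d} {w : ℂ} (h : w ∈ sector d (k : ℕ))
    (h' : w ∈ sector d (l : ℕ)) : k = l := by
  have hd : 0 < d := k.pos
  have h1 := sector_disjoint hd h h'
  have h2 := Int.eq_zero_of_abs_lt_dvd h1 (by rw [abs_lt]; omega)
  ext; omega

theorem sector_sub_one {d : ℕ} [NeZero d] (k : Fin d) :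
    sector d ((k - 1 : Fin d) : ℕ) = sector d ((k : ℕ) - 1) := by
  have hd : 0 < d := Nat.pos_of_ne_zero (NeZero.ne d)
  apply sector_congr hd
  by_cases hk : k = 0
  · subst hk
    have : ((0 - 1 : Fin d) : ℕ) = d - 1 := by
      rw [Fin.sub_def]
      rcases Nat.lt_or_ge 1 d with h | h
      · simp [Nat.mod_eq_of_lt h]
      · have : d = 1 := by omega
        subst this; simp
    rw [this]
    refine ⟨-1, ?_⟩
    push_cast [hd]
    simp
    ring
  · have : ((k - 1 : Fin d) : ℕ) = k - 1 := by
      have h1 : 0 < (k : ℕ) := Nat.pos_of_ne_zero fun h => hk (Fin.ext (by simpa using h))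
      have h2 : 1 < d := by have := k.2; omega
      rw [Fin.sub_def]
      have h3 : ((1 : Fin d) : ℕ) = 1 := by
        rw [Fin.val_one', Nat.mod_eq_of_lt h2]
      simp only [h3]
      rw [show d - 1 + (k : ℕ) = (k - 1) + d by omega, Nat.add_mod_right, Nat.mod_eq_of_lt]
      omega
    have h1 : 0 < (k : ℕ) := Nat.pos_of_ne_zero fun h => hk (Fin.ext (by simpa using h))
    rw [this]
    refine ⟨0, ?_⟩
    omega

theorem isOpen_sector (d : ℕ) (k : ℤ) : IsOpen (sector d k) := by
  have : sector d k = Complex.exp '' (Complex.im ⁻¹' Set.Ioo (dirAngle d k) (dirAngle d (k + 1))) := by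
    ext w
    constructor
    · rintro ⟨s, θ, h1, h2, rfl⟩
      exact ⟨_, by simpa using ⟨h1, h2⟩, rfl⟩
    · rintro ⟨z, hz, rfl⟩
      exact ⟨z.re, z.im, hz.1, hz.2, by rw [Complex.re_add_im]⟩
  rw [this]
  exact Complex.isOpenMap_exp _ (isOpen_Ioo.preimage Complex.continuous_im)

/-- The truncated sector is the image under `Complex.exp` of a half-strip, which is convex. -/
theorem isPreconnected_ball_inter_sector (d : ℕ) (k : ℤ) {ρ : ℝ} (hρ : 0 < ρ) :
    IsPreconnected (Metric.ball (0 : ℂ) ρ ∩ sector d k) := by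
  have : Metric.ball (0 : ℂ) ρ ∩ sector d k = Complex.exp ''
      (Set.Iio (Real.log ρ) ×ℂ Set.Ioo (dirAngle d k) (dirAngle d (k + 1))) := by
    ext w
    constructor
    · rintro ⟨h0, s, θ, h1, h2, rfl⟩
      refine ⟨_, ?_, rfl⟩
      rw [mem_ball_zero_iff, Complex.norm_exp] at h0
      simp at h0
      simp [Complex.mem_reProdIm, h1, h2]
      rwa [Real.lt_log_iff_exp_lt hρ]
    · rintro ⟨z, hz, rfl⟩
      rw [Complex.mem_reProdIm] at hz
      refine ⟨?_, z.re, z.im, hz.2.1, hz.2.2, by rw [Complex.re_add_im]⟩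
      rw [mem_ball_zero_iff, Complex.norm_exp]
      exact (Real.lt_log_iff_exp_lt hρ).1 hz.1
  rw [this]
  have hc : Convex ℝ (Set.Iio (Real.log ρ) ×ℂ Set.Ioo (dirAngle d k) (dirAngle d (k + 1))) :=
    ((convex_Iio _).linear_preimage Complex.reLm).inter ((convex_Ioo _ _).linear_preimage Complex.imLm)
  exact hc.isPreconnected.image _ Complex.continuous_exp.continuousOn

/-- The direction `k` as a complex number. -/
theorem exp_dirAngle (d k : ℕ) :
    Complex.exp (2 * Real.pi * Complex.I * k / d) = Complex.exp (dirAngle d k * Complex.I) := by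
  congr 1
  unfold dirAngle
  push_cast
  ring

theorem exists_polar {w : ℂ} (hw : w ≠ 0) (d : ℕ) (hd : 0 < d) : ∃ (k : Fin d) (s θ : ℝ),
    dirAngle d (k : ℕ) ≤ θ ∧ θ < dirAngle d ((k : ℕ) + 1) ∧ w = Complex.exp (s + θ * Complex.I) := by
  have hd' : (0 : ℝ) < d := by exact_mod_cast hd
  set a := Complex.arg w
  -- The number of whole steps `2π / d` in the argument. Reducing it modulo `d` shifts the argument
  -- by a multiple of `2π`.
  set k : ℤ := ⌊a * d / (2 * Real.pi)⌋
  have h1 : dirAngle d k ≤ a := by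
    have := Int.floor_le (a * d / (2 * Real.pi))
    unfold dirAngle
    rw [le_div_iff₀ (by positivity)] at this
    rw [div_le_iff₀ hd']; linarith
  have h2 : a < dirAngle d (k + 1) := by
    have := Int.lt_floor_add_one (a * d / (2 * Real.pi))
    unfold dirAngle
    rw [div_lt_iff₀ (by positivity)] at this
    rw [lt_div_iff₀ hd']; push_cast; linarith
  have hdz : (0 : ℤ) < d := by exact_mod_cast hd
  have hk0 := Int.emod_nonneg k hdz.ne'
  have hk1 := Int.emod_lt_of_pos k hdz
  have hk2 := Int.emod_add_mul_ediv k d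
  have e : k % d = k + (-(k / d)) * d := by linarith
  refine ⟨⟨(k % d).toNat, by omega⟩, Real.log ‖w‖, a + (-(k / d) : ℤ) * (2 * Real.pi), ?_, ?_, ?_⟩
  · simp only [Int.toNat_of_nonneg hk0]
    rw [e, dirAngle_add_mul hd]; linarith
  · simp only [Int.toNat_of_nonneg hk0]
    rw [e, show k + (-(k / d)) * d + 1 = (k + 1) + (-(k / d)) * d by ring, dirAngle_add_mul hd]
    linarith
  · rw [exp_add_two_pi_mul, Complex.exp_add, ← Complex.ofReal_exp, Real.exp_log (norm_pos_iff.2 hw),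
      Complex.norm_mul_exp_arg_mul_I]

theorem zero_mem_starSet {d : ℕ} (hd : 0 < d) : (0 : ℂ) ∈ starSet d := ⟨⟨0, hd⟩, 0, le_rfl, by simp⟩

theorem sector_disjoint_starSet {d : ℕ} {k : ℤ} {w : ℂ} (h : w ∈ sector d k) : w ∉ starSet d := by
  rintro ⟨j, r, hr, h'⟩
  have hd : 0 < d := j.pos
  obtain ⟨s, θ, h1, h2, rfl⟩ := h
  have hr0 : 0 < r := by
    rcases hr.lt_or_eq with h | h
    · exact h
    · subst h; simp at h'
  rw [exp_dirAngle, ← Real.exp_log hr0, Complex.ofReal_exp, ← Complex.exp_add,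
    Complex.exp_eq_exp_iff_exists_int] at h'
  obtain ⟨m, hm⟩ := h'
  have him := congrArg Complex.im hm
  simp at him
  have e : θ = dirAngle d (j + m * d) := by rw [dirAngle_add_mul hd, him]
  rw [e, dirAngle_lt hd] at h1 h2
  omega

theorem exists_sector {d : ℕ} (hd : 0 < d) {w : ℂ} (h : w ∉ starSet d) :
    ∃ k : Fin d, w ∈ sector d (k : ℕ) := by
  have hw : w ≠ 0 := fun h0 => h (h0 ▸ zero_mem_starSet hd)
  obtain ⟨k, s, θ, h1, h2, h3⟩ := exists_polar hw d hd
  refine ⟨k, s, θ, lt_of_le_of_ne h1 ?_, h2, h3⟩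
  intro h4
  apply h
  refine ⟨k, Real.exp s, (Real.exp_pos s).le, ?_⟩
  rw [exp_dirAngle, h3, ← h4, Complex.exp_add]
  push_cast
  rfl

/-- A point of the `k`-th sector at distance `r` from the centre. -/
noncomputable def sectorPt (d : ℕ) (k : ℤ) (r : ℝ) : ℂ :=
  Complex.exp (Real.log r + ((dirAngle d k + dirAngle d (k + 1)) / 2 : ℝ) * Complex.I)

theorem sectorPt_mem {d : ℕ} (hd : 0 < d) (k : ℤ) (r : ℝ) : sectorPt d k r ∈ sector d k := by
  have := (dirAngle_lt hd).2 (lt_add_one k)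
  exact ⟨_, _, by linarith, by linarith, rfl⟩

theorem norm_sectorPt (d : ℕ) (k : ℤ) {r : ℝ} (hr : 0 < r) : ‖sectorPt d k r‖ = r := by
  rw [sectorPt, Complex.norm_exp]
  simp [Real.exp_log hr]

/-- The direction of the `k`-th radius. -/
noncomputable def radius (d : ℕ) (k : Fin d) : ℂ := Complex.exp (2 * Real.pi * Complex.I * (k : ℕ) / d)

theorem norm_radius {d : ℕ} (k : Fin d) : ‖radius d k‖ = 1 := by
  rw [radius, exp_dirAngle, Complex.norm_exp_ofReal_mul_I]

theorem radius_ne_zero {d : ℕ} (k : Fin d) : radius d k ≠ 0 := Complex.exp_ne_zero _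

theorem radius_injective {d : ℕ} {k l : Fin d} {r s : ℝ} (hr : 0 < r) (hs : 0 < s)
    (h : r * radius d k = s * radius d l) : k = l ∧ r = s := by
  have hd : 0 < d := k.pos
  have hrs : r = s := by
    have := congrArg norm h
    rwa [norm_mul, norm_mul, norm_radius, norm_radius, Complex.norm_of_nonneg hr.le,
      Complex.norm_of_nonneg hs.le, mul_one, mul_one] at this
  subst hrs
  refine ⟨?_, rfl⟩
  have h' := mul_left_cancel₀ (by exact_mod_cast hr.ne') h
  rw [radius, radius, exp_dirAngle, exp_dirAngle, Complex.exp_eq_exp_iff_exists_int] at h'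
  obtain ⟨m, hm⟩ := h'
  have him := congrArg Complex.im hm
  simp at him
  have e : dirAngle d k = dirAngle d (l + m * d) := by rw [dirAngle_add_mul hd, him]
  have e2 : (k : ℤ) = l + m * d :=
    le_antisymm ((dirAngle_le hd).1 e.le) ((dirAngle_le hd).1 e.ge)
  have h1 := Int.eq_zero_of_abs_lt_dvd (m := d) (x := (k : ℤ) - l) ⟨m, by rw [e2]; ring⟩
    (by rw [abs_lt]; omega)
  ext; omega

/-- Multiplying a point on a radius by `exp ζ` moves it into the sector to the left, along the
radius, or to the sector to the right, according to the sign of the imaginary part of `ζ`. -/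
theorem radius_mul_exp_eq {d : ℕ} (k : Fin d) {r : ℝ} (hr : 0 < r) (ζ : ℂ) :
    r * radius d k * Complex.exp ζ =
      Complex.exp ((Real.log r + ζ.re : ℝ) + (dirAngle d k + ζ.im : ℝ) * Complex.I) := by
  rw [radius, exp_dirAngle]
  conv_lhs => rw [← Real.exp_log hr, Complex.ofReal_exp, ← Complex.exp_add, ← Complex.exp_add]
  congr 1
  push_cast
  conv_lhs => rw [← Complex.re_add_im ζ]
  ring

theorem dirAngle_succ {d : ℕ} (k : ℤ) : dirAngle d (k + 1) = dirAngle d k + 2 * Real.pi / d := by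
  unfold dirAngle; push_cast; ring

theorem radius_mul_exp_mem_left {d : ℕ} (k : Fin d) {r : ℝ} (hr : 0 < r) {ζ : ℂ} (h0 : 0 < ζ.im)
    (h1 : ζ.im < 2 * Real.pi / d) : r * radius d k * Complex.exp ζ ∈ sector d (k : ℕ) := by
  refine ⟨_, _, ?_, ?_, radius_mul_exp_eq k hr ζ⟩
  · simpa using h0
  · rw [dirAngle_succ]; simpa using h1

theorem radius_mul_exp_mem_right {d : ℕ} [NeZero d] (k : Fin d) {r : ℝ} (hr : 0 < r) {ζ : ℂ}
    (h0 : ζ.im < 0) (h1 : -(2 * Real.pi / d) < ζ.im) :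
    r * radius d k * Complex.exp ζ ∈ sector d ((k - 1 : Fin d) : ℕ) := by
  rw [sector_sub_one]
  refine ⟨_, _, ?_, ?_, radius_mul_exp_eq k hr ζ⟩
  · have := dirAngle_succ (d := d) ((k : ℕ) - 1)
    simp at this ⊢
    linarith
  · simpa using h0

theorem radius_mul_exp_mem_starSet {d : ℕ} (k : Fin d) {r : ℝ} (hr : 0 < r) {ζ : ℂ}
    (h1 : |ζ.im| < 2 * Real.pi / d) : r * radius d k * Complex.exp ζ ∈ starSet d ↔ ζ.im = 0 := by
  have : NeZero d := ⟨k.pos.ne'⟩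
  rw [abs_lt] at h1
  constructor
  · intro h
    by_contra h0
    rcases lt_or_gt_of_ne h0 with h0 | h0
    · exact sector_disjoint_starSet (radius_mul_exp_mem_right k hr h0 h1.1) h
    · exact sector_disjoint_starSet (radius_mul_exp_mem_left k hr h0 h1.2) h
  · intro h
    refine ⟨k, r * Real.exp ζ.re, by positivity, ?_⟩
    have : ζ = ζ.re := Complex.ext rfl (by simp [h])
    rw [this, ← radius]
    push_cast
    simp only [Complex.ofReal_re]
    ring

theorem mem_starSet_two {w : ℂ} : w ∈ starSet 2 ↔ w.im = 0 := by
  have h1 : Complex.exp (2 * Real.pi * Complex.I * (1 : ℕ) / (2 : ℕ)) = -1 := by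
    rw [← Complex.exp_pi_mul_I]; congr 1; push_cast; ring
  constructor
  · rintro ⟨j, r, hr, rfl⟩
    fin_cases j
    · simp
    · simp only [h1]; simp
  · intro h
    have hw : w = w.re := Complex.ext rfl (by simp [h])
    rcases le_total 0 w.re with h0 | h0
    · exact ⟨0, w.re, h0, by rw [hw]; simp⟩
    · exact ⟨1, -w.re, by linarith, by simp only [Fin.val_one, h1]; rw [hw]; simp⟩

theorem mem_sector_two_zero {w : ℂ} (h : 0 < w.im) : w ∈ sector 2 0 := by
  refine ⟨Real.log ‖w‖, w.arg, ?_, ?_, ?_⟩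
  · have := Complex.arg_nonneg_iff.2 h.le
    simp only [dirAngle, Int.cast_zero, mul_zero, zero_div]
    refine lt_of_le_of_ne this fun h0 => ?_
    have := Complex.arg_eq_zero_iff.1 h0.symm
    linarith [this.2]
  · simp only [dirAngle]
    have := Complex.arg_lt_pi_iff.2 (Or.inr h.ne')
    push_cast; linarith
  · have hw : w ≠ 0 := by rintro rfl; simp at h
    rw [Complex.exp_add, ← Complex.ofReal_exp, Real.exp_log (norm_pos_iff.2 hw),
      Complex.norm_mul_exp_arg_mul_I]

theorem mem_sector_two_one {w : ℂ} (h : w.im < 0) : w ∈ sector 2 1 := by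
  obtain ⟨s, θ, h1, h2, h3⟩ := mem_sector_two_zero (w := -w) (by simpa using h)
  refine ⟨s, θ + Real.pi, ?_, ?_, ?_⟩
  · simp [dirAngle] at h1 ⊢; linarith
  · simp [dirAngle] at h2 ⊢; linarith
  · push_cast
    rw [add_mul, ← add_assoc, Complex.exp_add, Complex.exp_pi_mul_I, ← h3]; ring


/-! ### Points of a cut space -/

section CutPoint

variable {X : Type*} [TopologicalSpace X] {S : Set X}

theorem _root_.CutPoint.exists_liesIn (p : CutPoint S) {U : Opens X} (h : p.pt ∈ U) :
    ∃ y ∈ (U : Set X) \ S, p.LiesIn U (connectedComponentIn ((U : Set X) \ S) y) := by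
  obtain ⟨y, hy, h'⟩ := p.isComponent ⟨U, h⟩
  exact ⟨y, hy, h, h'⟩

theorem _root_.CutPoint.liesIn_unique {p : CutPoint S} {U : Opens X} {W W' : Set X} (h : p.LiesIn U W)
    (h' : p.LiesIn U W') : W = W' := by
  obtain ⟨_, rfl⟩ := h
  obtain ⟨_, rfl⟩ := h'
  rfl

theorem _root_.CutPoint.LiesIn.mem {p : CutPoint S} {U : Opens X} {W : Set X} (h : p.LiesIn U W) :
    p.pt ∈ U := h.1

theorem _root_.CutPoint.LiesIn.eq_component {p : CutPoint S} {U : Opens X} {W : Set X} (h : p.LiesIn U W)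
    {y : X} (hy : y ∈ W) : W = connectedComponentIn ((U : Set X) \ S) y := by
  obtain ⟨z, hz, h'⟩ := CutPoint.exists_liesIn p h.mem
  obtain rfl := CutPoint.liesIn_unique h h'
  exact connectedComponentIn_eq hy

theorem _root_.CutPoint.LiesIn.nonempty {p : CutPoint S} {U : Opens X} {W : Set X} (h : p.LiesIn U W) :
    W.Nonempty := by
  obtain ⟨z, hz, h'⟩ := CutPoint.exists_liesIn p h.mem
  obtain rfl := CutPoint.liesIn_unique h h'
  exact ⟨z, mem_connectedComponentIn hz⟩

theorem _root_.CutPoint.LiesIn.subset {p : CutPoint S} {U : Opens X} {W : Set X} (h : p.LiesIn U W) :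
    W ⊆ (U : Set X) \ S := by
  obtain ⟨z, hz, h'⟩ := CutPoint.exists_liesIn p h.mem
  obtain rfl := CutPoint.liesIn_unique h h'
  exact connectedComponentIn_subset _ _

theorem _root_.CutPoint.LiesIn.subset_of_le {p : CutPoint S} {U V : Opens X} {W W' : Set X}
    (h : p.LiesIn U W) (h' : p.LiesIn V W') (hUV : U ≤ V) : W ⊆ W' := by
  obtain ⟨h1, rfl⟩ := h
  obtain ⟨h2, rfl⟩ := h'
  exact p.mono _ _ hUV

/-- Two points of the cut space over `U` lie on the same side over `U`. -/
def SameSide (U : Opens X) (p q : CutPoint S) : Prop := ∃ W, p.LiesIn U W ∧ q.LiesIn U W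

/-- A component over `U` meets only one component over `V`, so sides over small sets determine sides
over larger ones. -/
theorem SameSide.mono {U V : Opens X} {p q : CutPoint S} (h : SameSide U p q) (hUV : U ≤ V) :
    SameSide V p q := by
  obtain ⟨W, h1, h2⟩ := h
  obtain ⟨y, -, hy⟩ := CutPoint.exists_liesIn p (hUV h1.mem)
  obtain ⟨z, -, hz⟩ := CutPoint.exists_liesIn q (hUV h2.mem)
  obtain ⟨w, hw⟩ := h1.nonempty
  refine ⟨_, hy, ?_⟩
  have e1 := hy.eq_component (h1.subset_of_le hy hUV hw)
  have e2 := hz.eq_component (h2.subset_of_le hz hUV hw)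
  rw [e1, ← e2]
  exact hz

theorem SameSide.refl {U : Opens X} {p : CutPoint S} (h : p.pt ∈ U) : SameSide U p p := by
  obtain ⟨y, -, hy⟩ := CutPoint.exists_liesIn p h
  exact ⟨_, hy, hy⟩

theorem _root_.CutPoint.eq_of_sameSide {p q : CutPoint S} (h : p.pt = q.pt)
    (H : ∀ U : Opens X, p.pt ∈ U → ∃ V : Opens X, p.pt ∈ V ∧ V ≤ U ∧ SameSide V p q) : p = q := by
  have H' : ∀ U : Opens X, p.pt ∈ U → SameSide U p q := fun U hU => by
    obtain ⟨V, -, h2, h3⟩ := H U hU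
    exact h3.mono h2
  obtain ⟨x, P, hP, mP⟩ := p
  obtain ⟨y, Q, hQ, mQ⟩ := q
  obtain rfl : x = y := h
  congr 1
  funext U
  obtain ⟨W, ⟨h1, h2⟩, ⟨h3, h4⟩⟩ := H' U.toOpens U.mem
  exact h2.trans h4.symm

theorem isOpen_liesIn (U : Opens X) (W : Set X) : IsOpen {p : CutPoint S | p.LiesIn U W} :=
  isOpen_generateFrom_of_mem ⟨U, W, rfl⟩

theorem isOpen_sameSide (U : Opens X) (p : CutPoint S) : IsOpen {q : CutPoint S | SameSide U p q} := by
  have : {q : CutPoint S | SameSide U p q} = ⋃ W ∈ {W | p.LiesIn U W}, {q | q.LiesIn U W} := by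
    ext q; simp [SameSide]
  rw [this]
  exact isOpen_biUnion fun W _ => isOpen_liesIn U W

theorem _root_.CutPoint.continuous_pt : Continuous (CutPoint.pt : CutPoint S → X) := by
  refine continuous_def.2 fun V hV => ?_
  have : (CutPoint.pt : CutPoint S → X) ⁻¹' V = ⋃ W, {p : CutPoint S | p.LiesIn ⟨V, hV⟩ W} := by
    ext p
    simp only [Set.mem_preimage, Set.mem_iUnion, Set.mem_ofPred_eq]
    exact ⟨fun h => ⟨_, h, rfl⟩, fun ⟨W, h, _⟩ => h⟩
  rw [this]
  exact isOpen_iUnion fun W => isOpen_liesIn _ W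

/-- A compact space cut along a subset that locally separates it into finitely many parts is
compact. -/
theorem compactSpace_cutPoint [CompactSpace X]
    (H : ∀ x : X, ∀ V : Opens X, x ∈ V → ∃ U : Opens X, x ∈ U ∧ U ≤ V ∧
      {W | ∃ y ∈ (U : Set X) \ S, W = connectedComponentIn ((U : Set X) \ S) y}.Finite) :
    CompactSpace (CutPoint S) := by
  refine ⟨isCompact_iff_ultrafilter_le_nhds.2 fun F _ => ?_⟩
  obtain ⟨x, -, hx⟩ := isCompact_iff_ultrafilter_le_nhds.1 (isCompact_univ (X := X))
    (F.map CutPoint.pt) (by simp)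
  have hU : ∀ U : Opens X, x ∈ U → ∀ᶠ p in (F : Filter (CutPoint S)), p.pt ∈ U := fun U hU =>
    hx (U.isOpen.mem_nhds hU)
  -- Over a small `U` there are finitely many components, so the ultrafilter settles on one of them,
  -- and hence on one over `V`. These components are the sides of the limit point. They are
  -- compatible because any two of them are realised by a common point of the cut space.
  have key : ∀ V : OpenNhdsOf x, ∃ W, ∀ᶠ p in (F : Filter (CutPoint S)), p.LiesIn V.toOpens W := by
    intro V
    obtain ⟨U, hxU, hUV, hfin⟩ := H x V.toOpens V.mem
    have h1 : ∀ᶠ p in (F : Filter (CutPoint S)), ∃ W ∈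
        {W | ∃ y ∈ (U : Set X) \ S, W = connectedComponentIn ((U : Set X) \ S) y}, p.LiesIn U W := by
      filter_upwards [hU U hxU] with p hp
      obtain ⟨y, hy, h⟩ := CutPoint.exists_liesIn p hp
      exact ⟨_, ⟨y, hy, rfl⟩, h⟩
    obtain ⟨W, -, hW⟩ := (Ultrafilter.eventually_exists_mem_iff hfin).1 h1
    obtain ⟨p, hp⟩ := hW.exists
    obtain ⟨z, -, hz⟩ := CutPoint.exists_liesIn p (hUV hp.mem)
    refine ⟨connectedComponentIn ((V.toOpens : Set X) \ S) z, hW.mono fun q hq => ?_⟩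
    obtain ⟨W', h1, h2⟩ := SameSide.mono (p := p) (q := q) ⟨W, hp, hq⟩ hUV
    rwa [CutPoint.liesIn_unique hz h1]
  choose P hP using key
  refine ⟨⟨x, P, fun U => ?_, fun U V hUV => ?_⟩, trivial, ?_⟩
  · obtain ⟨p, hp⟩ := (hP U).exists
    obtain ⟨y, hy, h⟩ := CutPoint.exists_liesIn p hp.mem
    exact ⟨y, hy, CutPoint.liesIn_unique hp h⟩
  · obtain ⟨p, hp, hq⟩ := ((hP U).and (hP V)).exists
    exact hp.subset_of_le hq hUV
  · rw [nhds_generateFrom]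
    refine le_iInf₂ fun A hA => ?_
    obtain ⟨hxA, U, W, rfl⟩ := hA
    obtain ⟨hx', hW⟩ := hxA
    rw [le_principal_iff, ← hW]
    exact hP ⟨U, hx'⟩

/-- Away from the cut there are arbitrarily small neighbourhoods with one component. -/
theorem exists_nhds_of_notMem [LocallyConnectedSpace X] (hS : IsClosed S) {x : X} (hx : x ∉ S)
    {V : Opens X} (hV : x ∈ V) : ∃ U : Opens X, x ∈ U ∧ U ≤ V ∧
      ∀ y ∈ (U : Set X) \ S, connectedComponentIn ((U : Set X) \ S) y = U := by
  have hn : (V : Set X) ∩ Sᶜ ∈ 𝓝 x :=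
    inter_mem (V.isOpen.mem_nhds hV) (hS.isOpen_compl.mem_nhds hx)
  obtain ⟨U, ⟨hUo, hUx, hUc⟩, hUV⟩ := (LocallyConnectedSpace.open_connected_basis x).mem_iff.1 hn
  have hUS : U \ S = U := sdiff_eq_left.2 (Set.disjoint_left.2 fun z hz => (hUV hz).2)
  refine ⟨⟨U, hUo⟩, hUx, fun z hz => (hUV hz).1, fun y hy => ?_⟩
  change connectedComponentIn (U \ S) y = U
  rw [hUS]
  exact Set.Subset.antisymm (connectedComponentIn_subset _ _)
    (hUc.isPreconnected.subset_connectedComponentIn hy.1 subset_rfl)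

/-- Away from the cut there is one point of the cut space over every point. -/
theorem _root_.CutPoint.eq_of_notMem [LocallyConnectedSpace X] (hS : IsClosed S) {p q : CutPoint S}
    (h : p.pt = q.pt) (hp : p.pt ∉ S) : p = q := by
  refine CutPoint.eq_of_sameSide h fun U hU => ?_
  obtain ⟨V, hpV, hVU, hV⟩ := exists_nhds_of_notMem hS hp hU
  have : ∀ r : CutPoint S, r.pt ∈ V → r.LiesIn V V := by
    intro r hr
    obtain ⟨y, hy, h'⟩ := CutPoint.exists_liesIn r hr
    rwa [hV y hy] at h'
  exact ⟨V, hpV, hVU, V, this p hpV, this q (h ▸ hpV)⟩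

end CutPoint

/-! ### Star charts -/

section StarChart

variable {X : Type*} [TopologicalSpace X] {S : Set X} {x : X} {d : ℕ}

/-- `ψ` is a chart onto the unit disc, centred at `x`, in which `S` is a star with `d` legs. -/
structure IsStarChart (S : Set X) (x : X) (d : ℕ) (ψ : OpenPartialHomeomorph X ℂ) : Prop where
  mem_source : x ∈ ψ.source
  map_center : ψ x = 0
  target_eq : ψ.target = Metric.ball 0 1
  mem_iff : ∀ w ∈ ψ.source, w ∈ S ↔ ψ w ∈ starSet d

/-- The part of the domain of a chart that is taken to the disc of radius `ρ`. -/
def disc (ψ : OpenPartialHomeomorph X ℂ) (ρ : ℝ) : Opens X :=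
  ⟨ψ.source ∩ ψ ⁻¹' Metric.ball 0 ρ, ψ.isOpen_inter_preimage Metric.isOpen_ball⟩

/-- The part of `disc ψ ρ` that is taken to the `k`-th sector. -/
def discSector (ψ : OpenPartialHomeomorph X ℂ) (d : ℕ) (ρ : ℝ) (k : Fin d) : Set X :=
  ψ.source ∩ ψ ⁻¹' (Metric.ball 0 ρ ∩ sector d (k : ℕ))

theorem disc_mono (ψ : OpenPartialHomeomorph X ℂ) {ρ ρ' : ℝ} (h : ρ ≤ ρ') : disc ψ ρ ≤ disc ψ ρ' :=
  fun _ hy => ⟨hy.1, Metric.ball_subset_ball h hy.2⟩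

theorem discSector_mono (ψ : OpenPartialHomeomorph X ℂ) (k : Fin d) {ρ ρ' : ℝ} (h : ρ ≤ ρ') :
    discSector ψ d ρ k ⊆ discSector ψ d ρ' k :=
  fun _ hy => ⟨hy.1, Metric.ball_subset_ball h hy.2.1, hy.2.2⟩

namespace IsStarChart

variable {ψ : OpenPartialHomeomorph X ℂ} (hψ : IsStarChart S x d ψ)
include hψ

theorem exists_disc_le {V : Opens X} (hV : x ∈ V) {r : ℝ} (hr : 0 < r) :
    ∃ ρ, 0 < ρ ∧ ρ ≤ 1 ∧ ρ ≤ r ∧ disc ψ ρ ≤ V := by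
  have h1 : ψ.symm ⁻¹' V ∈ 𝓝 (0 : ℂ) := by
    have h0 : (0 : ℂ) ∈ ψ.target := by rw [hψ.target_eq]; simp
    refine (ψ.continuousAt_symm h0).preimage_mem_nhds ?_
    rw [← hψ.map_center, ψ.left_inv hψ.mem_source]
    exact V.isOpen.mem_nhds hV
  obtain ⟨ε, hε, h⟩ := Metric.mem_nhds_iff.1 h1
  refine ⟨min ε (min 1 r), by positivity, (min_le_right _ _).trans (min_le_left _ _),
    (min_le_right _ _).trans (min_le_right _ _), ?_⟩
  rintro y ⟨hy, hy'⟩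
  have := h (Metric.ball_subset_ball (min_le_left _ _) hy')
  rwa [Set.mem_preimage, ψ.left_inv hy] at this

theorem center_mem_disc {ρ : ℝ} (hρ : 0 < ρ) : x ∈ disc ψ ρ :=
  ⟨hψ.mem_source, by rw [Set.mem_preimage, hψ.map_center]; simpa⟩

theorem discSector_eq_image {ρ : ℝ} (hρ : ρ ≤ 1) (k : Fin d) :
    discSector ψ d ρ k = ψ.symm '' (Metric.ball 0 ρ ∩ sector d (k : ℕ)) := by
  rw [discSector, ψ.symm_image_eq_source_inter_preimage]
  rw [hψ.target_eq]
  exact Set.inter_subset_left.trans (Metric.ball_subset_ball hρ)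

theorem discSector_subset (ρ : ℝ) (k : Fin d) : discSector ψ d ρ k ⊆ (disc ψ ρ : Set X) \ S :=
  fun y hy => ⟨⟨hy.1, hy.2.1⟩, fun h => sector_disjoint_starSet hy.2.2 ((hψ.mem_iff y hy.1).1 h)⟩

theorem symm_sectorPt_mem {r ρ : ℝ} (hr : 0 < r) (hr1 : r < 1) (h : r < ρ) (k : Fin d) :
    ψ.symm (sectorPt d (k : ℕ) r) ∈ discSector ψ d ρ k := by
  have ht : sectorPt d (k : ℕ) r ∈ ψ.target := by
    rw [hψ.target_eq, mem_ball_zero_iff, norm_sectorPt _ _ hr]; exact hr1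
  refine ⟨ψ.map_target ht, ?_⟩
  rw [Set.mem_preimage, ψ.right_inv ht]
  exact ⟨by rwa [mem_ball_zero_iff, norm_sectorPt _ _ hr], sectorPt_mem k.pos _ _⟩

/-- The sectors are open, connected and pairwise disjoint, and they cover the disc outside the star.
-/
theorem component_eq {ρ : ℝ} (hρ : 0 < ρ) (hρ1 : ρ ≤ 1) {k : Fin d} {y : X}
    (hy : y ∈ discSector ψ d ρ k) :
    connectedComponentIn ((disc ψ ρ : Set X) \ S) y = discSector ψ d ρ k := by
  have hd : 0 < d := k.pos
  have hsub : Metric.ball (0 : ℂ) ρ ⊆ ψ.target := by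
    rw [hψ.target_eq]; exact Metric.ball_subset_ball hρ1
  refine Set.Subset.antisymm ?_ ?_
  · have ho : ∀ l : Fin d, IsOpen (discSector ψ d ρ l) := fun l =>
      ψ.isOpen_inter_preimage (Metric.isOpen_ball.inter (isOpen_sector _ _))
    refine IsPreconnected.subset_left_of_subset_union (ho k)
      (isOpen_iUnion fun l : {l // l ≠ k} => ho l) ?_ ?_ ?_
      isPreconnected_connectedComponentIn
    · refine Set.disjoint_left.2 fun z hz hz' => ?_
      obtain ⟨⟨l, hl⟩, hz'⟩ := Set.mem_iUnion.1 hz'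
      exact hl (sector_fin_injective hz'.2.2 hz.2.2)
    · intro z hz
      obtain ⟨hz1, hz2⟩ := connectedComponentIn_subset _ _ hz
      obtain ⟨l, hl⟩ := exists_sector hd fun h => hz2 ((hψ.mem_iff z hz1.1).2 h)
      by_cases hlk : l = k
      · subst hlk; exact Or.inl ⟨hz1.1, hz1.2, hl⟩
      · exact Or.inr (Set.mem_iUnion.2 ⟨⟨l, hlk⟩, hz1.1, hz1.2, hl⟩)
    · exact ⟨y, mem_connectedComponentIn (hψ.discSector_subset ρ k hy), hy⟩
  · refine IsPreconnected.subset_connectedComponentIn ?_ hy (hψ.discSector_subset ρ k)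
    rw [hψ.discSector_eq_image hρ1]
    exact (isPreconnected_ball_inter_sector d _ hρ).image _
      (ψ.continuousOn_symm.mono (Set.inter_subset_left.trans hsub))

theorem exists_mem_discSector [NeZero d] {ρ : ℝ} {y : X} (hy : y ∈ (disc ψ ρ : Set X) \ S) :
    ∃ k, y ∈ discSector ψ d ρ k := by
  obtain ⟨l, hl⟩ := exists_sector (Nat.pos_of_ne_zero (NeZero.ne d))
    fun h => hy.2 ((hψ.mem_iff y hy.1.1).2 h)
  exact ⟨l, hy.1.1, hy.1.2, hl⟩

theorem finite_components [NeZero d] {ρ : ℝ} (hρ : 0 < ρ) (hρ1 : ρ ≤ 1) :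
    {W | ∃ y ∈ (disc ψ ρ : Set X) \ S,
      W = connectedComponentIn ((disc ψ ρ : Set X) \ S) y}.Finite := by
  refine (Set.finite_range (discSector ψ d ρ)).subset ?_
  rintro W ⟨y, hy, rfl⟩
  obtain ⟨k, hk⟩ := hψ.exists_mem_discSector hy
  exact ⟨k, (hψ.component_eq hρ hρ1 hk).symm⟩

theorem discSector_injective {ρ : ℝ} (hρ : 0 < ρ) {k l : Fin d}
    (h : discSector ψ d ρ k = discSector ψ d ρ l) : k = l := by
  have h1 := hψ.symm_sectorPt_mem (r := min ρ 1 / 2) (ρ := ρ) (by positivity)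
    (by have := min_le_right ρ 1; linarith) (by have := min_le_left ρ 1; have : 0 < min ρ 1 := by positivity
                                                linarith) k
  have h2 := h ▸ h1
  exact sector_fin_injective h1.2.2 h2.2.2

/-- Over a disc, every point of the cut space lies in one of the sectors. -/
theorem exists_liesIn [NeZero d] {ρ : ℝ} (hρ : 0 < ρ) (hρ1 : ρ ≤ 1) {p : CutPoint S}
    (hp : p.pt ∈ disc ψ ρ) : ∃ k, p.LiesIn (disc ψ ρ) (discSector ψ d ρ k) := by
  obtain ⟨y, hy, h⟩ := CutPoint.exists_liesIn p hp
  obtain ⟨k, hk⟩ := hψ.exists_mem_discSector hy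
  rw [hψ.component_eq hρ hρ1 hk] at h
  exact ⟨k, h⟩

theorem liesIn_of_mem {ρ : ℝ} (hρ : 0 < ρ) (hρ1 : ρ ≤ 1) {p : CutPoint S} {W : Set X}
    (hp : p.LiesIn (disc ψ ρ) W) {y : X} (hy : y ∈ W) {k : Fin d} (hk : ψ y ∈ sector d (k : ℕ)) :
    p.LiesIn (disc ψ ρ) (discSector ψ d ρ k) := by
  have h1 := hp.eq_component hy
  rw [hψ.component_eq hρ hρ1 (k := k) ⟨(hp.subset hy).1.1, (hp.subset hy).1.2, hk⟩] at h1
  rwa [h1] at hp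

/-- The sectors that contain a point of the cut space are the same for all discs. -/
theorem liesIn_disc [NeZero d] {ρ ρ' : ℝ} (hρ' : 0 < ρ') (hρ1' : ρ' ≤ 1)
    {p : CutPoint S} {k : Fin d} (h : p.LiesIn (disc ψ ρ) (discSector ψ d ρ k))
    (hp : p.pt ∈ disc ψ ρ') : p.LiesIn (disc ψ ρ') (discSector ψ d ρ' k) := by
  obtain ⟨l, hl⟩ := hψ.exists_liesIn hρ' hρ1' hp
  have key : l = k := by
    rcases le_total ρ ρ' with hle | hle
    · obtain ⟨y, hy⟩ := h.nonempty
      exact sector_fin_injective (h.subset_of_le hl (disc_mono ψ hle) hy).2.2 hy.2.2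
    · obtain ⟨y, hy⟩ := hl.nonempty
      exact sector_fin_injective hy.2.2 (hl.subset_of_le h (disc_mono ψ hle) hy).2.2
  rwa [key] at hl

theorem liesIn_unique {ρ : ℝ} (hρ : 0 < ρ) {p : CutPoint S} {k l : Fin d}
    (h : p.LiesIn (disc ψ ρ) (discSector ψ d ρ k)) (h' : p.LiesIn (disc ψ ρ) (discSector ψ d ρ l)) :
    k = l :=
  hψ.discSector_injective hρ (CutPoint.liesIn_unique h h')

theorem eq_of_sameSide [NeZero d] {p q : CutPoint S} (hp : p.pt = x) (hq : q.pt = x)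
    (h : SameSide (disc ψ 1) p q) : p = q := by
  refine CutPoint.eq_of_sameSide (hp.trans hq.symm) fun U hU => ?_
  obtain ⟨ρ, h0, h1, -, h2⟩ := hψ.exists_disc_le (hp ▸ hU) one_pos
  have hm := hψ.center_mem_disc h0
  refine ⟨disc ψ ρ, hp ▸ hm, h2, ?_⟩
  obtain ⟨k, hk⟩ := hψ.exists_liesIn one_pos le_rfl (p := p) (hp ▸ hψ.center_mem_disc one_pos)
  obtain ⟨W, hW1, hW2⟩ := h
  obtain rfl := CutPoint.liesIn_unique hW1 hk
  exact ⟨_, hψ.liesIn_disc h0 h1 hk (hp ▸ hm),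
    hψ.liesIn_disc h0 h1 hW2 (hq ▸ hm)⟩

/-- Every sector contains a point of the cut space over the centre. -/
theorem exists_centerPt [NeZero d] (k : Fin d) :
    ∃ p : CutPoint S, p.pt = x ∧ p.LiesIn (disc ψ 1) (discSector ψ d 1 k) := by
  -- The side over `V` is the component containing the `k`-th sector of a disc inside `V`. The
  -- choice of the disc is irrelevant, since the sectors of concentric discs are nested and
  -- connected.
  have H : ∀ V : OpenNhdsOf x, ∃ ρ, 0 < ρ ∧ ρ ≤ 1 ∧ disc ψ ρ ≤ V.toOpens := fun V => by
    obtain ⟨ρ, h0, h1, -, h2⟩ := hψ.exists_disc_le V.mem one_pos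
    exact ⟨ρ, h0, h1, h2⟩
  choose ρ h0 h1 h2 using H
  let y : OpenNhdsOf x → X := fun V => ψ.symm (sectorPt d (k : ℕ) (ρ V / 2))
  have hy : ∀ V, y V ∈ discSector ψ d (ρ V) k := fun V =>
    hψ.symm_sectorPt_mem (by have := h0 V; positivity) (by linarith [h1 V, h0 V]) (by linarith [h0 V]) k
  have hsub : ∀ (V : OpenNhdsOf x) (r : ℝ), disc ψ r ≤ V.toOpens →
      discSector ψ d r k ⊆ (V : Set X) \ S := fun V r hr z hz =>
    ⟨hr (hψ.discSector_subset _ _ hz).1, (hψ.discSector_subset _ _ hz).2⟩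
  have hpc : ∀ r, 0 < r → r ≤ 1 → IsPreconnected (discSector ψ d r k) := fun r hr hr1 => by
    have := hψ.component_eq hr hr1
      (hψ.symm_sectorPt_mem (r := r / 2) (by positivity) (by linarith) (by linarith) k)
    rw [← this]
    exact isPreconnected_connectedComponentIn
  refine ⟨⟨x, fun V => connectedComponentIn ((V : Set X) \ S) (y V), fun V => ⟨y V,
    hsub V _ (h2 V) (hy V), rfl⟩, fun V V' hV => ?_⟩, rfl, ?_⟩
  · have hV'' : disc ψ (ρ V) ≤ V'.toOpens := (h2 V).trans hV
    have e : connectedComponentIn ((V' : Set X) \ S) (y V) =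
        connectedComponentIn ((V' : Set X) \ S) (y V') := by
      rcases le_total (ρ V) (ρ V') with hle | hle
      · exact (connectedComponentIn_eq ((hpc _ (h0 V') (h1 V')).subset_connectedComponentIn (hy V')
          (hsub V' _ (h2 V')) (discSector_mono ψ k hle (hy V)))).symm
      · exact connectedComponentIn_eq ((hpc _ (h0 V) (h1 V)).subset_connectedComponentIn (hy V)
          (hsub V' _ hV'') (discSector_mono ψ k hle (hy V')))
    rw [← e]
    exact connectedComponentIn_mono _ fun z hz => ⟨hV hz.1, hz.2⟩
  · refine ⟨hψ.center_mem_disc one_pos, ?_⟩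
    exact hψ.component_eq one_pos le_rfl (discSector_mono ψ k (h1 _) (hy _))

end IsStarChart
end StarChart

/-! ### Charts of the plane -/

theorem det_eq (D : ℂ →L[ℝ] ℂ) :
    D.det = (D 1).re * (D Complex.I).im - (D 1).im * (D Complex.I).re := by
  rw [ContinuousLinearMap.det, ← LinearMap.det_toMatrix Complex.basisOneI, Matrix.det_fin_two]
  simp [LinearMap.toMatrix_apply]
  ring

theorem exists_rescale {X : Type*} [TopologicalSpace X] (χ : OpenPartialHomeomorph X ℂ) {ε : ℝ}
    (hε : 0 < ε) (h : Metric.ball 0 ε ⊆ χ.target) : ∃ φ : OpenPartialHomeomorph X ℂ,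
      φ.source = χ.source ∩ χ ⁻¹' Metric.ball 0 ε ∧ φ.target = Metric.ball 0 1 ∧
      ∀ w, φ w = χ w / ε := by
  have hε' : (ε : ℂ) ≠ 0 := by exact_mod_cast hε.ne'
  have hb : ∀ w : ℂ, (ε : ℂ)⁻¹ * w ∈ Metric.ball (0 : ℂ) 1 ↔ w ∈ Metric.ball (0 : ℂ) ε := by
    intro w
    rw [mem_ball_zero_iff, mem_ball_zero_iff, norm_mul, norm_inv, Complex.norm_of_nonneg hε.le,
      inv_mul_lt_iff₀ hε, mul_one]
  refine ⟨(χ.trans (Homeomorph.mulLeft₀ (ε : ℂ)⁻¹ (inv_ne_zero hε')).toOpenPartialHomeomorph).trans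
    (OpenPartialHomeomorph.ofSet (Metric.ball 0 1) Metric.isOpen_ball), ?_, ?_, ?_⟩
  · ext w
    simp [-Metric.mem_ball, hb]
  · ext w
    simp [-Metric.mem_ball]
    intro hw
    apply h
    rw [← hb, inv_mul_cancel_left₀ hε']
    exact hw
  · intro w
    simp [div_eq_inv_mul]

/-- `φ'` straightens the star seen by `φ` at the point `z` of its `k`-th leg: the outward direction
becomes the positive real direction. -/
structure IsRayChart (φ : OpenPartialHomeomorph ℂ ℂ) (d : ℕ) [NeZero d] (k : Fin d) (z : ℂ)
    (φ' : OpenPartialHomeomorph ℂ ℂ) : Prop where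
  mem_source : z ∈ φ'.source
  map_center : φ' z = 0
  target_eq : φ'.target = Metric.ball 0 1
  source_subset : φ'.source ⊆ φ.source
  left : ∀ w ∈ φ'.source, 0 < (φ' w).im → φ w ∈ sector d (k : ℕ)
  right : ∀ w ∈ φ'.source, (φ' w).im < 0 → φ w ∈ sector d ((k - 1 : Fin d) : ℕ)
  mem_starSet : ∀ w ∈ φ'.source, φ w ∈ starSet d ↔ (φ' w).im = 0
  re_pos : ∀ w ∈ φ'.source, 0 < (φ' w).re ↔ ‖φ z‖ < ‖φ w‖
  re_neg : ∀ w ∈ φ'.source, (φ' w).re < 0 ↔ ‖φ w‖ < ‖φ z‖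
  hasFDerivAt : ∀ D : ℂ →L[ℝ] ℂ, HasFDerivAt φ D z → 0 < D.det →
    ∃ D' : ℂ →L[ℝ] ℂ, HasFDerivAt φ' D' z ∧ 0 < D'.det

/-- The chart is a rescaling of `log (φ w / φ z)`. Its real part compares `‖φ w‖` with `‖φ z‖`, and
its imaginary part is the angle from the leg. The logarithm is holomorphic with nonzero derivative,
so the Jacobian stays positive. -/
theorem exists_rayChart (φ : OpenPartialHomeomorph ℂ ℂ) {d : ℕ} [NeZero d] (k : Fin d) {z : ℂ}
    (hz : z ∈ φ.source) {r : ℝ} (hr : 0 < r) (h : φ z = r * radius d k) :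
    ∃ φ', IsRayChart φ d k z φ' := by
  set a : ℂ := r * radius d k with ha
  have ha0 : a ≠ 0 := mul_ne_zero (by exact_mod_cast hr.ne') (radius_ne_zero k)
  have hd : (0 : ℝ) < d := by exact_mod_cast Nat.pos_of_ne_zero (NeZero.ne d)
  let χ := (φ.trans (Homeomorph.mulLeft₀ a⁻¹ (inv_ne_zero ha0)).toOpenPartialHomeomorph).trans
    Complex.expOpenPartialHomeomorph.symm
  have hχ : ∀ w, χ w = Complex.log (a⁻¹ * φ w) := fun w => rfl
  have hz0 : a⁻¹ * φ z = 1 := by rw [h]; exact inv_mul_cancel₀ ha0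
  have hzs : z ∈ χ.source := by
    have : (1 : ℂ) ∈ Complex.expOpenPartialHomeomorph.target := Complex.one_mem_slitPlane
    simp [χ, hz, hz0, this]
  have hχz : χ z = 0 := by rw [hχ, hz0, Complex.log_one]
  have ht : χ.target ∈ 𝓝 (0 : ℂ) := χ.open_target.mem_nhds (hχz ▸ χ.map_source hzs)
  obtain ⟨ε', hε', hb⟩ := Metric.mem_nhds_iff.1 ht
  -- Angles below `2π / d` reach only the two sectors next to the leg.
  obtain ⟨ε, hε, hεε, hεd⟩ : ∃ ε, 0 < ε ∧ ε ≤ ε' ∧ ε ≤ 2 * Real.pi / d :=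
    ⟨min ε' (2 * Real.pi / d), by positivity, min_le_left _ _, min_le_right _ _⟩
  obtain ⟨φ', h1, h2, h3⟩ := exists_rescale χ hε ((Metric.ball_subset_ball hεε).trans hb)
  have hεC : (ε : ℂ) ≠ 0 := by exact_mod_cast hε.ne'
  have hsub : φ'.source ⊆ φ.source := by
    rw [h1]; intro w hw
    have := hw.1
    simp [χ] at this
    exact this.1
  have hexp : ∀ w ∈ φ'.source, φ w = a * Complex.exp (ε * φ' w) := by
    intro w hw
    rw [h1] at hw
    have hs := hw.1
    rw [h3, mul_div_cancel₀ _ hεC, hχ, Complex.exp_log, mul_inv_cancel_left₀ ha0]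
    simp only [χ, OpenPartialHomeomorph.trans_source] at hs
    exact Complex.slitPlane_ne_zero hs.2
  have him : ∀ w ∈ φ'.source, |((ε : ℂ) * φ' w).im| < 2 * Real.pi / d := by
    intro w hw
    have h4 : φ' w ∈ Metric.ball (0 : ℂ) 1 := h2 ▸ φ'.map_source hw
    rw [mem_ball_zero_iff] at h4
    have h5 := (Complex.abs_im_le_norm (φ' w)).trans_lt h4
    simp only [Complex.im_ofReal_mul, abs_mul, abs_of_pos hε]
    nlinarith [abs_nonneg (φ' w).im]
  have hnorm : ∀ w ∈ φ'.source, ‖φ w‖ = ‖φ z‖ * Real.exp (ε * (φ' w).re) := by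
    intro w hw
    rw [hexp w hw, norm_mul, Complex.norm_exp, h]
    simp
  have hz1 : 0 < ‖φ z‖ := by rw [h]; exact norm_pos_iff.2 ha0
  refine ⟨φ', ?_, by rw [h3, hχz, zero_div], h2, hsub, ?_, ?_, ?_, ?_, ?_, ?_⟩
  · rw [h1]; exact ⟨hzs, by rw [Set.mem_preimage, hχz]; simpa⟩
  · intro w hw hw'
    rw [hexp w hw, ha]
    refine radius_mul_exp_mem_left k hr ?_ (abs_lt.1 (him w hw)).2
    rw [Complex.im_ofReal_mul]; positivity
  · intro w hw hw'
    rw [hexp w hw, ha]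
    refine radius_mul_exp_mem_right k hr ?_ (abs_lt.1 (him w hw)).1
    rw [Complex.im_ofReal_mul]; exact mul_neg_of_pos_of_neg hε hw'
  · intro w hw
    rw [hexp w hw, ha, radius_mul_exp_mem_starSet k hr (him w hw), Complex.im_ofReal_mul]
    simp [hε.ne']
  · intro w hw
    rw [hnorm w hw, lt_mul_iff_one_lt_right hz1, Real.one_lt_exp_iff, mul_pos_iff_of_pos_left hε]
  · intro w hw
    rw [hnorm w hw, mul_lt_iff_lt_one_right hz1, Real.exp_lt_one_iff]
    constructor <;> intro h <;> nlinarith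
  · intro D hD hdet
    have hg : HasDerivAt (fun u : ℂ => Complex.log (a⁻¹ * u) / ε) (a⁻¹ / ε) (φ z) := by
      have h5 : HasDerivAt (fun u : ℂ => a⁻¹ * u) a⁻¹ (φ z) := by
        simpa using (hasDerivAt_id (φ z)).const_mul a⁻¹
      have h6 := h5.clog (by rw [hz0]; exact Complex.one_mem_slitPlane)
      rw [hz0, div_one] at h6
      exact h6.div_const _
    have h7 := (hg.hasFDerivAt.restrictScalars ℝ).comp z hD
    have h8 : (fun u : ℂ => Complex.log (a⁻¹ * u) / ε) ∘ φ = φ' := by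
      funext w
      simp only [Function.comp, h3, hχ]
    rw [h8] at h7
    refine ⟨_, h7, ?_⟩
    have hc : a⁻¹ / (ε : ℂ) ≠ 0 := div_ne_zero (inv_ne_zero ha0) hεC
    generalize a⁻¹ / (ε : ℂ) = c at hc
    have h9 : 0 < Complex.normSq c := Complex.normSq_pos.2 hc
    rw [det_eq] at hdet ⊢
    simp [Complex.normSq_apply] at h9 ⊢
    nlinarith [mul_pos h9 hdet]

/-! ### Sides of an oriented edge -/

/-- A homeomorphism with positive Jacobian at a point that fixes the positive real direction takes
the upper side of the real axis to itself. -/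
theorem eventually_im_pos {T : ℂ → ℂ} {L : ℂ →L[ℝ] ℂ} (hT : HasFDerivAt T L 0) (h0 : T 0 = 0)
    (hL : 0 < L.det) {α : Type*} {l : Filter α} [l.NeBot] {c : α → ℝ}
    (hc : Tendsto c l (𝓝[>] 0)) (hre : ∀ᶠ t in l, 0 < (T (c t)).re)
    (him : ∀ᶠ t in l, (T (c t)).im = 0) : ∀ᶠ s : ℝ in 𝓝[>] 0, 0 < (T (s * Complex.I)).im := by
  have key : ∀ v : ℂ, Tendsto (fun s : ℝ => s⁻¹ • T (s * v)) (𝓝[>] 0) (𝓝 (L v)) := by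
    intro v
    have h1 : HasDerivAt (fun s : ℝ => (s : ℂ) * v) v 0 := by
      simpa using (Complex.ofRealCLM.hasDerivAt (x := (0 : ℝ))).mul_const v
    have h2 : HasDerivAt (fun s : ℝ => T (s * v)) (L v) 0 := by
      have h3 : HasFDerivAt T L (((0 : ℝ) : ℂ) * v) := by simpa using hT
      exact h3.comp_hasDerivAt (0 : ℝ) h1
    have h4 := (hasDerivAt_iff_tendsto_slope.1 h2).mono_left
      (nhdsWithin_mono _ (fun s (hs : 0 < s) => hs.ne') : 𝓝[>] (0 : ℝ) ≤ 𝓝[≠] 0)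
    refine h4.congr fun s => ?_
    simp [slope_def_module, h0]
  -- Along the points `c t` the values of `T` are real and positive, so `L 1` is real and
  -- nonnegative. Then `det L = (L 1).re * (L I).im > 0` forces `(L I).im > 0`.
  have h1 := (key 1).comp hc
  have h1re : 0 ≤ (L 1).re := by
    refine ge_of_tendsto (Complex.continuous_re.continuousAt.tendsto.comp h1) ?_
    filter_upwards [hre, hc self_mem_nhdsWithin] with t ht hct
    simp only [Set.mem_preimage, Set.mem_Ioi] at hct
    simp only [Function.comp, mul_one, Complex.real_smul, Complex.re_ofReal_mul]
    positivity
  have h1im : (L 1).im = 0 := by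
    refine tendsto_nhds_unique (Complex.continuous_im.continuousAt.tendsto.comp h1) ?_
    refine tendsto_const_nhds.congr' ?_
    filter_upwards [him] with t ht
    simp [ht]
  have hI : 0 < (L Complex.I).im := by
    rw [det_eq, h1im, zero_mul, sub_zero] at hL
    exact pos_of_mul_pos_right hL h1re
  have h2 := (Complex.continuous_im.continuousAt.tendsto.comp (key Complex.I)).eventually
    (lt_mem_nhds hI)
  filter_upwards [h2, self_mem_nhdsWithin] with s hs hs0
  simp only [Set.mem_Ioi] at hs0
  simp only [Function.comp, Complex.real_smul, Complex.im_ofReal_mul] at hs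
  exact pos_of_mul_pos_right hs (inv_nonneg.2 hs0.le)

/-- The points of the curve `e` that follow the parameter `t` in the direction of the
orientation `o`. -/
def ahead {n : ℕ} {Γ : PreChart n} (o : Fin Γ.numEdges → Bool) (e : Fin Γ.numEdges) (t : I) :
    Filter I :=
  if o e then 𝓝[>] t else 𝓝[<] t

theorem ahead_neBot {n : ℕ} {Γ : PreChart n} (o : Fin Γ.numEdges → Bool) (e : Fin Γ.numEdges)
    {t : I} (h0 : 0 < t) (h1 : t < 1) : (ahead o e t).NeBot := by
  unfold ahead
  split_ifs
  · exact nhdsGT_neBot_of_exists_gt ⟨1, h1⟩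
  · exact nhdsLT_neBot_of_exists_lt ⟨0, h0⟩

theorem ahead_le {n : ℕ} {Γ : PreChart n} (o : Fin Γ.numEdges → Bool) (e : Fin Γ.numEdges)
    (t : I) : ahead o e t ≤ 𝓝 t := by
  unfold ahead
  split_ifs
  · exact nhdsWithin_le_nhds
  · exact nhdsWithin_le_nhds

/-- A chart in which the graph is the real axis, near a point of an edge; it has positive Jacobian
at the point, and the edge is oriented in the positive direction. -/
structure IsEdgeChart {n : ℕ} (Γ : PreChart n) (o : Fin Γ.numEdges → Bool) (e : Fin Γ.numEdges)
    (t : I) (φ : OpenPartialHomeomorph ℂ ℂ) : Prop where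
  isStarChart : IsStarChart Γ.support (Γ.curve e t) 2 φ
  hasFDerivAt : ∃ D : ℂ →L[ℝ] ℂ, HasFDerivAt φ D (Γ.curve e t) ∧ 0 < D.det
  re_pos : ∀ᶠ s in ahead o e t, 0 < (φ (Γ.curve e s)).re

/-- The transition map between the charts has positive Jacobian, and both charts send the edge ahead
of the point into the positive real axis. So the transition map takes points just above the origin
to points above the real axis. This makes the left side of an edge independent of the chart. -/
theorem IsEdgeChart.exists_upper {n : ℕ} {Γ : PreChart n} {o : Fin Γ.numEdges → Bool}
    {e : Fin Γ.numEdges} {t : I} (h0 : 0 < t) (h1 : t < 1) {φ φ' : OpenPartialHomeomorph ℂ ℂ}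
    (hφ : IsEdgeChart Γ o e t φ) (hφ' : IsEdgeChart Γ o e t φ') {N : Set ℂ}
    (hN : N ∈ 𝓝 (Γ.curve e t)) :
    ∃ w ∈ N, w ∈ φ.source ∧ w ∈ φ'.source ∧ 0 < (φ w).im ∧ 0 < (φ' w).im := by
  have := ahead_neBot o e h0 h1
  obtain ⟨D, hD, hdet⟩ := hφ.hasFDerivAt
  obtain ⟨D', hD', hdet'⟩ := hφ'.hasFDerivAt
  set z := Γ.curve e t
  have hz := hφ.isStarChart.mem_source
  have hz' := hφ'.isStarChart.mem_source
  have hz0 := hφ.isStarChart.map_center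
  have ht0 : (0 : ℂ) ∈ φ.target := hz0 ▸ φ.map_source hz
  have hs0 : φ.symm 0 = z := by rw [← hz0, φ.left_inv hz]
  let E := D.toContinuousLinearEquivOfDetNeZero hdet.ne'
  have hE : (E : ℂ →L[ℝ] ℂ) = D := ContinuousLinearMap.coe_toContinuousLinearEquivOfDetNeZero _ _
  have hsymm : HasFDerivAt φ.symm (E.symm : ℂ →L[ℝ] ℂ) 0 :=
    φ.hasFDerivAt_symm ht0 (by rw [hs0, hE]; exact hD)
  have hT : HasFDerivAt (φ' ∘ φ.symm) (D'.comp (E.symm : ℂ →L[ℝ] ℂ)) 0 :=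
    HasFDerivAt.comp 0 (by rw [hs0]; exact hD') hsymm
  have hL : 0 < (D'.comp (E.symm : ℂ →L[ℝ] ℂ)).det := by
    have e1 : (D'.comp (E.symm : ℂ →L[ℝ] ℂ)).det * D.det = D'.det := by
      rw [ContinuousLinearMap.det, ContinuousLinearMap.det, ← LinearMap.det_comp]
      congr 1
      ext v
      all_goals simp [← hE]
    nlinarith [mul_pos hdet hdet']
  have hcurve : Tendsto (Γ.curve e) (ahead o e t) (𝓝 z) :=
    ((Γ.curve e).continuous.tendsto t).mono_left (ahead_le o e t)
  have hreal : ∀ φ₁, IsEdgeChart Γ o e t φ₁ → ∀ᶠ s in ahead o e t,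
      Γ.curve e s ∈ φ₁.source ∧ (φ₁ (Γ.curve e s)).im = 0 := by
    intro φ₁ h
    filter_upwards [hcurve (φ₁.open_source.mem_nhds h.isStarChart.mem_source)] with s hs
    exact ⟨hs, mem_starSet_two.1 ((h.isStarChart.mem_iff _ hs).1 ⟨e, s, rfl⟩)⟩
  have hofReal : ∀ᶠ s in ahead o e t,
      (φ' ∘ φ.symm) ((φ (Γ.curve e s)).re : ℂ) = φ' (Γ.curve e s) := by
    filter_upwards [hreal φ hφ] with s hs
    have : ((φ (Γ.curve e s)).re : ℂ) = φ (Γ.curve e s) := Complex.ext rfl (by simp [hs.2])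
    rw [Function.comp, this, φ.left_inv hs.1]
  have hup := eventually_im_pos hT (by simp [hs0, hφ'.isStarChart.map_center, z]) hL
    (l := ahead o e t) (c := fun s => (φ (Γ.curve e s)).re) ?_ ?_ ?_
  · have hpath : Tendsto (fun s : ℝ => φ.symm (s * Complex.I)) (𝓝[>] 0) (𝓝 z) := by
      have h2 : Tendsto (fun s : ℝ => (s : ℂ) * Complex.I) (𝓝[>] 0) (𝓝 0) := by
        have h3 : Continuous (fun s : ℝ => (s : ℂ) * Complex.I) := by fun_prop
        simpa using (h3.tendsto 0).mono_left nhdsWithin_le_nhds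
      have h4 := (φ.continuousAt_symm ht0).tendsto.comp h2
      rwa [hs0] at h4
    have ht : ∀ᶠ s : ℝ in 𝓝[>] 0, (s : ℂ) * Complex.I ∈ φ.target := by
      have h3 : Continuous (fun s : ℝ => (s : ℂ) * Complex.I) := by fun_prop
      have h5 : Tendsto (fun s : ℝ => (s : ℂ) * Complex.I) (𝓝[>] 0) (𝓝 0) := by
        simpa using (h3.tendsto 0).mono_left nhdsWithin_le_nhds
      exact h5 (φ.open_target.mem_nhds ht0)
    obtain ⟨s, h1, h2, h3, h4, h5, h6⟩ := (hup.and ((hpath.eventually hN).and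
      ((hpath.eventually (φ.open_source.mem_nhds hz)).and ((hpath.eventually (φ'.open_source.mem_nhds hz')).and
        (ht.and self_mem_nhdsWithin))))).exists
    refine ⟨_, h2, h3, h4, ?_, h1⟩
    rw [φ.right_inv h5]
    simpa using h6
  · refine tendsto_nhdsWithin_iff.2 ⟨?_, hφ.re_pos⟩
    have h2 := (φ.continuousAt hz).tendsto.comp hcurve
    rw [hz0] at h2
    exact (Complex.continuous_re.tendsto 0).comp h2
  · filter_upwards [hofReal, hφ'.re_pos] with s hs hs'
    rwa [hs]
  · filter_upwards [hofReal, hreal φ' hφ'] with s hs hs'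
    rw [hs, hs'.2]


/-! ### Models: star charts with labelled and oriented legs -/

variable {n : ℕ} {Γ : PermutationChart n}

/-- `φ` is a star chart at `z` with positive Jacobian away from `z`; the `k`-th leg consists of
points of open edges with label `lab k`, oriented outwards if `out k` and inwards otherwise. -/
structure IsModel (Γ : PermutationChart n) (o : Fin Γ.numEdges → Bool) (z : ℂ) (d : ℕ) [NeZero d]
    (φ : OpenPartialHomeomorph ℂ ℂ) (lab : Fin d → ℕ) (out : Fin d → Bool) : Prop where
  isStarChart : IsStarChart Γ.support z d φ
  hasFDerivAt : ∀ w ∈ φ.source, w ≠ z → ∃ D : ℂ →L[ℝ] ℂ, HasFDerivAt φ D w ∧ 0 < D.det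
  exists_edge : ∀ w ∈ φ.source, w ∈ Γ.support → w ≠ z →
    ∃ (e : _) (t : I), 0 < t ∧ t < 1 ∧ Γ.curve e t = w
  leg : ∀ (e) (t : I), Γ.curve e t ∈ φ.source → Γ.curve e t ≠ z →
    ∃ (k : Fin d) (r : ℝ), 0 < r ∧ φ (Γ.curve e t) = r * radius d k ∧ Γ.label e = lab k ∧
      ((out k = o e ∧ ∀ᶠ s in 𝓝 t, (t < s → ‖φ (Γ.curve e t)‖ < ‖φ (Γ.curve e s)‖) ∧
          (s < t → ‖φ (Γ.curve e s)‖ < ‖φ (Γ.curve e t)‖)) ∨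
        (out k = !o e ∧ ∀ᶠ s in 𝓝 t, (t < s → ‖φ (Γ.curve e s)‖ < ‖φ (Γ.curve e t)‖) ∧
          (s < t → ‖φ (Γ.curve e t)‖ < ‖φ (Γ.curve e s)‖)))
  label_center : ∀ (e) (t : I), 0 < t → t < 1 → Γ.curve e t = z → d = 2 ∧ ∀ k, Γ.label e = lab k

/-- Right sides are treated as left sides for the reversed orientation. -/
theorem IsModel.reverse {o : Fin Γ.numEdges → Bool} {z : ℂ} {d : ℕ} [NeZero d]
    {φ : OpenPartialHomeomorph ℂ ℂ} {lab : Fin d → ℕ} {out : Fin d → Bool}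
    (h : IsModel Γ o z d φ lab out) :
    IsModel Γ (fun e => !o e) z d φ lab (fun k => !out k) := by
  refine ⟨h.1, h.2, h.3, fun e t h1 h2 => ?_, h.5⟩
  obtain ⟨k, r, hr, h3, h4, h5⟩ := h.leg e t h1 h2
  refine ⟨k, r, hr, h3, h4, h5.imp ?_ ?_⟩
  · rintro ⟨h6, h7⟩; exact ⟨by rw [h6], h7⟩
  · rintro ⟨h6, h7⟩; exact ⟨by rw [h6], h7⟩

/-! ### Germs of edges -/

/-- A germ of an edge at the parameter `t`: forward if `fwd`, backward otherwise. -/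
structure Germ (Γ : PermutationChart n) where
  e : Fin Γ.numEdges
  t : I
  fwd : Bool

namespace Germ

/-- The sign of the direction of a germ. -/
def sign (g : Germ Γ) : ℝ := if g.fwd then 1 else -1

/-- The curve of a germ. -/
noncomputable def path (g : Germ Γ) (u : ℝ) : ℂ :=
  Set.IccExtend zero_le_one (Γ.curve g.e) (g.t + g.sign * u)

/-- The germ contains points of the edge. -/
def Valid (g : Germ Γ) : Prop := if g.fwd then g.t < 1 else 0 < g.t

theorem path_zero (g : Germ Γ) : g.path 0 = Γ.curve g.e g.t := by
  simp [path]

theorem path_eq (g : Germ Γ) {u : ℝ} {s : I} (h : (s : ℝ) = g.t + g.sign * u) :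
    g.path u = Γ.curve g.e s := by
  rw [path, ← h, Set.IccExtend_val]

theorem continuous_path (g : Germ Γ) : Continuous g.path := by
  have h : Continuous (Set.IccExtend (zero_le_one (α := ℝ)) (Γ.curve g.e)) :=
    (Γ.curve g.e).continuous.Icc_extend'
  exact h.comp (by fun_prop)

/-- The bound `1 / 3` keeps germs at the two ends of an edge from overlapping. -/
theorem Valid.exists_interior {g : Germ Γ} (hg : g.Valid) : ∃ δ, 0 < δ ∧ δ ≤ 1 / 3 ∧
    ∀ u, 0 < u → u ≤ δ → ∃ s : I, 0 < s ∧ s < 1 ∧ (s : ℝ) = g.t + g.sign * u := by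
  obtain ⟨e, t, b⟩ := g
  have ht0 := t.2.1
  have ht1 := t.2.2
  cases b
  · have h : (0 : ℝ) < t := by simpa [Valid] using hg
    refine ⟨min (t / 2) (1 / 3), by positivity, min_le_right _ _, fun u hu hu' => ?_⟩
    have := hu'.trans (min_le_left _ _)
    have h0 : (0 : ℝ) < t - u := by linarith
    have h1 : (t : ℝ) - u < 1 := by linarith
    exact ⟨⟨t - u, h0.le, h1.le⟩, h0, h1, by simp [sign]; ring⟩
  · have h : (t : ℝ) < 1 := by simpa [Valid] using hg
    refine ⟨min ((1 - t) / 2) (1 / 3), by have : (0 : ℝ) < 1 - t := by linarith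
                                          positivity, min_le_right _ _, fun u hu hu' => ?_⟩
    have := hu'.trans (min_le_left _ _)
    have h0 : (0 : ℝ) < t + u := by linarith
    have h1 : (t : ℝ) + u < 1 := by linarith
    exact ⟨⟨t + u, h0.le, h1.le⟩, h0, h1, by simp [sign]⟩

theorem sign_ne_zero (g : Germ Γ) : g.sign ≠ 0 := by
  unfold sign; split_ifs <;> norm_num

/-- The germ runs along the `k`-th leg of the star seen by `φ`. -/
def OnLeg (g : Germ Γ) (φ : OpenPartialHomeomorph ℂ ℂ) {d : ℕ} (k : Fin d) : Prop :=
  ∀ᶠ u in 𝓝[>] (0 : ℝ), g.path u ∈ φ.source ∧ ∃ r : ℝ, 0 < r ∧ φ (g.path u) = r * radius d k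

/-- On a leg a point is determined by its norm, and open edges are embedded, so the norm is
injective along the germ. A continuous injective function on an interval is strictly monotone, and
this one starts at its minimum `0`. -/
theorem OnLeg.exists_strictMonoOn {g : Germ Γ} {φ : OpenPartialHomeomorph ℂ ℂ} {d : ℕ} {k : Fin d}
    (h : g.OnLeg φ k) (hg : g.Valid) (hs : g.path 0 ∈ φ.source) (h0 : φ (g.path 0) = 0) :
    ∃ δ, 0 < δ ∧ δ ≤ 1 / 3 ∧ StrictMonoOn (fun u => ‖φ (g.path u)‖) (Set.Icc 0 δ) ∧
      ContinuousOn (fun u => ‖φ (g.path u)‖) (Set.Icc 0 δ) ∧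
      ∀ u, 0 < u → u ≤ δ → g.path u ∈ φ.source ∧ 0 < ‖φ (g.path u)‖ ∧
        φ (g.path u) = ‖φ (g.path u)‖ * radius d k ∧
        ∃ s : I, 0 < s ∧ s < 1 ∧ (s : ℝ) = g.t + g.sign * u := by
  obtain ⟨δ₁, h1, h2, h3⟩ := hg.exists_interior
  obtain ⟨δ₂, h4, h5⟩ := mem_nhdsGT_iff_exists_Ioc_subset.1 h
  simp only [Set.mem_Ioi] at h4
  set δ := min δ₁ δ₂
  have hδ : 0 < δ := by positivity
  have key : ∀ u, 0 < u → u ≤ δ → g.path u ∈ φ.source ∧ 0 < ‖φ (g.path u)‖ ∧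
        φ (g.path u) = ‖φ (g.path u)‖ * radius d k ∧
        ∃ s : I, 0 < s ∧ s < 1 ∧ (s : ℝ) = g.t + g.sign * u := by
    intro u hu hu'
    obtain ⟨h6, r, hr, h7⟩ := h5 ⟨hu, hu'.trans (min_le_right _ _)⟩
    have h8 : ‖φ (g.path u)‖ = r := by
      rw [h7, norm_mul, norm_radius, Complex.norm_of_nonneg hr.le, mul_one]
    exact ⟨h6, h8 ▸ hr, by rw [h8, h7], h3 u hu (hu'.trans (min_le_left _ _))⟩
  have hc : ContinuousOn (fun u => ‖φ (g.path u)‖) (Set.Icc 0 δ) := by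
    refine ContinuousOn.norm (φ.continuousOn.comp g.continuous_path.continuousOn fun u hu => ?_)
    rcases hu.1.eq_or_lt with rfl | hu0
    · exact hs
    · exact (key u hu0 hu.2).1
  have hinj : Set.InjOn (fun u => ‖φ (g.path u)‖) (Set.Icc 0 δ) := by
    intro u hu v hv huv
    simp only at huv
    rcases hu.1.eq_or_lt with rfl | hu0 <;> rcases hv.1.eq_or_lt with rfl | hv0
    · rfl
    · have := (key v hv0 hv.2).2.1
      rw [← huv, h0, norm_zero] at this
      exact absurd this (lt_irrefl _)
    · have := (key u hu0 hu.2).2.1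
      rw [huv, h0, norm_zero] at this
      exact absurd this (lt_irrefl _)
    · obtain ⟨a1, -, a3, s, a4, a5, a6⟩ := key u hu0 hu.2
      obtain ⟨b1, -, b3, s', b4, b5, b6⟩ := key v hv0 hv.2
      have : g.path u = g.path v := φ.injOn a1 b1 (by rw [a3, b3, huv])
      rw [g.path_eq a6, g.path_eq b6] at this
      obtain ⟨-, rfl⟩ := Γ.curve_inj _ _ _ _ a4 a5 this
      rw [a6] at b6
      exact mul_left_cancel₀ g.sign_ne_zero (add_left_cancel b6)
  refine ⟨δ, hδ, (min_le_left _ _).trans h2, ?_, hc, key⟩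
  refine (hc.strictMonoOn_of_injOn_Icc' hδ.le hinj).resolve_right fun h => ?_
  have := h (Set.left_mem_Icc.2 hδ.le) (Set.right_mem_Icc.2 hδ.le) hδ
  simp only [h0, norm_zero] at this
  exact absurd this (norm_nonneg _).not_gt

/-- Different germs at the centre run along different legs. -/
theorem OnLeg.unique {g g' : Germ Γ} {φ : OpenPartialHomeomorph ℂ ℂ} {d : ℕ} {k : Fin d}
    (h : g.OnLeg φ k) (h' : g'.OnLeg φ k) (hg : g.Valid) (hg' : g'.Valid)
    {z : ℂ} (hz : g.path 0 = z) (hz' : g'.path 0 = z) (hs : z ∈ φ.source) (h0 : φ z = 0) :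
    g = g' := by
  obtain ⟨δ, a1, a2, -, a3, a4⟩ := h.exists_strictMonoOn hg (hz ▸ hs) (hz ▸ h0)
  obtain ⟨δ', b1, b2, -, b3, b4⟩ := h'.exists_strictMonoOn hg' (hz' ▸ hs) (hz' ▸ h0)
  -- Both germs pass the point of the leg at distance `v` from the centre. As open edges are
  -- disjoint and embedded, they have the same edge and the same parameter there.
  obtain ⟨v, hv, hvl, hvr⟩ : ∃ v, 0 < v ∧ v ≤ ‖φ (g.path δ)‖ ∧ v ≤ ‖φ (g'.path δ')‖ :=
    ⟨min _ _, lt_min (a4 δ a1 le_rfl).2.1 (b4 δ' b1 le_rfl).2.1, min_le_left _ _, min_le_right _ _⟩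
  obtain ⟨u, ⟨hu0, hu1⟩, hu⟩ := intermediate_value_Icc a1.le a3
    (show v ∈ Set.Icc _ _ from ⟨by rw [hz, h0, norm_zero]; exact hv.le, hvl⟩)
  obtain ⟨u', ⟨hu0', hu1'⟩, hu'⟩ := intermediate_value_Icc b1.le b3
    (show v ∈ Set.Icc _ _ from ⟨by rw [hz', h0, norm_zero]; exact hv.le, hvr⟩)
  simp only at hu hu'
  have hup : 0 < u := by
    rcases hu0.eq_or_lt with rfl | hlt
    · rw [hz, h0, norm_zero] at hu; exact absurd hu hv.ne
    · exact hlt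
  have hup' : 0 < u' := by
    rcases hu0'.eq_or_lt with rfl | hlt
    · rw [hz', h0, norm_zero] at hu'; exact absurd hu' hv.ne
    · exact hlt
  obtain ⟨c1, -, c3, s, c4, c5, c6⟩ := a4 u hup hu1
  obtain ⟨d1, -, d3, s', d4, d5, d6⟩ := b4 u' hup' hu1'
  have : g.path u = g'.path u' := φ.injOn c1 d1 (by rw [c3, d3, hu, hu'])
  rw [g.path_eq c6, g'.path_eq d6] at this
  obtain ⟨he, rfl⟩ := Γ.curve_inj _ _ _ _ c4 c5 this
  obtain ⟨e, t, b⟩ := g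
  obtain ⟨e', t', b'⟩ := g'
  obtain rfl : e = e' := he
  rw [path_zero] at hz hz'
  simp only at hz hz' c6 d6
  have hval : ∀ r : I, r ≠ 0 → r ≠ 1 → 0 < r ∧ r < 1 := fun r h1 h2 =>
    ⟨unitInterval.pos_iff_ne_zero.2 h1, unitInterval.lt_one_iff_ne_one.2 h2⟩
  -- Distinct parameters over one point can only be the two ends of the edge. No parameter is within
  -- `1 / 3` of both, and opposite germs at one parameter share no point.
  have hlt : (t : ℝ) = t' ∨ ((t : ℝ) = 0 ∧ (t' : ℝ) = 1) ∨ ((t : ℝ) = 1 ∧ (t' : ℝ) = 0) := by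
    by_cases h1 : 0 < t ∧ t < 1
    · left; rw [(Γ.curve_inj e e t t' h1.1 h1.2 (hz.trans hz'.symm)).2]
    by_cases h2 : 0 < t' ∧ t' < 1
    · left; rw [(Γ.curve_inj e e t' t h2.1 h2.2 (hz'.trans hz.symm)).2]
    have e1 : t = 0 ∨ t = 1 := by
      by_contra hcon; push Not at hcon; exact h1 (hval t hcon.1 hcon.2)
    have e2 : t' = 0 ∨ t' = 1 := by
      by_contra hcon; push Not at hcon; exact h2 (hval t' hcon.1 hcon.2)
    rcases e1 with rfl | rfl <;> rcases e2 with rfl | rfl <;> simp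
  have c6' := c6.symm.trans d6
  have hs0 : (0 : ℝ) < s := c4
  have hs1 : (s : ℝ) < 1 := c5
  have htt : (t : ℝ) = t' → t = t' := fun h => Subtype.ext h
  cases b <;> cases b' <;> simp only [sign, Bool.false_eq_true, if_true, if_false] at c6 d6 c6' <;>
    rcases hlt with h | h | h <;> first | (exfalso; linarith) | (rw [htt h])

/-- The parameters at distance at least `δ` from all parameters over `z` form a compact set, so
their images form a closed set that misses `z`. -/
theorem exists_nhds (z : ℂ) {δ : ℝ} (hδ : 0 < δ) : ∃ N : Opens ℂ, z ∈ N ∧ ∀ e s, Γ.curve e s ∈ N →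
    Γ.curve e s ≠ z → ∃ (g : Germ Γ) (u : ℝ), g.Valid ∧ g.path 0 = z ∧ g.e = e ∧ 0 < u ∧ u < δ ∧
      (s : ℝ) = g.t + g.sign * u := by
  let K : Fin Γ.numEdges → Set I := fun e => {s | ∀ t, Γ.curve e t = z → δ ≤ dist s t}
  have hK : ∀ e, IsClosed (Γ.curve e '' K e) := fun e => by
    refine IsCompact.isClosed (IsCompact.image (IsClosed.isCompact ?_) (Γ.curve e).continuous)
    have : K e = ⋂ t ∈ {t | Γ.curve e t = z}, {s | δ ≤ dist s t} := by ext; simp [K]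
    rw [this]
    exact isClosed_biInter fun t _ => isClosed_le continuous_const (continuous_id.dist continuous_const)
  refine ⟨⟨⋂ e, (Γ.curve e '' K e)ᶜ, isOpen_iInter_of_finite fun e => (hK e).isOpen_compl⟩, ?_, ?_⟩
  · refine Set.mem_iInter.2 fun e => ?_
    rintro ⟨s, hs, hsz⟩
    have := hs s hsz
    rw [dist_self] at this
    exact absurd hδ this.not_gt
  · intro e s hs hne
    have h1 : s ∉ K e := fun h => Set.mem_iInter.1 hs e ⟨s, h, rfl⟩
    simp only [K, Set.mem_ofPred_eq, not_forall, not_le] at h1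
    obtain ⟨t, ht, hd⟩ := h1
    have hst : (s : ℝ) ≠ t := fun h => hne (by rw [Subtype.ext h, ht])
    rw [Subtype.dist_eq, Real.dist_eq] at hd
    rcases lt_or_gt_of_ne hst with h | h
    · refine ⟨⟨e, t, false⟩, t - s, ?_, by rw [path_zero]; exact ht, rfl, by linarith, ?_, ?_⟩
      · exact lt_of_le_of_lt s.2.1 h
      · rw [abs_of_neg (by linarith)] at hd; linarith
      · simp [sign]
    · refine ⟨⟨e, t, true⟩, s - t, ?_, by rw [path_zero]; exact ht, rfl, by linarith, ?_, ?_⟩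
      · exact lt_of_lt_of_le h s.2.2
      · rw [abs_of_pos (by linarith)] at hd; linarith
      · simp [sign]

end Germ

/-! ### Existence of models -/

theorem starSet_div {d : ℕ} {ρ : ℝ} (hρ : 0 < ρ) {w : ℂ} : w / ρ ∈ starSet d ↔ w ∈ starSet d := by
  have hρ' : (ρ : ℂ) ≠ 0 := by exact_mod_cast hρ.ne'
  constructor
  · rintro ⟨j, r, hr, h⟩
    exact ⟨j, r * ρ, by positivity, by rw [div_eq_iff hρ'] at h; rw [h]; push_cast; ring⟩
  · rintro ⟨j, r, hr, rfl⟩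
    exact ⟨j, r / ρ, by positivity, by push_cast; ring⟩

theorem det_smul_pos {D : ℂ →L[ℝ] ℂ} (h : 0 < D.det) {c : ℝ} (hc : c ≠ 0) : 0 < (c • D).det := by
  have h2 : 0 < c * c := mul_self_pos.2 hc
  rw [det_eq] at h ⊢
  simp
  nlinarith [mul_pos h2 h]

/-- The chart is shrunk until all of the graph in it, apart from the centre, lies on the initial
pieces of the germs `g k`, where the norm is strictly monotone. Distant parts of the edges then
cannot return to the chart. -/
theorem IsStarChart.exists_isModel {o : Fin Γ.numEdges → Bool} {z : ℂ} {d : ℕ} [NeZero d]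
    {φ : OpenPartialHomeomorph ℂ ℂ} (hφ : IsStarChart Γ.support z d φ)
    (hD : ∀ w ∈ φ.source, w ≠ z → ∃ D : ℂ →L[ℝ] ℂ, HasFDerivAt φ D w ∧ 0 < D.det)
    (g : Fin d → Germ Γ) (hv : ∀ k, (g k).Valid) (hz : ∀ k, (g k).path 0 = z)
    (hleg : ∀ k, (g k).OnLeg φ k) (hall : ∀ g' : Germ Γ, g'.Valid → g'.path 0 = z → ∃ k, g k = g')
    (hlab : ∀ (e) (t : I), 0 < t → t < 1 → Γ.curve e t = z → d = 2 ∧ ∀ k, Γ.label e = Γ.label (g k).e) :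
    ∃ φ', IsModel Γ o z d φ' (fun k => Γ.label (g k).e)
      (fun k => if (g k).fwd then o (g k).e else !o (g k).e) := by
  have H := fun k => (hleg k).exists_strictMonoOn (hv k) ((hz k).symm ▸ hφ.mem_source)
    ((hz k).symm ▸ hφ.map_center)
  choose δ h1 h2 h3 h4 h5 using H
  obtain ⟨δ₀, hδ₀, hδ⟩ : ∃ δ₀, 0 < δ₀ ∧ ∀ k, δ₀ ≤ δ k :=
    ⟨Finset.univ.inf' Finset.univ_nonempty δ, by simpa [Finset.lt_inf'_iff] using h1,
      fun k => Finset.inf'_le _ (Finset.mem_univ k)⟩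
  obtain ⟨N, hzN, hN⟩ := Germ.exists_nhds (Γ := Γ) z hδ₀
  obtain ⟨ρ, hρ, hρ1, -, hρN⟩ := hφ.exists_disc_le hzN one_pos
  obtain ⟨φ', e1, e2, e3⟩ := exists_rescale φ hρ (by
    rw [hφ.target_eq]; exact Metric.ball_subset_ball hρ1)
  have hsub : φ'.source ⊆ φ.source := e1 ▸ Set.inter_subset_left
  have hsubN : φ'.source ⊆ N := fun w hw => by rw [e1] at hw; exact hρN hw
  have hnorm : ∀ w, ‖φ' w‖ = ‖φ w‖ / ρ := fun w => by
    rw [e3, norm_div, Complex.norm_of_nonneg hρ.le]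
  refine ⟨φ', ⟨?_, by rw [e3, hφ.map_center, zero_div], e2, ?_⟩, ?_, ?_, ?_, hlab⟩
  · rw [e1]; exact hφ.center_mem_disc hρ
  · intro w hw
    rw [e3, starSet_div hρ, hφ.mem_iff w (hsub hw)]
  · intro w hw hwz
    obtain ⟨D, h, h'⟩ := hD w (hsub hw) hwz
    refine ⟨ρ⁻¹ • D, ?_, det_smul_pos h' (inv_ne_zero hρ.ne')⟩
    have : (φ' : ℂ → ℂ) = ρ⁻¹ • (φ : ℂ → ℂ) := by
      funext w; rw [e3]; simp [div_eq_inv_mul]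
    rw [this]
    exact h.const_smul _
  · rintro w hw ⟨e, s, rfl⟩ hwz
    obtain ⟨g', u, a1, a2, a3, a4, a5, a6⟩ := hN e s (hsubN hw) hwz
    obtain ⟨k, rfl⟩ := hall g' a1 a2
    obtain ⟨-, -, -, s', b1, b2, b3⟩ := h5 k u a4 (a5.le.trans (hδ k))
    obtain rfl : s = s' := Subtype.ext (a6.trans b3.symm)
    exact ⟨e, s, b1, b2, rfl⟩
  · intro e s hw hwz
    obtain ⟨g', u, a1, a2, a3, a4, a5, a6⟩ := hN e s (hsubN hw) hwz
    obtain ⟨k, rfl⟩ := hall g' a1 a2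
    subst a3
    obtain ⟨b0, b1, b2, -⟩ := h5 k u a4 (a5.le.trans (hδ k))
    have hp := (g k).path_eq a6
    have hnear : ∀ᶠ s' : I in 𝓝 s, ∃ u', 0 < u' ∧ u' < δ k ∧ (s' : ℝ) = (g k).t + (g k).sign * u' := by
      have hc : Continuous fun s' : I => (g k).sign * ((s' : ℝ) - (g k).t) := by fun_prop
      have hsg : (g k).sign * (g k).sign = 1 := by
        unfold Germ.sign; split_ifs <;> norm_num
      have hu : (g k).sign * ((s : ℝ) - (g k).t) = u := by
        rw [a6]; linear_combination u * hsg
      have hm : Set.Ioo 0 (δ k) ∈ 𝓝 ((g k).sign * ((s : ℝ) - (g k).t)) := by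
        rw [hu]; exact Ioo_mem_nhds a4 (a5.trans_le (hδ k))
      filter_upwards [hc.continuousAt.preimage_mem_nhds hm] with s' hs'
      exact ⟨_, hs'.1, hs'.2, by linear_combination (-((s' : ℝ) - (g k).t)) * hsg⟩
    have hmono : ∀ {v v' : ℝ} {r r' : I}, 0 < v → v < δ k → 0 < v' → v' < δ k → v < v' →
        (r : ℝ) = (g k).t + (g k).sign * v → (r' : ℝ) = (g k).t + (g k).sign * v' →
        ‖φ' (Γ.curve (g k).e r)‖ < ‖φ' (Γ.curve (g k).e r')‖ := by
      intro v v' r r' c1 c2 c3 c4 c5 c6 c7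
      rw [hnorm, hnorm, div_lt_div_iff_of_pos_right hρ, ← (g k).path_eq c6, ← (g k).path_eq c7]
      exact h3 k ⟨c1.le, c2.le⟩ ⟨c3.le, c4.le⟩ c5
    refine ⟨k, ‖φ (Γ.curve (g k).e s)‖ / ρ, by rw [← hp]; positivity, ?_, rfl, ?_⟩
    · rw [e3, ← hp, b2]
      simp only [norm_mul, Complex.norm_real, norm_norm, norm_radius, mul_one]
      push_cast; ring
    · have hu' := a5.trans_le (hδ k)
      cases hfwd : (g k).fwd
      · right
        refine ⟨by simp, ?_⟩
        filter_upwards [hnear] with s' ⟨u', f1, f2, f3⟩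
        have hsgn : (g k).sign = -1 := by simp [Germ.sign, hfwd]
        constructor
        · intro (hlt : (s : ℝ) < s')
          rw [a6, f3, hsgn] at hlt
          exact hmono f1 f2 a4 hu' (by linarith) f3 a6
        · intro (hlt : (s' : ℝ) < s)
          rw [a6, f3, hsgn] at hlt
          exact hmono a4 hu' f1 f2 (by linarith) a6 f3
      · left
        refine ⟨by simp, ?_⟩
        filter_upwards [hnear] with s' ⟨u', f1, f2, f3⟩
        have hsgn : (g k).sign = 1 := by simp [Germ.sign, hfwd]
        constructor
        · intro (hlt : (s : ℝ) < s')
          rw [a6, f3, hsgn] at hlt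
          exact hmono a4 hu' f1 f2 (by linarith) a6 f3
        · intro (hlt : (s' : ℝ) < s)
          rw [a6, f3, hsgn] at hlt
          exact hmono f1 f2 a4 hu' (by linarith) f3 a6


theorem isStarChart_of_isStarPicture {z : ℂ} {d : ℕ} {φ : OpenPartialHomeomorph ℂ ℂ}
    (h : Γ.IsStarPicture z d φ) : IsStarChart Γ.support z d φ :=
  ⟨h.1, h.2.1, h.2.2.1, h.2.2.2.2.2⟩

theorem hasFDerivAt_of_isStarPicture {z : ℂ} {d : ℕ} {φ : OpenPartialHomeomorph ℂ ℂ}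
    (h : Γ.IsStarPicture z d φ) (w : ℂ) (hw : w ∈ φ.source) (hwz : w ≠ z) :
    ∃ D : ℂ →L[ℝ] ℂ, HasFDerivAt φ D w ∧ 0 < D.det := by
  refine ⟨fderiv ℝ φ w, ?_, h.2.2.2.2.1 w ⟨hw, hwz⟩⟩
  have hn : φ.source \ {z} ∈ 𝓝 w := (φ.open_source.sdiff isClosed_singleton).mem_nhds ⟨hw, hwz⟩
  exact ((h.2.2.2.1.differentiableOn one_ne_zero).differentiableAt hn).hasFDerivAt

/-- The germ of a half-edge. -/
def halfGerm (h : Γ.HalfEdge) : Germ Γ := ⟨h.1, if h.2 then 1 else 0, !h.2⟩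

theorem halfGerm_valid (h : Γ.HalfEdge) : (halfGerm h).Valid := by
  obtain ⟨e, b⟩ := h
  cases b <;> simp [halfGerm, Germ.Valid]

theorem halfGerm_path (h : Γ.HalfEdge) (u : I) : (halfGerm h).path u = Γ.halfCurve h u := by
  obtain ⟨e, b⟩ := h
  cases b
  · exact Germ.path_eq _ (by simp [halfGerm, Germ.sign])
  · exact Germ.path_eq _ (by simp [halfGerm, Germ.sign]; ring)

theorem halfGerm_path_zero (h : Γ.HalfEdge) : (halfGerm h).path 0 = Γ.halfCurve h 0 := by
  rw [← halfGerm_path]; rfl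

theorem eventually_coe_of_eventually {P : ℂ → Prop} {h : Γ.HalfEdge}
    (H : ∀ᶠ t in 𝓝[>] (0 : I), P (Γ.halfCurve h t)) :
    ∀ᶠ u in 𝓝[>] (0 : ℝ), P ((halfGerm h).path u) := by
  have ht : Tendsto (Set.projIcc (0 : ℝ) 1 zero_le_one) (𝓝[>] 0) (𝓝[>] (0 : I)) := by
    refine tendsto_nhdsWithin_iff.2 ⟨?_, ?_⟩
    · have := (continuous_projIcc (h := zero_le_one (α := ℝ))).tendsto 0
      rw [Set.projIcc_left] at this
      exact this.mono_left nhdsWithin_le_nhds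
    · filter_upwards [Ioc_mem_nhdsGT (zero_lt_one (α := ℝ))] with u hu
      rw [Set.projIcc_of_mem _ ⟨hu.1.le, hu.2⟩]
      exact hu.1
  filter_upwards [ht.eventually H, Ioc_mem_nhdsGT (zero_lt_one (α := ℝ))] with u hu hu1
  rw [Set.projIcc_of_mem _ ⟨hu1.1.le, hu1.2⟩, ← halfGerm_path] at hu
  exact hu

theorem unitInterval_cases (t : I) : t = 0 ∨ t = 1 ∨ (0 < t ∧ t < 1) := by
  by_cases h0 : t = 0
  · exact Or.inl h0
  by_cases h1 : t = 1
  · exact Or.inr (Or.inl h1)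
  exact Or.inr (Or.inr ⟨unitInterval.pos_iff_ne_zero.2 h0, unitInterval.lt_one_iff_ne_one.2 h1⟩)

/-- A vertex whose half-edges are listed in cyclic order has a model. -/
theorem exists_isModel_of_isCyclicOrder (o : Fin Γ.numEdges → Bool) {v : ℂ} {d : ℕ} [NeZero d]
    {half : Fin d → Γ.HalfEdge} (h : Γ.IsCyclicOrder v half) :
    ∃ (φ : _) (out : Fin d → Bool), IsModel Γ o v d φ (fun k => Γ.label (half k).1) out ∧
      ∀ k, out k = true ↔ Γ.IsOutgoing o (half k) := by
  obtain ⟨hb, φ, hφ, hleg⟩ := h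
  have hend : ∀ k, Γ.halfCurve (half k) 0 = v := fun k => hb.mapsTo (Set.mem_univ k)
  have hnot : ∀ e (t : I), 0 < t → t < 1 → Γ.curve e t ≠ v := by
    intro e t h0 h1 he
    have h2 := hend 0
    rw [← he] at h2
    unfold PreChart.halfCurve at h2
    split_ifs at h2
    · have := (Γ.curve_inj _ _ _ _ h0 h1 h2.symm).2
      rw [this] at h1; simp at h1
    · have := (Γ.curve_inj _ _ _ _ h0 h1 h2.symm).2
      rw [this] at h0; simp at h0
  have key := (isStarChart_of_isStarPicture hφ).exists_isModel (o := o)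
    (hasFDerivAt_of_isStarPicture hφ) (fun k => halfGerm (half k))
    (fun k => halfGerm_valid _) (fun k => (halfGerm_path_zero _).trans (hend k))
    (fun k => eventually_coe_of_eventually (P := fun w => w ∈ φ.source ∧
      ∃ r : ℝ, 0 < r ∧ φ w = r * radius d k) (hleg k)) ?_
    (fun e t h0 h1 he => absurd he (hnot e t h0 h1))
  · obtain ⟨φ', h'⟩ := key
    refine ⟨φ', _, h', fun k => ?_⟩
    have : ∀ a b : Bool, (if (!a) = true then b else !b) = true ↔ b ≠ a := by decide
    exact this (half k).2 (o (half k).1)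
  · rintro ⟨e, t, b⟩ hv hz
    have hz' := hz
    rw [Germ.path_zero] at hz'
    have : ∃ h : Γ.HalfEdge, halfGerm h = ⟨e, t, b⟩ := by
      rcases unitInterval_cases t with rfl | rfl | ht
      · refine ⟨(e, false), ?_⟩
        cases b
        · simp [Germ.Valid] at hv
        · simp [halfGerm]
      · refine ⟨(e, true), ?_⟩
        cases b
        · simp [halfGerm]
        · simp [Germ.Valid] at hv
      · exact absurd hz' (hnot e t ht.1 ht.2)
    obtain ⟨h, hh⟩ := this
    rw [← hh, halfGerm_path_zero] at hz
    obtain ⟨k, -, hk⟩ := hb.surjOn hz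
    exact ⟨k, by rw [hk, hh]⟩

theorem radius_two_zero : radius 2 0 = 1 := by simp [radius]

theorem radius_two_one : radius 2 1 = -1 := by
  rw [radius, ← Complex.exp_pi_mul_I]; congr 1; push_cast; simp; ring

/-- The germ stays on the real axis and avoids the origin after its start, so by the intermediate
value theorem its real part keeps one sign. -/
theorem exists_onLeg {z : ℂ} {φ : OpenPartialHomeomorph ℂ ℂ} (hφ : IsStarChart Γ.support z 2 φ)
    {g : Germ Γ} (hv : g.Valid) (hz : g.path 0 = z) : ∃ k : Fin 2, g.OnLeg φ k := by
  obtain ⟨δ, h1, h2, h3⟩ := hv.exists_interior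
  have hs : ∀ᶠ u in 𝓝 (0 : ℝ), g.path u ∈ φ.source :=
    g.continuous_path.continuousAt.preimage_mem_nhds
      (φ.open_source.mem_nhds (hz ▸ hφ.mem_source))
  obtain ⟨ε, hε, hs⟩ := Metric.eventually_nhds_iff_ball.1 hs
  set η := min δ ε
  have hη : 0 < η := by positivity
  have hsrc : ∀ u ∈ Set.Ioo 0 η, g.path u ∈ φ.source := fun u hu => hs u (by
    rw [Metric.mem_ball, Real.dist_eq, sub_zero, abs_of_pos hu.1]
    exact hu.2.trans_le (min_le_right _ _))
  have hsup : ∀ u, g.path u ∈ Γ.support := fun u => ⟨g.e, _, rfl⟩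
  have him : ∀ u ∈ Set.Ioo 0 η, (φ (g.path u)).im = 0 := fun u hu =>
    mem_starSet_two.1 ((hφ.mem_iff _ (hsrc u hu)).1 (hsup u))
  have hre : ∀ u ∈ Set.Ioo 0 η, (φ (g.path u)).re ≠ 0 := by
    intro u hu h0
    have h4 : φ (g.path u) = φ z := by
      rw [hφ.map_center]; exact Complex.ext h0 (him u hu)
    have h5 := φ.injOn (hsrc u hu) hφ.mem_source h4
    obtain ⟨s, h6, h7, h8⟩ := h3 u hu.1 (hu.2.le.trans (min_le_left _ _))
    rw [← hz, g.path_zero, g.path_eq h8] at h5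
    obtain ⟨-, rfl⟩ := Γ.curve_inj _ _ _ _ h6 h7 h5
    have := mul_ne_zero g.sign_ne_zero hu.1.ne'
    exact this (by linarith)
  have hcont : ContinuousOn (fun u => (φ (g.path u)).re) (Set.Ioo 0 η) :=
    Complex.continuous_re.comp_continuousOn
      (φ.continuousOn.comp g.continuous_path.continuousOn hsrc)
  have hmem : Set.Ioo 0 η ∈ 𝓝[>] (0 : ℝ) := Ioo_mem_nhdsGT hη
  have hsign : (∀ u ∈ Set.Ioo 0 η, 0 < (φ (g.path u)).re) ∨
      (∀ u ∈ Set.Ioo 0 η, (φ (g.path u)).re < 0) := by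
    by_contra hcon
    push Not at hcon
    obtain ⟨⟨u, hu, hu'⟩, ⟨v, hv, hv'⟩⟩ := hcon
    obtain ⟨w, hw, hw'⟩ := isPreconnected_Ioo.intermediate_value hu hv hcont ⟨hu', hv'⟩
    exact hre w hw hw'
  rcases hsign with h | h
  · refine ⟨0, ?_⟩
    filter_upwards [hmem] with u hu
    refine ⟨hsrc u hu, _, h u hu, ?_⟩
    rw [radius_two_zero]
    exact Complex.ext (by simp) (by simp [him u hu])
  · refine ⟨1, ?_⟩
    filter_upwards [hmem] with u hu
    refine ⟨hsrc u hu, _, neg_pos.2 (h u hu), ?_⟩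
    rw [radius_two_one]
    exact Complex.ext (by simp) (by simp [him u hu])

/-- The forward and the backward germ run along different legs, hence fill both, and there is no
room for a third germ. One of them follows the parametrization and the other opposes it, so one leg
is outgoing and the other incoming. -/
theorem exists_isModel_of_germs (o : Fin Γ.numEdges → Bool) {z : ℂ}
    {φ : OpenPartialHomeomorph ℂ ℂ} (hφ : Γ.IsStarPicture z 2 φ) {e : Fin Γ.numEdges} {t t' : I}
    (h1 : (⟨e, t, true⟩ : Germ Γ).Valid) (h2 : (⟨e, t', false⟩ : Germ Γ).Valid)
    (ht : Γ.curve e t = z) (ht' : Γ.curve e t' = z) :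
    ∃ (φ' : _) (out : Fin 2 → Bool), IsModel Γ o z 2 φ' (fun _ => Γ.label e) out ∧
      out 1 = !out 0 := by
  have hφ' := isStarChart_of_isStarPicture hφ
  have hz1 : (⟨e, t, true⟩ : Germ Γ).path 0 = z := (Germ.path_zero _).trans ht
  have hz2 : (⟨e, t', false⟩ : Germ Γ).path 0 = z := (Germ.path_zero _).trans ht'
  obtain ⟨k₁, hk₁⟩ := exists_onLeg hφ' h1 hz1
  obtain ⟨k₂, hk₂⟩ := exists_onLeg hφ' h2 hz2
  have hne : k₁ ≠ k₂ := by
    rintro rfl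
    have := hk₁.unique hk₂ h1 h2 hz1 hz2 hφ'.mem_source hφ'.map_center
    simp at this
  let g : Fin 2 → Germ Γ := fun k => if k = k₁ then ⟨e, t, true⟩ else ⟨e, t', false⟩
  have hg1 : g k₁ = ⟨e, t, true⟩ := if_pos rfl
  have hg2 : g k₂ = ⟨e, t', false⟩ := if_neg hne.symm
  have hk : ∀ k, k = k₁ ∨ k = k₂ := by omega
  have hge : ∀ k, (g k).e = e := fun k => by
    rcases hk k with rfl | rfl
    · rw [hg1]
    · rw [hg2]
  have hall : ∀ g' : Germ Γ, g'.Valid → g'.path 0 = z → ∃ k, g k = g' := by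
    intro g' hv hz
    obtain ⟨k, hk'⟩ := exists_onLeg hφ' hv hz
    rcases hk k with rfl | rfl
    · exact ⟨k, by rw [hg1, hk'.unique hk₁ hv h1 hz hz1 hφ'.mem_source hφ'.map_center]⟩
    · exact ⟨k, by rw [hg2, hk'.unique hk₂ hv h2 hz hz2 hφ'.mem_source hφ'.map_center]⟩
  obtain ⟨φ'', h⟩ := hφ'.exists_isModel (o := o) (hasFDerivAt_of_isStarPicture hφ) g
    (fun k => by rcases hk k with rfl | rfl <;> simp only [hg1, hg2, h1, h2])
    (fun k => by rcases hk k with rfl | rfl <;> simp only [hg1, hg2, hz1, hz2])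
    (fun k => by rcases hk k with rfl | rfl <;> simp only [hg1, hg2, hk₁, hk₂]) hall
    (fun e' s hs0 hs1 hs => by
      obtain ⟨k, hk'⟩ := hall ⟨e', s, true⟩ hs1 ((Germ.path_zero _).trans hs)
      have : e' = e := by rw [← hge k, hk']
      exact ⟨rfl, fun l => by rw [hge, this]⟩)
  simp only [hge] at h
  refine ⟨φ'', _, h, ?_⟩
  have h01 : (k₁ = 0 ∧ k₂ = 1) ∨ (k₁ = 1 ∧ k₂ = 0) := by omega
  rcases h01 with ⟨rfl, rfl⟩ | ⟨rfl, rfl⟩ <;> simp [hg1, hg2]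

/-- A point of the graph that is not a vertex has a model. -/
theorem exists_isModel_of_notMem_vertex (o : Fin Γ.numEdges → Bool) {z : ℂ} (hz : z ∈ Γ.support)
    (hv : z ∉ Γ.vertex) : ∃ (φ : _) (i : ℕ) (out : Fin 2 → Bool), i + 1 < n ∧
      IsModel Γ o z 2 φ (fun _ => i) out ∧ out 1 = !out 0 := by
  obtain ⟨φ, hφ⟩ := Γ.locally_line z hz hv
  obtain ⟨e, t, ht⟩ := hz
  have hends : Γ.curve e 0 = z ∨ Γ.curve e 1 = z → Γ.curve e 0 = z ∧ Γ.curve e 1 = z := by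
    intro h
    rcases Γ.curve_ends e with ⟨h0, h1⟩ | ⟨h0, -⟩
    · rcases h with rfl | rfl <;> contradiction
    · rcases h with h | h
      · exact ⟨h, h0 ▸ h⟩
      · exact ⟨h0.trans h, h⟩
  -- At the base point of a closed curve the forward germ starts at `0` and the backward germ at
  -- `1`.
  have key : ∃ t t' : I, t < 1 ∧ 0 < t' ∧ Γ.curve e t = z ∧ Γ.curve e t' = z := by
    rcases unitInterval_cases t with rfl | rfl | h
    · exact ⟨0, 1, zero_lt_one, zero_lt_one, ht, (hends (Or.inl ht)).2⟩
    · exact ⟨0, 1, zero_lt_one, zero_lt_one, (hends (Or.inr ht)).1, ht⟩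
    · exact ⟨t, t, h.2, h.1, ht, ht⟩
  obtain ⟨t₁, t₂, h1, h2, h3, h4⟩ := key
  obtain ⟨φ', out, h⟩ := exists_isModel_of_germs o hφ (e := e) (t := t₁) (t' := t₂) h1 h2 h3 h4
  exact ⟨φ', _, out, Γ.label_lt e, h⟩


/-! ### Edge charts near the legs of a model -/

theorem mem_sector_two_zero_iff {w : ℂ} : w ∈ sector 2 0 ↔ 0 < w.im := by
  refine ⟨fun h => ?_, mem_sector_two_zero⟩
  by_contra h0
  rcases (not_lt.1 h0).lt_or_eq with h1 | h1
  · have := sector_disjoint two_pos h (mem_sector_two_one h1)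
    omega
  · exact sector_disjoint_starSet h (mem_starSet_two.2 h1)

theorem mem_sector_two_one_iff {w : ℂ} : w ∈ sector 2 1 ↔ w.im < 0 := by
  refine ⟨fun h => ?_, mem_sector_two_one⟩
  by_contra h0
  rcases (not_lt.1 h0).lt_or_eq with h1 | h1
  · have := sector_disjoint two_pos (mem_sector_two_zero h1) h
    omega
  · exact sector_disjoint_starSet h (mem_starSet_two.2 h1.symm)

/-- The side of the `k`-th leg that is on the left for an orientation. -/
def leftSector {d : ℕ} [NeZero d] (out : Fin d → Bool) (k : Fin d) : Fin d :=
  if out k then k else k - 1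

/-- The side of the `k`-th leg that is on the right for an orientation. -/
def rightSector {d : ℕ} [NeZero d] (out : Fin d → Bool) (k : Fin d) : Fin d :=
  if out k then k - 1 else k

/-- Near a point of a leg, a model provides an edge chart. -/
theorem IsModel.exists_isEdgeChart {o : Fin Γ.numEdges → Bool} {z : ℂ} {d : ℕ} [NeZero d]
    {φ : OpenPartialHomeomorph ℂ ℂ} {lab : Fin d → ℕ} {out : Fin d → Bool}
    (h : IsModel Γ o z d φ lab out) {e : Fin Γ.numEdges} {t : I}
    (hs : Γ.curve e t ∈ φ.source) (hz : Γ.curve e t ≠ z) :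
    ∃ (k : Fin d) (χ : OpenPartialHomeomorph ℂ ℂ), Γ.label e = lab k ∧
      (∃ r : ℝ, 0 < r ∧ φ (Γ.curve e t) = r * radius d k) ∧ IsEdgeChart Γ.toPreChart o e t χ ∧
      χ.source ⊆ φ.source ∧
      (∀ w ∈ χ.source, 0 < (χ w).im → φ w ∈ sector d (leftSector out k : ℕ)) ∧
      (∀ w ∈ χ.source, (χ w).im < 0 → φ w ∈ sector d (rightSector out k : ℕ)) := by
  obtain ⟨k, r, hr, h1, h2, h3⟩ := h.leg e t hs hz
  obtain ⟨φ', h'⟩ := exists_rayChart φ k hs hr h1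
  obtain ⟨D, hD, hdet⟩ := h.hasFDerivAt _ hs hz
  obtain ⟨D', hD', hdet'⟩ := h'.hasFDerivAt D hD hdet
  have hstar : ∀ w ∈ φ'.source, w ∈ Γ.support ↔ (φ' w).im = 0 := fun w hw => by
    rw [h.isStarChart.mem_iff w (h'.source_subset hw), h'.mem_starSet w hw]
  have hnear : ∀ᶠ s in ahead (Γ := Γ.toPreChart) o e t, Γ.curve e s ∈ φ'.source :=
    ((Γ.curve e).continuous.tendsto t).mono_left (ahead_le _ _ _)
      (φ'.open_source.mem_nhds h'.mem_source)
  have hle := ahead_le (Γ := Γ.toPreChart) o e t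
  cases hk : out k
  -- On an incoming leg the chart is turned by `π`, so that the edge runs in the positive direction;
  -- this exchanges the two sides.
  · let ν := φ'.trans (Homeomorph.neg ℂ).toOpenPartialHomeomorph
    have hν : ∀ w, ν w = -φ' w := fun w => rfl
    have hνs : ν.source = φ'.source := by simp [ν]
    refine ⟨k, ν, h2, ⟨r, hr, h1⟩, ⟨⟨by rw [hνs]; exact h'.mem_source, by
      rw [hν, h'.map_center, neg_zero], ?_, fun w hw => ?_⟩, ⟨-D', hD'.neg, ?_⟩, ?_⟩,
      hνs ▸ h'.source_subset, fun w hw hw' => ?_, fun w hw hw' => ?_⟩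
    · ext w
      simp [ν, h'.target_eq]
    · rw [hνs] at hw
      rw [hstar w hw, mem_starSet_two, hν, Complex.neg_im, neg_eq_zero]
    · rw [show -D' = (-1 : ℝ) • D' from (neg_one_smul ℝ D').symm]
      exact det_smul_pos hdet' (by norm_num)
    · have key : ∀ᶠ s in ahead (Γ := Γ.toPreChart) o e t,
          ‖φ (Γ.curve e s)‖ < ‖φ (Γ.curve e t)‖ := by
        rcases h3 with ⟨h4, h5⟩ | ⟨h4, h5⟩
        · have ho : o e = false := by rw [← h4, hk]
          simp only [ahead, ho, Bool.false_eq_true, if_false] at hle ⊢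
          filter_upwards [hle h5, self_mem_nhdsWithin] with s h6 h7 using h6.2 h7
        · have ho : o e = true := by simpa [hk] using h4
          simp only [ahead, ho, if_true] at hle ⊢
          filter_upwards [hle h5, self_mem_nhdsWithin] with s h6 h7 using h6.1 h7
      filter_upwards [key, hnear] with s h6 h7
      rw [hν, Complex.neg_re, neg_pos]
      exact (h'.re_neg _ h7).2 h6
    · rw [leftSector, hk]
      exact h'.right w (hνs ▸ hw) (by simpa [hν] using hw')
    · rw [rightSector, hk]
      exact h'.left w (hνs ▸ hw) (by simpa [hν] using hw')
  · refine ⟨k, φ', h2, ⟨r, hr, h1⟩, ⟨⟨h'.mem_source, h'.map_center, h'.target_eq, fun w hw => ?_⟩,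
      ⟨D', hD', hdet'⟩, ?_⟩, h'.source_subset, fun w hw hw' => ?_, fun w hw hw' => ?_⟩
    · rw [hstar w hw, mem_starSet_two]
    · have key : ∀ᶠ s in ahead (Γ := Γ.toPreChart) o e t,
          ‖φ (Γ.curve e t)‖ < ‖φ (Γ.curve e s)‖ := by
        rcases h3 with ⟨h4, h5⟩ | ⟨h4, h5⟩
        · have ho : o e = true := by rw [← h4, hk]
          simp only [ahead, ho, if_true] at hle ⊢
          filter_upwards [hle h5, self_mem_nhdsWithin] with s h6 h7 using h6.1 h7
        · have ho : o e = false := by simpa [hk] using h4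
          simp only [ahead, ho, Bool.false_eq_true, if_false] at hle ⊢
          filter_upwards [hle h5, self_mem_nhdsWithin] with s h6 h7 using h6.2 h7
      filter_upwards [key, hnear] with s h6 h7
      exact (h'.re_pos _ h7).2 h6
    · rw [leftSector, hk]
      exact h'.left w hw hw'
    · rw [rightSector, hk]
      exact h'.right w hw hw'

/-! ### Charts of the sphere -/

variable {ι : ℂ → Sphere2} (hι : Topology.IsOpenEmbedding ι)

/-- The chart of the sphere induced by a chart of the plane. -/
noncomputable def sphereChart (φ : OpenPartialHomeomorph ℂ ℂ) : OpenPartialHomeomorph Sphere2 ℂ :=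
  (hι.toOpenPartialHomeomorph ι).symm.trans φ

theorem sphereChart_apply (φ : OpenPartialHomeomorph ℂ ℂ) (w : ℂ) :
    sphereChart hι φ (ι w) = φ w := by
  have : (hι.toOpenPartialHomeomorph ι).symm (ι w) = w :=
    (hι.toOpenPartialHomeomorph ι).left_inv (by simp)
  simp [sphereChart, this]

theorem sphereChart_source (φ : OpenPartialHomeomorph ℂ ℂ) :
    (sphereChart hι φ).source = ι '' φ.source := by
  ext x
  simp only [sphereChart, OpenPartialHomeomorph.trans_source, OpenPartialHomeomorph.symm_source,
    Topology.IsOpenEmbedding.toOpenPartialHomeomorph_target, Set.mem_inter_iff, Set.mem_range,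
    Set.mem_preimage]
  constructor
  · rintro ⟨⟨w, rfl⟩, h⟩
    have : (hι.toOpenPartialHomeomorph ι).symm (ι w) = w :=
      (hι.toOpenPartialHomeomorph ι).left_inv (by simp)
    exact ⟨w, by rwa [this] at h, rfl⟩
  · rintro ⟨w, h, rfl⟩
    have : (hι.toOpenPartialHomeomorph ι).symm (ι w) = w :=
      (hι.toOpenPartialHomeomorph ι).left_inv (by simp)
    exact ⟨⟨w, rfl⟩, by rwa [this]⟩

theorem mem_sphereChart_source {φ : OpenPartialHomeomorph ℂ ℂ} {w : ℂ} :
    ι w ∈ (sphereChart hι φ).source ↔ w ∈ φ.source := by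
  rw [sphereChart_source, hι.injective.mem_set_image]

theorem sphereChart_target (φ : OpenPartialHomeomorph ℂ ℂ) :
    (sphereChart hι φ).target = φ.target := by
  ext w
  simp [sphereChart]

theorem IsStarChart.sphere {S : Set ℂ} {z : ℂ} {d : ℕ} {φ : OpenPartialHomeomorph ℂ ℂ}
    (h : IsStarChart S z d φ) : IsStarChart (ι '' S) (ι z) d (sphereChart hι φ) := by
  refine ⟨(mem_sphereChart_source hι).2 h.mem_source, by rw [sphereChart_apply, h.map_center],
    by rw [sphereChart_target, h.target_eq], ?_⟩
  intro x hx
  rw [sphereChart_source] at hx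
  obtain ⟨w, hw, rfl⟩ := hx
  rw [hι.injective.mem_set_image, sphereChart_apply, h.mem_iff w hw]

theorem mem_disc_sphereChart {S : Set ℂ} {z : ℂ} {d : ℕ} {φ : OpenPartialHomeomorph ℂ ℂ}
    (h : IsStarChart S z d φ) {w : ℂ} : ι w ∈ disc (sphereChart hι φ) 1 ↔ w ∈ φ.source := by
  constructor
  · exact fun h' => (mem_sphereChart_source hι).1 h'.1
  · intro hw
    refine ⟨(mem_sphereChart_source hι).2 hw, ?_⟩
    rw [Set.mem_preimage, sphereChart_apply, ← h.target_eq]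
    exact φ.map_source hw

/-! ### The left side of an edge -/

/-- The point `a` of the cut sphere lies in the `k`-th sector of the chart `φ`. -/
def InSector (φ : OpenPartialHomeomorph ℂ ℂ) {d : ℕ} (k : Fin d) (a : Γ.CutSphere ι) : Prop :=
  a.LiesIn (disc (sphereChart hι φ) 1) (discSector (sphereChart hι φ) d 1 k)

theorem IsStarChart.exists_inSector {z : ℂ} {d : ℕ} [NeZero d] {φ : OpenPartialHomeomorph ℂ ℂ}
    (h : IsStarChart Γ.support z d φ) {a : Γ.CutSphere ι}
    (ha : a.pt ∈ disc (sphereChart hι φ) 1) : ∃ k : Fin d, InSector hι φ k a :=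
  (h.sphere hι).exists_liesIn one_pos le_rfl ha

theorem IsStarChart.inSector_unique {z : ℂ} {d : ℕ} {φ : OpenPartialHomeomorph ℂ ℂ}
    (h : IsStarChart Γ.support z d φ) {a : Γ.CutSphere ι} {k l : Fin d} (h1 : InSector hι φ k a)
    (h2 : InSector hι φ l a) : k = l :=
  (h.sphere hι).liesIn_unique one_pos h1 h2

theorem IsStarChart.eq_of_inSector {z : ℂ} {d : ℕ} [NeZero d] {φ : OpenPartialHomeomorph ℂ ℂ}
    (h : IsStarChart Γ.support z d φ) {a b : Γ.CutSphere ι} {k : Fin d} (ha : a.pt = ι z)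
    (hb : b.pt = ι z) (h1 : InSector hι φ k a) (h2 : InSector hι φ k b) : a = b :=
  (h.sphere hι).eq_of_sameSide ha hb ⟨_, h1, h2⟩

/-- Two edge charts at the same point have the same left side. -/
theorem IsEdgeChart.inSector_zero {o : Fin Γ.numEdges → Bool} {e : Fin Γ.numEdges} {t : I}
    (h0 : 0 < t) (h1 : t < 1) {χ χ' : OpenPartialHomeomorph ℂ ℂ}
    (h : IsEdgeChart Γ.toPreChart o e t χ) (h' : IsEdgeChart Γ.toPreChart o e t χ')
    {a : Γ.CutSphere ι} (ha : a.pt = ι (Γ.curve e t)) (hl : InSector hι χ (0 : Fin 2) a) :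
    InSector hι χ' (0 : Fin 2) a := by
  have hs := h.isStarChart.sphere hι
  have hs' := h'.isStarChart.sphere hι
  obtain ⟨ρ, hρ, hρ1, -, hle⟩ := hs.exists_disc_le (hs'.center_mem_disc one_pos) one_pos
  have hm := hs.center_mem_disc hρ
  have h2 := hs.liesIn_disc hρ hρ1 hl (ha ▸ hm)
  obtain ⟨y, -, h3⟩ := CutPoint.exists_liesIn a (ha ▸ hs'.center_mem_disc one_pos)
  obtain ⟨w, hw, h4, h5, h6, h7⟩ := h.exists_upper h0 h1 h'
    (hι.continuous.continuousAt.preimage_mem_nhds ((disc _ ρ).isOpen.mem_nhds hm))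
  have h8 : ι w ∈ discSector (sphereChart hι χ) 2 ρ 0 := by
    refine ⟨hw.1, hw.2, ?_⟩
    rw [sphereChart_apply]
    exact mem_sector_two_zero_iff.2 h6
  refine hs'.liesIn_of_mem one_pos le_rfl h3 (h2.subset_of_le h3 hle h8) ?_
  rw [sphereChart_apply]
  exact mem_sector_two_zero_iff.2 h7

/-- The point `p` of the cut sphere is adjacent to an edge with label `i`, which runs with `p` on
its left. -/
def IsLeft (o : Fin Γ.numEdges → Bool) (i : ℕ) (p : Γ.CutSphere ι) : Prop :=
  ∀ U : Opens Sphere2, p.pt ∈ U → ∃ (a : Γ.CutSphere ι) (e : _) (t : I), Γ.label e = i ∧ 0 < t ∧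
    t < 1 ∧ a.pt = ι (Γ.curve e t) ∧ a.pt ≠ p.pt ∧ SameSide U p a ∧
    ∃ χ, IsEdgeChart Γ.toPreChart o e t χ ∧ InSector hι χ (0 : Fin 2) a

theorem inSector_of_inSector {φ χ : OpenPartialHomeomorph ℂ ℂ} {z : ℂ} {d d' : ℕ} {k : Fin d}
    {l : Fin d'}
    (hφ : IsStarChart Γ.support z d φ) (hsub : χ.source ⊆ φ.source)
    (h : ∀ w ∈ χ.source, χ w ∈ sector d' (l : ℕ) → φ w ∈ sector d (k : ℕ)) {a : Γ.CutSphere ι}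
    (ha : InSector hι χ l a) : InSector hι φ k a := by
  have hle : disc (sphereChart hι χ) 1 ≤ disc (sphereChart hι φ) 1 := by
    rintro x ⟨hx, -⟩
    rw [sphereChart_source] at hx
    obtain ⟨w, hw, rfl⟩ := hx
    exact (mem_disc_sphereChart hι hφ).2 (hsub hw)
  obtain ⟨y, -, h3⟩ := CutPoint.exists_liesIn a (hle ha.mem)
  obtain ⟨x, hx⟩ := ha.nonempty
  have hx' := hx.1
  rw [sphereChart_source] at hx'
  obtain ⟨w, hw, rfl⟩ := hx'
  refine (hφ.sphere hι).liesIn_of_mem one_pos le_rfl h3 (ha.subset_of_le h3 hle hx) ?_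
  have h4 := hx.2.2
  rw [sphereChart_apply] at h4 ⊢
  exact h w hw h4

/-! ### Left sides and facing points in terms of sectors -/

section Model

variable {o : Fin Γ.numEdges → Bool} {z : ℂ} {d : ℕ} [NeZero d]
  {φ : OpenPartialHomeomorph ℂ ℂ} {lab : Fin d → ℕ} {out : Fin d → Bool}

/-- Near a point of a leg, the two sides of the leg are points of the cut sphere in the two adjacent
sectors. -/
theorem IsModel.exists_sides (h : IsModel Γ o z d φ lab out) {e : Fin Γ.numEdges} {t : I}
    (hs : Γ.curve e t ∈ φ.source) (hz : Γ.curve e t ≠ z) :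
    ∃ (k : Fin d) (χ : OpenPartialHomeomorph ℂ ℂ), Γ.label e = lab k ∧
      (∃ r : ℝ, 0 < r ∧ φ (Γ.curve e t) = r * radius d k) ∧ IsEdgeChart Γ.toPreChart o e t χ ∧
      (∀ a : Γ.CutSphere ι, InSector hι χ (0 : Fin 2) a → InSector hι φ (leftSector out k) a) ∧
      (∀ a : Γ.CutSphere ι, InSector hι χ (1 : Fin 2) a → InSector hι φ (rightSector out k) a) := by
  obtain ⟨k, χ, h1, h2, h3, h4, h5, h6⟩ := h.exists_isEdgeChart hs hz
  exact ⟨k, χ, h1, h2, h3, fun a ha => inSector_of_inSector hι h.isStarChart h4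
    (fun w hw hw' => h5 w hw (mem_sector_two_zero_iff.1 hw')) ha,
    fun a ha => inSector_of_inSector hι h.isStarChart h4
    (fun w hw hw' => h6 w hw (mem_sector_two_one_iff.1 hw')) ha⟩

theorem IsModel.inSector_of_isLeft (h : IsModel Γ o z d φ lab out) {i : ℕ} {p : Γ.CutSphere ι}
    (hp : p.pt ∈ disc (sphereChart hι φ) 1) (hl : IsLeft hι o i p) :
    ∃ k, lab k = i ∧ InSector hι φ (leftSector out k) p := by
  -- If `p` is not over the centre, `U` avoids the centre; if it is, `a.pt ≠ p.pt` does so. In both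
  -- cases `a` lies over a leg, whose left sector is known.
  obtain ⟨U, hpU, hU, hUz⟩ : ∃ U : Opens Sphere2, p.pt ∈ U ∧ U ≤ disc (sphereChart hι φ) 1 ∧
      (p.pt ≠ ι z → ι z ∉ U) := by
    by_cases hz : p.pt = ι z
    · exact ⟨_, hp, le_rfl, fun h => absurd hz h⟩
    · exact ⟨disc (sphereChart hι φ) 1 ⊓ ⟨{ι z}ᶜ, isOpen_compl_singleton⟩, ⟨hp, hz⟩, inf_le_left,
        fun _ h => h.2 rfl⟩
  obtain ⟨a, e, t, h1, h2, h3, h4, h5, h6, χ, h7, h8⟩ := hl U hpU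
  have haU : a.pt ∈ U := by obtain ⟨W, -, hW⟩ := h6; exact hW.mem
  have hne : Γ.curve e t ≠ z := by
    intro he
    rw [he] at h4
    by_cases hz : p.pt = ι z
    · exact h5 (h4.trans hz.symm)
    · exact hUz hz (h4 ▸ haU)
  have hsrc : Γ.curve e t ∈ φ.source :=
    (mem_disc_sphereChart hι h.isStarChart).1 (h4 ▸ hU haU)
  obtain ⟨k, χ', g1, -, g3, g4, -⟩ := h.exists_sides hι hsrc hne
  refine ⟨k, g1.symm.trans h1, ?_⟩
  have h9 := g4 a (h7.inSector_zero hι h2 h3 g3 h4 h8)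
  obtain ⟨W, hW1, hW2⟩ := h6.mono hU
  rwa [CutPoint.liesIn_unique hW2 h9] at hW1

theorem fin_two_eq_sub_one {k l : Fin 2} (h : k ≠ l) : l = k - 1 := by
  revert k l; decide

theorem IsModel.inSector_of_facing (h : IsModel Γ o z d φ lab out) {i : ℕ} {p q : Γ.CutSphere ι}
    (hp : p.pt ∈ disc (sphereChart hι φ) 1) (hf : Γ.Facing ι i p q) :
    ∃ k, lab k = i ∧ ((InSector hι φ k p ∧ InSector hι φ (k - 1) q) ∨
      (InSector hι φ (k - 1) p ∧ InSector hι φ k q)) := by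
  obtain ⟨a, b, hab, hpt, ⟨w, ⟨e, t, he, h0, h1, rfl⟩, hw⟩, hpa, hqb⟩ := hf.2 _ hp
  have haU : a.pt ∈ disc (sphereChart hι φ) 1 := by obtain ⟨W, -, hW⟩ := hpa; exact hW.mem
  suffices H : ∃ k, lab k = i ∧ ((InSector hι φ k a ∧ InSector hι φ (k - 1) b) ∨
      (InSector hι φ (k - 1) a ∧ InSector hι φ k b)) by
    obtain ⟨W, hW1, hW2⟩ := hpa
    obtain ⟨W', hW1', hW2'⟩ := hqb
    obtain ⟨k, hk, H⟩ := H
    refine ⟨k, hk, H.imp (fun H => ?_) (fun H => ?_)⟩ <;>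
    · rw [CutPoint.liesIn_unique hW2 H.1] at hW1
      rw [CutPoint.liesIn_unique hW2' H.2] at hW1'
      exact ⟨hW1, hW1'⟩
  -- An interior point of an edge is the centre only if there are two legs; the two copies of the
  -- point then occupy the two sectors.
  by_cases hz : Γ.curve e t = z
  · obtain ⟨rfl, hlab⟩ := h.label_center e t h0 h1 hz
    obtain ⟨k, hk⟩ := h.isStarChart.exists_inSector hι haU
    obtain ⟨l, hl⟩ := h.isStarChart.exists_inSector hι (hpt ▸ haU)
    have hkl : k ≠ l := by
      rintro rfl
      exact hab (h.isStarChart.eq_of_inSector hι (by rw [← hw, hz]) (by rw [← hpt, ← hw, hz]) hk hl)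
    have : l = k - 1 := fin_two_eq_sub_one hkl
    exact ⟨k, (hlab k).symm.trans he, Or.inl ⟨hk, this ▸ hl⟩⟩
  · have hsrc : Γ.curve e t ∈ φ.source := (mem_disc_sphereChart hι h.isStarChart).1 (hw ▸ haU)
    obtain ⟨k, χ, g1, -, g3, g4, g5⟩ := h.exists_sides hι hsrc hz
    have hm := (g3.isStarChart.sphere hι).center_mem_disc one_pos
    obtain ⟨j, hj⟩ := g3.isStarChart.exists_inSector hι (a := a) (hw ▸ hm)
    obtain ⟨l, hl⟩ := g3.isStarChart.exists_inSector hι (a := b) (hpt ▸ hw ▸ hm)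
    have hjl : j ≠ l := by
      rintro rfl
      exact hab (g3.isStarChart.eq_of_inSector hι hw.symm (hpt ▸ hw.symm) hj hl)
    refine ⟨k, g1.symm.trans he, ?_⟩
    have : (j = 0 ∧ l = 1) ∨ (j = 1 ∧ l = 0) := by omega
    rcases this with ⟨rfl, rfl⟩ | ⟨rfl, rfl⟩
    · have e1 := g4 a hj
      have e2 := g5 b hl
      unfold leftSector at e1
      unfold rightSector at e2
      split_ifs at e1 e2
      · exact Or.inl ⟨e1, e2⟩
      · exact Or.inr ⟨e1, e2⟩
    · have e1 := g5 a hj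
      have e2 := g4 b hl
      unfold rightSector at e1
      unfold leftSector at e2
      split_ifs at e1 e2
      · exact Or.inr ⟨e1, e2⟩
      · exact Or.inl ⟨e1, e2⟩

/-- Every leg contains points arbitrarily close to the centre, and the two points of the cut sphere
over them lie in the two adjacent sectors. -/
theorem IsModel.exists_leg_point (h : IsModel Γ o z d φ lab out) (k : Fin d) {ρ : ℝ} (hρ : 0 < ρ)
    (hρ1 : ρ ≤ 1) : ∃ (e : _) (t : I) (χ : OpenPartialHomeomorph ℂ ℂ) (a b : Γ.CutSphere ι),
      0 < t ∧ t < 1 ∧ Γ.label e = lab k ∧ Γ.curve e t ≠ z ∧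
      a.pt = ι (Γ.curve e t) ∧ b.pt = ι (Γ.curve e t) ∧ a ≠ b ∧
      ι (Γ.curve e t) ∈ disc (sphereChart hι φ) ρ ∧
      IsEdgeChart Γ.toPreChart o e t χ ∧ InSector hι χ (0 : Fin 2) a ∧
      InSector hι φ (leftSector out k) a ∧ InSector hι φ (rightSector out k) b := by
  have hρ2 : (0 : ℝ) < ρ / 2 := by positivity
  set w₀ : ℂ := (ρ / 2 : ℝ) * radius d k
  have hn : ‖w₀‖ = ρ / 2 := by
    rw [norm_mul, norm_radius, mul_one, Complex.norm_of_nonneg hρ2.le]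
  have ht : w₀ ∈ φ.target := by
    rw [h.isStarChart.target_eq, mem_ball_zero_iff, hn]; linarith
  have hs := φ.map_target ht
  have hr := φ.right_inv ht
  have hsup : φ.symm w₀ ∈ Γ.support := (h.isStarChart.mem_iff _ hs).2 (by
    rw [hr]; exact ⟨k, _, hρ2.le, rfl⟩)
  have hne : φ.symm w₀ ≠ z := by
    intro h0
    rw [h0, h.isStarChart.map_center] at hr
    rw [← hr, norm_zero] at hn
    linarith
  obtain ⟨e, t, h0, h1, he⟩ := h.exists_edge _ hs hsup hne
  rw [← he] at hs hr hne
  obtain ⟨k', χ, g1, ⟨r, hr0, g2⟩, g3, g4, g5⟩ := h.exists_sides hι hs hne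
  obtain ⟨rfl, -⟩ := radius_injective hρ2 hr0 (hr.symm.trans g2)
  obtain ⟨a, ha1, ha2⟩ := (g3.isStarChart.sphere hι).exists_centerPt (0 : Fin 2)
  obtain ⟨b, hb1, hb2⟩ := (g3.isStarChart.sphere hι).exists_centerPt (1 : Fin 2)
  refine ⟨e, t, χ, a, b, h0, h1, g1, hne, ha1, hb1, ?_, ⟨(mem_sphereChart_source hι).2 hs, ?_⟩, g3,
    ha2, g4 a ha2, g5 b hb2⟩
  · rintro rfl
    have := g3.isStarChart.inSector_unique hι ha2 hb2
    simp at this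
  · rw [Set.mem_preimage, sphereChart_apply, hr, mem_ball_zero_iff, hn]
    linarith

theorem IsModel.sameSide (h : IsModel Γ o z d φ lab out) {ρ : ℝ} (hρ : 0 < ρ)
    (hρ1 : ρ ≤ 1) {k : Fin d} {p a : Γ.CutSphere ι} (hp : InSector hι φ k p)
    (ha : InSector hι φ k a) (hpρ : p.pt ∈ disc (sphereChart hι φ) ρ)
    (haρ : a.pt ∈ disc (sphereChart hι φ) ρ) : SameSide (disc (sphereChart hι φ) ρ) p a :=
  ⟨_, (h.isStarChart.sphere hι).liesIn_disc hρ hρ1 hp hpρ,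
    (h.isStarChart.sphere hι).liesIn_disc hρ hρ1 ha haρ⟩

theorem IsModel.isLeft (h : IsModel Γ o z d φ lab out) (k : Fin d) {p : Γ.CutSphere ι}
    (hp : p.pt = ι z) (hk : InSector hι φ (leftSector out k) p) : IsLeft hι o (lab k) p := by
  intro U hU
  obtain ⟨ρ, hρ, hρ1, -, hle⟩ := (h.isStarChart.sphere hι).exists_disc_le (hp ▸ hU) one_pos
  obtain ⟨e, t, χ, a, b, h0, h1, h2, h3, h4, h5, h6, h7, h8, h9, h10, h11⟩ :=
    h.exists_leg_point hι k hρ hρ1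
  exact ⟨a, e, t, h2, h0, h1, h4, by rw [h4, hp]; exact fun h => h3 (hι.injective h),
    (h.sameSide hι hρ hρ1 hk h10 (hp ▸ (h.isStarChart.sphere hι).center_mem_disc hρ)
      (h4 ▸ h7)).mono hle, χ, h8, h9⟩

theorem IsModel.facing (h : IsModel Γ o z d φ lab out) (k : Fin d) {p q : Γ.CutSphere ι}
    (hp : p.pt = ι z) (hq : q.pt = ι z) (hpk : InSector hι φ (leftSector out k) p)
    (hqk : InSector hι φ (rightSector out k) q) :
    Γ.Facing ι (lab k) p q ∧ Γ.Facing ι (lab k) q p := by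
  have key : ∀ U : Opens Sphere2, ι z ∈ U → ∃ a b : Γ.CutSphere ι, a ≠ b ∧ a.pt = b.pt ∧
      a.pt ∈ ι '' Γ.openEdges (lab k) ∧ SameSide U p a ∧ SameSide U q b := by
    intro U hU
    obtain ⟨ρ, hρ, hρ1, -, hle⟩ := (h.isStarChart.sphere hι).exists_disc_le hU one_pos
    obtain ⟨e, t, χ, a, b, h0, h1, h2, h3, h4, h5, h6, h7, h8, h9, h10, h11⟩ :=
      h.exists_leg_point hι k hρ hρ1
    have hm := (h.isStarChart.sphere hι).center_mem_disc hρ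
    exact ⟨a, b, h6, h4.trans h5.symm, h4 ▸ ⟨_, ⟨e, t, h2, h0, h1, rfl⟩, rfl⟩,
      (h.sameSide hι hρ hρ1 hpk h10 (hp ▸ hm) (h4 ▸ h7)).mono hle,
      (h.sameSide hι hρ hρ1 hqk h11 (hq ▸ hm) (h5 ▸ h7)).mono hle⟩
  refine ⟨⟨hp.trans hq.symm, fun U hU => ?_⟩, ⟨hq.trans hp.symm, fun U hU => ?_⟩⟩
  · exact key U (hp ▸ hU)
  · obtain ⟨a, b, h1, h2, h3, h4, h5⟩ := key U (hq ▸ hU)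
    exact ⟨b, a, h1.symm, h2.symm, h2 ▸ h3, h5, h4⟩

/-- This reads off the labels for which the summand `D i` of the first coordinate vanishes at `ι z`.
-/
theorem IsModel.mem_closure_iff (hι : Topology.IsOpenEmbedding ι) (h : IsModel Γ o z d φ lab out) {i : ℕ} :
    ι z ∈ closure (ι '' Γ.openEdges i) ↔ ∃ k, lab k = i := by
  have hs := h.isStarChart.sphere hι
  constructor
  · intro hc
    obtain ⟨_, hx, w, ⟨e, t, he, h0, h1, rfl⟩, rfl⟩ := _root_.mem_closure_iff.1 hc _
      (disc (sphereChart hι φ) 1).isOpen (hs.center_mem_disc one_pos)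
    by_cases hz : Γ.curve e t = z
    · exact ⟨0, ((h.label_center e t h0 h1 hz).2 0).symm.trans he⟩
    · obtain ⟨k, r, -, -, h2, -⟩ := h.leg e t ((mem_disc_sphereChart hι h.isStarChart).1 hx) hz
      exact ⟨k, h2.symm.trans he⟩
  · rintro ⟨k, rfl⟩
    refine _root_.mem_closure_iff.2 fun V hV hzV => ?_
    obtain ⟨ρ, hρ, hρ1, -, hle⟩ := hs.exists_disc_le (V := ⟨V, hV⟩) hzV one_pos
    obtain ⟨e, t, χ, a, b, h0, h1, h2, h3, h4, h5, h6, h7, h8⟩ := h.exists_leg_point hι k hρ hρ1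
    exact ⟨_, hle h7, _, ⟨e, t, h2, h0, h1, rfl⟩, rfl⟩

end Model


/-! ### Heights of the sheets near a point -/

/-- The transposition of the sheets `i` and `i + 1`. -/
def sheetSwap {i : ℕ} (hi : i + 1 < n) : Equiv.Perm (Fin n) :=
  Equiv.swap ⟨i, Nat.lt_of_succ_lt hi⟩ ⟨i + 1, hi⟩

theorem sheetSwap_val {i : ℕ} (hi : i + 1 < n) (l : Fin n) : (sheetSwap hi l : ℕ) =
    if (l : ℕ) = i then i + 1 else if (l : ℕ) = i + 1 then i else l := by
  simp only [sheetSwap, Equiv.swap_apply_def, Fin.ext_iff]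
  split_ifs <;> rfl

theorem sheetSwap_sheetSwap {i : ℕ} (hi : i + 1 < n) (l : Fin n) :
    sheetSwap hi (sheetSwap hi l) = l := by simp [sheetSwap]

/-- Heights `c k l` of the sheets `l` over the sectors `k` of a model that are compatible with the
gluing, such that over the left side of an edge with label `i` sheet `i` is above sheet `i + 1`. -/
structure IsWeight (n : ℕ) {d : ℕ} [NeZero d] (lab : Fin d → ℕ) (out : Fin d → Bool)
    (c : Fin d → Fin n → ℝ) : Prop where
  glue : ∀ k (hi : lab k + 1 < n) l, c k (sheetSwap hi l) = c (k - 1) l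
  sign : ∀ k (hi : lab k + 1 < n), if out k
    then c k ⟨lab k + 1, hi⟩ < c k ⟨lab k, Nat.lt_of_succ_lt hi⟩
    else c k ⟨lab k, Nat.lt_of_succ_lt hi⟩ < c k ⟨lab k + 1, hi⟩
  bound : ∀ k l, |c k l| ≤ 1

/-- The function with values `1` at `i`, `-1` at `i + 1`, and `0` elsewhere. -/
noncomputable def dipole (i l : ℕ) : ℝ := if l = i then 1 else if l = i + 1 then -1 else 0

theorem dipole_self (i : ℕ) : dipole i i = 1 := by simp [dipole]

theorem dipole_succ (i : ℕ) : dipole i (i + 1) = -1 := by simp [dipole]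

theorem dipole_swap {i : ℕ} (hi : i + 1 < n) (l : Fin n) :
    dipole i (sheetSwap hi l : ℕ) = -dipole i l := by
  rw [sheetSwap_val]
  unfold dipole
  split_ifs <;> first | omega | simp

theorem dipole_swap_of_far {i j : ℕ} (hj : j + 1 < n) (h : i + 1 < j ∨ j + 1 < i) (l : Fin n) :
    dipole i (sheetSwap hj l : ℕ) = dipole i l := by
  rw [sheetSwap_val]
  unfold dipole
  split_ifs <;> first | omega | simp

theorem abs_dipole (i l : ℕ) : |dipole i l| ≤ 1 := by
  unfold dipole
  split_ifs <;> simp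

/-- The sign of an orientation. -/
noncomputable def boolSign (b : Bool) : ℝ := if b then 1 else -1

theorem boolSign_not (b : Bool) : boolSign (!b) = -boolSign b := by
  cases b <;> simp [boolSign]

theorem abs_boolSign_mul (b : Bool) (x : ℝ) : |boolSign b * x| = |x| := by
  cases b <;> simp [boolSign]

/-- A dipole changes sign under the swap of its two sheets, so opposite signs on the two sides
match. -/
theorem exists_isWeight_line (n i : ℕ) {out : Fin 2 → Bool} (h : out 1 = !out 0) :
    ∃ c, IsWeight n (fun _ : Fin 2 => i) out c := by
  refine ⟨fun k l => boolSign (out k) * dipole i l, fun k hi l => ?_, fun k hi => ?_, fun k l => ?_⟩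
  · have : out (k - 1) = !out k := by
      have hk : k = 0 ∨ k = 1 := by omega
      rcases hk with rfl | rfl
      · exact h
      · simp [h]
    rw [dipole_swap, this, boolSign_not]; ring
  · cases hk : out k <;> simp [boolSign, dipole]
  · rw [abs_boolSign_mul]; exact abs_dipole i l

/-- Distant labels involve disjoint pairs of sheets, so the dipoles of the two lines can be added
without interference. The factor `1 / 2` gives the bound. -/
theorem exists_isWeight_crossing (n : ℕ) {a b : ℕ} (hab : a + 1 < b ∨ b + 1 < a) {lab : Fin 4 → ℕ}
    (hlab : ∀ j : Fin 4, lab j = if (j : ℕ) % 2 = 0 then a else b) {out : Fin 4 → Bool}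
    (h2 : out 2 = !out 0) (h3 : out 3 = !out 1) : ∃ c, IsWeight n lab out c := by
  have l0 : lab 0 = a := hlab 0
  have l1 : lab 1 = b := hlab 1
  have l2 : lab 2 = a := hlab 2
  have l3 : lab 3 = b := hlab 3
  -- `A` and `B` are the signs of the two dipoles on the four sectors: `A` changes at legs `0` and
  -- `2`, `B` at legs `1` and `3`. Opposite legs ask for the same signs because the flow passes
  -- through.
  let A : Fin 4 → Bool := ![out 0, out 0, !out 0, !out 0]
  let B : Fin 4 → Bool := ![!out 1, out 1, out 1, !out 1]
  refine ⟨fun k l => (boolSign (A k) * dipole a l + boolSign (B k) * dipole b l) / 2,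
    fun k hi l => ?_, fun k hi => ?_, fun k l => ?_⟩
  · have hk : (lab k = a ∧ A k = !A (k - 1) ∧ B k = B (k - 1)) ∨
        (lab k = b ∧ B k = !B (k - 1) ∧ A k = A (k - 1)) := by
      fin_cases k
      · exact Or.inl ⟨l0, by simp [A], by simp [B]⟩
      · exact Or.inr ⟨l1, by simp [B], by simp [A]⟩
      · exact Or.inl ⟨l2, by simp [A], by simp [B]⟩
      · exact Or.inr ⟨l3, by simp [B], by simp [A]⟩
    generalize lab k = m at hi hk
    rcases hk with ⟨rfl, hA, hB⟩ | ⟨rfl, hB, hA⟩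
    · rw [dipole_swap, dipole_swap_of_far hi hab.symm, hA, hB, boolSign_not]; ring
    · rw [dipole_swap, dipole_swap_of_far hi hab, hA, hB, boolSign_not]; ring
  · have hk : (lab k = a ∧ A k = out k) ∨ (lab k = b ∧ B k = out k) := by
      fin_cases k
      · exact Or.inl ⟨l0, by simp [A]⟩
      · exact Or.inr ⟨l1, by simp [B]⟩
      · exact Or.inl ⟨l2, by simp [A, h2]⟩
      · exact Or.inr ⟨l3, by simp [B, h3]⟩
    generalize lab k = m at hi hk
    rcases hk with ⟨rfl, hA⟩ | ⟨rfl, hB⟩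
    · have e1 : dipole b m = 0 := by unfold dipole; split_ifs <;> first | omega | rfl
      have e2 : dipole b (m + 1) = 0 := by unfold dipole; split_ifs <;> first | omega | rfl
      cases ho : out k <;> simp [e1, e2, hA, ho, dipole_self, dipole_succ, boolSign] <;> norm_num
    · have e1 : dipole a m = 0 := by unfold dipole; split_ifs <;> first | omega | rfl
      have e2 : dipole a (m + 1) = 0 := by unfold dipole; split_ifs <;> first | omega | rfl
      cases ho : out k <;> simp [e1, e2, hB, ho, dipole_self, dipole_succ, boolSign] <;> norm_num
  · have h4 := abs_add_le (boolSign (A k) * dipole a l) (boolSign (B k) * dipole b l)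
    rw [abs_boolSign_mul, abs_boolSign_mul] at h4
    have h5 := abs_dipole a l
    have h6 := abs_dipole b l
    rw [abs_div, abs_two]
    linarith

/-- The function with values `x`, `y`, `z` at `m`, `m + 1`, `m + 2`, and `0` elsewhere. -/
noncomputable def triple (m : ℕ) (v : ℝ × ℝ × ℝ) (l : ℕ) : ℝ :=
  if l = m then v.1 else if l = m + 1 then v.2.1 else if l = m + 2 then v.2.2 else 0

theorem triple_swap_left {m : ℕ} (hi : m + 1 < n) (x y z : ℝ) (l : Fin n) :
    triple m (x, y, z) (sheetSwap hi l : ℕ) = triple m (y, x, z) l := by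
  rw [sheetSwap_val]
  unfold triple
  split_ifs <;> first | omega | rfl

theorem triple_swap_right {m : ℕ} (hi : m + 1 + 1 < n) (x y z : ℝ) (l : Fin n) :
    triple m (x, y, z) (sheetSwap hi l : ℕ) = triple m (x, z, y) l := by
  rw [sheetSwap_val]
  unfold triple
  split_ifs <;> first | omega | rfl

/-- The six sectors carry the six orderings of `-1, 0, 1` on three consecutive sheets, and crossing
a leg swaps the first two or the last two entries. From the increasing ordering on sector `5`, the
three outgoing legs each create an inversion, up to the decreasing ordering on sector `2`. The three
incoming legs undo them, so the hexagon closes. -/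
theorem exists_isWeight_white (n : ℕ) {a b : ℕ} (hab : a + 1 = b ∨ b + 1 = a) {lab : Fin 6 → ℕ}
    (hlab : ∀ j : Fin 6, lab j = if (j : ℕ) % 2 = 0 then a else b) {out : Fin 6 → Bool}
    (h0 : out 0 = true) (h1 : out 1 = true) (h2 : out 2 = true) (h3 : out 3 = false)
    (h4 : out 4 = false) (h5 : out 5 = false) : ∃ c, IsWeight n lab out c := by
  have l0 : lab 0 = a := hlab 0
  have l1 : lab 1 = b := hlab 1
  have l2 : lab 2 = a := hlab 2
  have l3 : lab 3 = b := hlab 3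
  have l4 : lab 4 = a := hlab 4
  have l5 : lab 5 = b := hlab 5
  have hb : ∀ (m : ℕ) (v : ℝ × ℝ × ℝ) (l : ℕ), |v.1| ≤ 1 → |v.2.1| ≤ 1 → |v.2.2| ≤ 1 →
      |triple m v l| ≤ 1 := by
    intro m v l h1 h2 h3
    unfold triple
    split_ifs <;> first | assumption | simp
  have hne : ∀ m : ℕ, ¬ m + 1 + 1 = m := by omega
  rcases hab with rfl | rfl
  · let T : Fin 6 → ℝ × ℝ × ℝ :=
      ![(0, -1, 1), (0, 1, -1), (1, 0, -1), (1, -1, 0), (-1, 1, 0), (-1, 0, 1)]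
    refine ⟨fun k l => triple a (T k) l, fun k hi l => ?_, fun k hi => ?_, fun k l => ?_⟩
    · fin_cases k <;> simp only [l0, l1, l2, l3, l4, l5, Fin.mk_one, Fin.zero_eta,
        Fin.reduceFinMk] at hi ⊢ <;>
      first | exact triple_swap_left hi _ _ _ l | exact triple_swap_right hi _ _ _ l
    · fin_cases k <;> simp [l0, l1, l2, l3, l4, l5, h0, h1, h2, h3, h4, h5, triple, T, hne]
    · apply hb <;> fin_cases k <;> simp [T]
  · let T : Fin 6 → ℝ × ℝ × ℝ :=
      ![(-1, 1, 0), (1, -1, 0), (1, 0, -1), (0, 1, -1), (0, -1, 1), (-1, 0, 1)]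
    refine ⟨fun k l => triple b (T k) l, fun k hi l => ?_, fun k hi => ?_, fun k l => ?_⟩
    · fin_cases k <;> simp only [l0, l1, l2, l3, l4, l5, Fin.mk_one, Fin.zero_eta,
        Fin.reduceFinMk] at hi ⊢ <;>
      first | exact triple_swap_left hi _ _ _ l | exact triple_swap_right hi _ _ _ l
    · fin_cases k <;> simp [l0, l1, l2, l3, l4, l5, h0, h1, h2, h3, h4, h5, triple, T, hne]
    · apply hb <;> fin_cases k <;> simp [T]


/-! ### The second coordinate of the embedding -/

/-- `f` is a function over `U` on the sheets that descends to the cover, such that over the left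
side of an edge with label `i` sheet `i` is above sheet `i + 1`, and over the right side below. -/
structure IsLocalHeight (o : Fin Γ.numEdges → Bool) (U : Opens Sphere2)
    (f : Γ.CutSphere ι × Fin n → ℝ) : Prop where
  continuousAt : ∀ x, x.1.pt ∈ U → ContinuousAt f x
  glue : ∀ x y, x.1.pt ∈ U → Γ.Glued ι x y → f x = f y
  left : ∀ p i (hi : i + 1 < n), p.pt ∈ U → IsLeft hι o i p →
    f (p, ⟨i + 1, hi⟩) < f (p, ⟨i, Nat.lt_of_succ_lt hi⟩)
  right : ∀ p i (hi : i + 1 < n), p.pt ∈ U → IsLeft hι (fun e => !o e) i p →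
    f (p, ⟨i, Nat.lt_of_succ_lt hi⟩) < f (p, ⟨i + 1, hi⟩)
  bound : ∀ x, |f x| ≤ 1

theorem sheetSwap_self {i : ℕ} (hi : i + 1 < n) :
    sheetSwap hi ⟨i, Nat.lt_of_succ_lt hi⟩ = ⟨i + 1, hi⟩ := Equiv.swap_apply_left _ _

theorem sheetSwap_succ {i : ℕ} (hi : i + 1 < n) :
    sheetSwap hi ⟨i + 1, hi⟩ = ⟨i, Nat.lt_of_succ_lt hi⟩ := Equiv.swap_apply_right _ _

/-- The height is the constant `c k l` on sheet `l` over sector `k`. It is continuous over the chart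
because the cut space keeps the sectors apart. -/
theorem IsModel.exists_isLocalHeight {o : Fin Γ.numEdges → Bool} {z : ℂ} {d : ℕ} [NeZero d]
    {φ : OpenPartialHomeomorph ℂ ℂ} {lab : Fin d → ℕ} {out : Fin d → Bool}
    (h : IsModel Γ o z d φ lab out) {c : Fin d → Fin n → ℝ} (hc : IsWeight n lab out c) :
    ∃ f, IsLocalHeight (Γ := Γ) hι o (disc (sphereChart hι φ) 1) f := by
  classical
  have hs := h.isStarChart
  let f : Γ.CutSphere ι × Fin n → ℝ := fun x =>
    if hx : x.1.pt ∈ disc (sphereChart hι φ) 1 then c (hs.exists_inSector hι hx).choose x.2 else 0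
  have hf : ∀ {p : Γ.CutSphere ι} {k : Fin d} (l : Fin n), InSector hι φ k p → f (p, l) = c k l := by
    intro p k l hk
    have hp : p.pt ∈ disc (sphereChart hι φ) 1 := hk.mem
    simp only [f, dif_pos hp]
    rw [hs.inSector_unique hι (hs.exists_inSector hι hp).choose_spec hk]
  refine ⟨f, fun x hx => ?_, ?_, ?_, ?_, fun x => ?_⟩
  · have h1 : ∀ᶠ y in 𝓝 x, SameSide (disc (sphereChart hι φ) 1) x.1 y.1 :=
      continuousAt_fst.eventually ((isOpen_sameSide _ x.1).mem_nhds (SameSide.refl hx))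
    have h2 : ∀ᶠ y in 𝓝 x, y.2 = x.2 :=
      continuousAt_snd.eventually ((isOpen_discrete {x.2}).mem_nhds rfl)
    have : f =ᶠ[𝓝 x] fun _ => f x := by
      filter_upwards [h1, h2] with y hy1 hy2
      obtain ⟨k, hk⟩ := hs.exists_inSector hι hx
      obtain ⟨W, hW1, hW2⟩ := hy1
      obtain rfl := CutPoint.liesIn_unique hW1 hk
      rw [show x = (x.1, x.2) from rfl, show y = (y.1, y.2) from rfl, hf _ hk, hf _ hW2, hy2]
    exact this.continuousAt
  · rintro ⟨p, l⟩ ⟨q, m⟩ hp ⟨i, hi, hfac, hm⟩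
    change m = sheetSwap hi l at hm
    subst hm
    obtain ⟨k, rfl, ⟨h1, h2⟩ | ⟨h1, h2⟩⟩ := h.inSector_of_facing hι hp hfac
    · rw [hf _ h1, hf _ h2, ← hc.glue k hi, sheetSwap_sheetSwap]
    · rw [hf _ h1, hf _ h2, hc.glue k hi]
  · intro p i hi hp hl
    obtain ⟨k, rfl, hk⟩ := h.inSector_of_isLeft hι hp hl
    have hsgn := hc.sign k hi
    rw [hf _ hk, hf _ hk]
    unfold leftSector
    split_ifs at hsgn ⊢
    · exact hsgn
    · rwa [← hc.glue k hi, ← hc.glue k hi, sheetSwap_self, sheetSwap_succ]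
  · intro p i hi hp hl
    obtain ⟨k, rfl, hk⟩ := h.reverse.inSector_of_isLeft hι hp hl
    have hsgn := hc.sign k hi
    rw [hf _ hk, hf _ hk]
    unfold leftSector
    cases ho : out k <;> simp only [ho, Bool.not_true, Bool.not_false, if_true, if_false,
      Bool.false_eq_true] at hsgn ⊢
    · exact hsgn
    · rwa [← hc.glue k hi, ← hc.glue k hi, sheetSwap_self, sheetSwap_succ]
  · simp only [f]
    split_ifs
    · exact hc.bound _ _
    · simp

/-- Off the graph no point is adjacent to an edge, so the conditions on sides are vacuous. -/
theorem isLocalHeight_zero (o : Fin Γ.numEdges → Bool) (hS : IsClosed (ι '' Γ.support)) :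
    IsLocalHeight (Γ := Γ) hι o ⟨(ι '' Γ.support)ᶜ, hS.isOpen_compl⟩ (fun _ => 0) := by
  have key : ∀ (o' : Fin Γ.numEdges → Bool) (i : ℕ) (p : Γ.CutSphere ι), p.pt ∉ ι '' Γ.support →
      ¬ IsLeft hι o' i p := by
    intro o' i p hp hl
    obtain ⟨a, e, t, -, -, -, h1, -, ⟨W, -, hW⟩, -⟩ := hl ⟨(ι '' Γ.support)ᶜ, hS.isOpen_compl⟩ hp
    have := hW.mem
    rw [h1] at this
    exact this ⟨_, ⟨e, t, rfl⟩, rfl⟩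
  exact ⟨fun x _ => continuousAt_const, fun _ _ _ _ => rfl, fun p i _ hp hl => (key _ _ _ hp hl).elim,
    fun p i _ hp hl => (key _ _ _ hp hl).elim, fun _ => by simp⟩

/-! ### Patching the local heights -/

theorem exists_zeroSet {X : Type*} [MetricSpace X] {E : Set X} (hE : IsClosed E) :
    ∃ D : X → ℝ, Continuous D ∧ (∀ x, 0 ≤ D x) ∧ ∀ x, D x = 0 ↔ x ∈ E := by
  rcases E.eq_empty_or_nonempty with rfl | hne
  · exact ⟨fun _ => 1, continuous_const, fun _ => zero_le_one, fun x => by simp⟩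
  · exact ⟨fun x => Metric.infDist x E, Metric.continuous_infDist_pt E,
      fun x => Metric.infDist_nonneg, fun x => (hE.mem_iff_infDist_zero hne).symm⟩

/-- A function on the sheets that descends to the cover and separates the sheets that meet at
a point outside the closed set `B`. -/
structure IsHeight (o : Fin Γ.numEdges → Bool) (B : Set Sphere2)
    (f : Γ.CutSphere ι × Fin n → ℝ) : Prop where
  continuous : Continuous f
  glue : ∀ x y, Γ.Glued ι x y → f x = f y
  left : ∀ p i (hi : i + 1 < n), p.pt ∉ B → IsLeft hι o i p →
    f (p, ⟨i + 1, hi⟩) < f (p, ⟨i, Nat.lt_of_succ_lt hi⟩)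
  right : ∀ p i (hi : i + 1 < n), p.pt ∉ B → IsLeft hι (fun e => !o e) i p →
    f (p, ⟨i, Nat.lt_of_succ_lt hi⟩) < f (p, ⟨i + 1, hi⟩)

theorem finsum_mul_lt {J Y : Type*} [TopologicalSpace Y] (ρ : PartitionOfUnity J Y) (y : Y)
    {f g : J → ℝ} (h : ∀ j, ρ j y ≠ 0 → f j < g j) :
    ∑ᶠ j, ρ j y * f j < ∑ᶠ j, ρ j y * g j := by
  have hfin := ρ.locallyFinite.point_finite y
  have hsum : ∀ f : J → ℝ, ∑ᶠ j, ρ j y * f j = ∑ j ∈ hfin.toFinset, ρ j y * f j := by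
    intro f
    refine finsum_eq_sum_of_support_subset _ fun j hj => ?_
    simp only [Set.Finite.coe_toFinset]
    exact left_ne_zero_of_mul hj
  rw [hsum, hsum]
  obtain ⟨j, hj⟩ := ρ.exists_pos (Set.mem_univ y)
  refine Finset.sum_lt_sum (fun j hj => ?_) ⟨j, ?_, mul_lt_mul_of_pos_left (h j hj.ne') hj⟩
  · have hj' : ρ j y ≠ 0 := by simpa using hj
    exact mul_le_mul_of_nonneg_left (h j hj').le (ρ.nonneg j y)
  · simpa using hj.ne'

/-- The gluing equations and the strict inequalities are stable under averages whose weights depend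
only on the point of the sphere. The average over a partition of unity on the complement of `B` is
multiplied by a function with zero set `B`. -/
theorem exists_isHeight (o : Fin Γ.numEdges → Bool) {B : Set Sphere2} (hB : IsClosed B)
    (H : ∀ x, x ∉ B → ∃ U : Opens Sphere2, x ∈ U ∧ ∃ f, IsLocalHeight (Γ := Γ) hι o U f) :
    ∃ f, IsHeight (Γ := Γ) hι o B f := by
  classical
  choose! U hU f hf using H
  let Y := {x : Sphere2 // x ∉ B}
  obtain ⟨ρ, hρ⟩ := PartitionOfUnity.exists_isSubordinate (X := Y) isClosed_univ
    (fun y : Y => Subtype.val ⁻¹' (U y.1 : Set Sphere2))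
    (fun y => (U y.1).isOpen.preimage continuous_subtype_val)
    (fun y _ => Set.mem_iUnion.2 ⟨y, hU y.1 y.2⟩)
  have hρU : ∀ {j y : Y}, ρ j y ≠ 0 → y.1 ∈ U j.1 := fun {j y} h => hρ j (subset_tsupport _ h)
  obtain ⟨D, hDc, hD0, hDB⟩ := exists_zeroSet hB
  let g : Γ.CutSphere ι × Fin n → ℝ := fun x =>
    if hx : x.1.pt ∉ B then ∑ᶠ j : Y, ρ j ⟨x.1.pt, hx⟩ * f j.1 x else 0
  have hg : ∀ x (hx : x.1.pt ∉ B), g x = ∑ᶠ j : Y, ρ j ⟨x.1.pt, hx⟩ * f j.1 x := fun x hx =>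
    dif_pos hx
  have hg1 : ∀ x, |g x| ≤ 1 := by
    intro x
    by_cases hx : x.1.pt ∉ B
    · rw [hg x hx, abs_le]
      have := ρ.finsum_smul_mem_convex (s := Set.univ) (x := ⟨x.1.pt, hx⟩)
        (g := fun (j : Y) _ => f j.1 x) (t := Set.Icc (-1) 1) (Set.mem_univ _)
        (fun j _ => abs_le.1 ((hf j.1 j.2).bound x)) (convex_Icc _ _)
      exact this
    · simp only [g, dif_neg hx, abs_zero, zero_le_one]
  have hgc : ∀ x, x.1.pt ∉ B → ContinuousAt g x := by
    intro x hx
    let Z := {x : Γ.CutSphere ι × Fin n | x.1.pt ∉ B}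
    have hpt : Continuous fun x : Γ.CutSphere ι × Fin n => x.1.pt :=
      CutPoint.continuous_pt.comp continuous_fst
    have hZ : IsOpen Z := hB.isOpen_compl.preimage hpt
    let π : Z → Y := fun z => ⟨z.1.1.pt, z.2⟩
    have hπ : Continuous π := (hpt.comp continuous_subtype_val).subtype_mk _
    have hcont : Continuous fun z : Z => ∑ᶠ j : Y, ρ j (π z) * f j.1 z.1 := by
      refine continuous_finsum (fun j => continuous_iff_continuousAt.2 fun z => ?_) ?_
      · by_cases hz : π z ∈ tsupport (ρ j)
        · have h1 : ContinuousAt (f j.1) z.1 := (hf j.1 j.2).continuousAt z.1 (hρ j hz)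
          exact ((ρ j).continuous.comp hπ).continuousAt.mul
            (h1.comp (f := (Subtype.val : Z → _)) continuous_subtype_val.continuousAt)
        · have h1 := hπ.continuousAt.eventually (notMem_tsupport_iff_eventuallyEq.1 hz)
          have h2 : (fun z : Z => ρ j (π z) * f j.1 z.1) =ᶠ[𝓝 z] fun _ => 0 := by
            filter_upwards [h1] with w hw
            rw [hw]; simp
          exact h2.continuousAt
      · refine (ρ.locallyFinite.preimage_continuous hπ).subset fun j z hz => ?_
        exact left_ne_zero_of_mul hz
    have h1 : ContinuousAt (g ∘ (Subtype.val : Z → _)) ⟨x, hx⟩ := by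
      have : g ∘ (Subtype.val : Z → _) = fun z : Z => ∑ᶠ j : Y, ρ j (π z) * f j.1 z.1 := by
        funext z; exact hg z.1 z.2
      rw [this]; exact hcont.continuousAt
    exact (hZ.isOpenEmbedding_subtypeVal.continuousAt_iff (x := ⟨x, hx⟩)).1 h1
  have hpt : Continuous fun x : Γ.CutSphere ι × Fin n => D x.1.pt :=
    hDc.comp (CutPoint.continuous_pt.comp continuous_fst)
  have hDpos : ∀ x, x ∉ B → 0 < D x := fun x hx =>
    lt_of_le_of_ne (hD0 x) fun h => hx ((hDB x).1 h.symm)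
  refine ⟨fun x => D x.1.pt * g x, continuous_iff_continuousAt.2 fun x => ?_, ?_, ?_, ?_⟩
  · by_cases hx : x.1.pt ∉ B
    · exact hpt.continuousAt.mul (hgc x hx)
    · have h0 : D x.1.pt = 0 := (hDB _).2 (not_not.1 hx)
      have h00 : D x.1.pt * g x = 0 := by rw [h0, zero_mul]
      change Tendsto _ _ (𝓝 (D x.1.pt * g x))
      rw [h00]
      -- Since `|g| ≤ 1`, the product is dominated by `D`, which tends to `0` at points over `B`.
      refine squeeze_zero_norm (a := fun y => D y.1.pt) (fun y => ?_) ?_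
      · rw [Real.norm_eq_abs, abs_mul, abs_of_nonneg (hD0 _)]
        exact mul_le_of_le_one_right (hD0 _) (hg1 y)
      · have := hpt.tendsto x
        rwa [h0] at this
  · intro x y hxy
    have hpq : x.1.pt = y.1.pt := by obtain ⟨i, hi, h, -⟩ := hxy; exact h.1
    change D x.1.pt * g x = D y.1.pt * g y
    rw [← hpq]
    congr 1
    by_cases hx : x.1.pt ∉ B
    · rw [hg x hx, hg y (hpq ▸ hx)]
      refine finsum_congr fun j => ?_
      simp only [← hpq]
      by_cases hj : ρ j ⟨x.1.pt, hx⟩ = 0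
      · rw [hj, zero_mul, zero_mul]
      · rw [(hf j.1 j.2).glue x y (hρU hj) hxy]
    · simp only [g, dif_neg hx, ← hpq]
  · intro p i hi hp hl
    refine mul_lt_mul_of_pos_left ?_ (hDpos _ hp)
    rw [hg _ hp, hg _ hp]
    exact finsum_mul_lt ρ _ fun j hj => (hf j.1 j.2).left p i hi (hρU hj) hl
  · intro p i hi hp hl
    refine mul_lt_mul_of_pos_left ?_ (hDpos _ hp)
    rw [hg _ hp, hg _ hp]
    exact finsum_mul_lt ρ _ fun j hj => (hf j.1 j.2).right p i hi (hρU hj) hl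


/-! ### Fibres of the cover -/

/-- Every point of the cover over the centre of a model is represented in the last sector. -/
theorem IsModel.exists_mk_eq {o : Fin Γ.numEdges → Bool} {z : ℂ} {d : ℕ} [NeZero d]
    {φ : OpenPartialHomeomorph ℂ ℂ} {lab : Fin d → ℕ} {out : Fin d → Bool}
    (h : IsModel Γ o z d φ lab out) (hlab : ∀ k, lab k + 1 < n) {q : Γ.CutSphere ι}
    (hq : q.pt = ι z) (l : Fin n) : ∃ (p : Γ.CutSphere ι) (l' : Fin n), p.pt = ι z ∧
      InSector hι φ ((0 : Fin d) - 1) p ∧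
      (Quot.mk _ (p, l') : Γ.Cover ι) = Quot.mk _ (q, l) := by
  -- Crossing leg `k` leads from sector `k` to sector `k - 1` without changing the point of the
  -- cover.
  have step : ∀ (k : Fin d) (q : Γ.CutSphere ι) (l : Fin n), q.pt = ι z → InSector hι φ k q →
      ∃ (p : Γ.CutSphere ι) (l' : Fin n), p.pt = ι z ∧ InSector hι φ (k - 1) p ∧
        (Quot.mk _ (p, l') : Γ.Cover ι) = Quot.mk _ (q, l) := by
    intro k q l hq hk
    obtain ⟨p, hp, hpk⟩ := (h.isStarChart.sphere hι).exists_centerPt (k - 1)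
    refine ⟨p, sheetSwap (hlab k) l, hp, hpk, (Quot.sound ⟨lab k, hlab k, ?_, rfl⟩).symm⟩
    have hl := h.facing hι k (p := q) (q := p) hq hp
    have hr := h.facing hι k (p := p) (q := q) hp hq
    unfold leftSector rightSector at hl hr
    split_ifs at hl hr
    · exact (hl hk hpk).1
    · exact (hr hpk hk).2
  have key : ∀ (m : ℕ) (k : Fin d) (q : Γ.CutSphere ι) (l : Fin n), (k : ℕ) = m → q.pt = ι z →
      InSector hι φ k q → ∃ (p : Γ.CutSphere ι) (l' : Fin n), p.pt = ι z ∧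
        InSector hι φ (0 : Fin d) p ∧ (Quot.mk _ (p, l') : Γ.Cover ι) = Quot.mk _ (q, l) := by
    intro m
    induction m with
    | zero =>
      intro k q l hkm hq hk
      obtain rfl : k = 0 := Fin.ext hkm
      exact ⟨q, l, hq, hk, rfl⟩
    | succ m ih =>
      intro k q l hkm hq hk
      obtain ⟨p, l', h1, h2, h3⟩ := step k q l hq hk
      have hd : m + 1 < d := hkm ▸ k.2
      have hk0 : k ≠ 0 := by rintro rfl; simp at hkm
      have : ((k - 1 : Fin d) : ℕ) = m := by
        rw [Fin.val_sub_one_of_ne_zero hk0, hkm]; rfl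
      obtain ⟨p', l'', h4, h5, h6⟩ := ih (k - 1) p l' this h1 h2
      exact ⟨p', l'', h4, h5, h6.trans h3⟩
  obtain ⟨k, hk⟩ := h.isStarChart.exists_inSector hι (a := q)
    (hq ▸ (h.isStarChart.sphere hι).center_mem_disc one_pos)
  obtain ⟨p, l', h1, h2, h3⟩ := key k k q l rfl hq hk
  obtain ⟨p', l'', h4, h5, h6⟩ := step 0 p l' h1 h2
  exact ⟨p', l'', h4, h5, h6.trans h3⟩

/-- The points of the graph other than black vertices have models with heights. -/
theorem exists_isModel_isWeight {o : Fin Γ.numEdges → Bool} (ho : Γ.IsBraidOrientation o) {z : ℂ}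
    (hz : z ∈ Γ.support) (hzb : ¬ (z ∈ Γ.vertex ∧ ∃ half, Γ.IsBlack z half)) :
    ∃ (d : ℕ) (_ : NeZero d) (φ : OpenPartialHomeomorph ℂ ℂ) (lab : Fin d → ℕ)
      (out : Fin d → Bool) (c : Fin d → Fin n → ℝ), IsModel Γ o z d φ lab out ∧
      IsWeight n lab out c ∧ (∀ k, lab k + 1 < n) ∧ (∀ k, lab k = lab 0 ∨ lab k = lab (0 - 1)) ∧
      (lab 0 + 1 = lab (0 - 1) ∨ lab (0 - 1) + 1 = lab 0 → out 0 = true ∧ out (0 - 1) = false) := by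
  by_cases hv : z ∈ Γ.vertex
  · rcases ho z hv with h | ⟨half, ⟨hc, a, b, hab, hlab⟩, h02, h13⟩ |
      ⟨half, ⟨hc, a, b, hab, hlab⟩, h0, h1, h2, h3, h4, h5⟩
    · exact absurd ⟨hv, h⟩ hzb
    · obtain ⟨φ, out, h, hout⟩ := exists_isModel_of_isCyclicOrder o hc
      rw [← hout, ← hout] at h02 h13
      obtain ⟨c, hw⟩ := exists_isWeight_crossing n hab hlab (out := out)
        (by cases h : out 0 <;> cases h' : out 2 <;> simp_all)
        (by cases h : out 1 <;> cases h' : out 3 <;> simp_all)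
      refine ⟨4, inferInstance, φ, _, out, c, h, hw, fun k => Γ.label_lt _, fun k => ?_, ?_⟩
      · simp only [hlab]
        fin_cases k <;> simp
      · simp only [hlab]
        simp
        omega
    · obtain ⟨φ, out, h, hout⟩ := exists_isModel_of_isCyclicOrder o hc
      rw [← hout] at h0 h1 h2 h3 h4 h5
      rw [Bool.not_eq_true] at h3 h4 h5
      obtain ⟨c, hw⟩ := exists_isWeight_white n hab hlab (out := out) h0 h1 h2 h3 h4 h5
      refine ⟨6, inferInstance, φ, _, out, c, h, hw, fun k => Γ.label_lt _, fun k => ?_,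
        fun _ => ⟨h0, h5⟩⟩
      simp only [hlab]
      fin_cases k <;> simp
  · obtain ⟨φ, i, out, hi, h, hout⟩ := exists_isModel_of_notMem_vertex o hz hv
    obtain ⟨c, hw⟩ := exists_isWeight_line n i hout
    exact ⟨2, inferInstance, φ, _, out, c, h, hw, fun k => hi, fun k => Or.inl rfl, by omega⟩

theorem leftSector_not {d : ℕ} [NeZero d] (out : Fin d → Bool) (k : Fin d) :
    leftSector (fun k => !out k) k = rightSector out k := by
  cases h : out k <;> simp [leftSector, rightSector, h]

/-- With two labels available, `k` and `l` differ by at most two. A difference of two forces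
adjacent labels; two inequalities `≠` would not suffice then, but two `<` in the same direction do.
-/
theorem ne_of_adjacent_ne {F : Fin n → ℝ} {a b : ℕ} (ha : a + 1 < n) (hb : b + 1 < n)
    (hFa : F ⟨a, Nat.lt_of_succ_lt ha⟩ ≠ F ⟨a + 1, ha⟩)
    (hFb : F ⟨b, Nat.lt_of_succ_lt hb⟩ ≠ F ⟨b + 1, hb⟩)
    (hab : a + 1 = b ∨ b + 1 = a → F ⟨a, Nat.lt_of_succ_lt ha⟩ < F ⟨a + 1, ha⟩ ∧
      F ⟨b, Nat.lt_of_succ_lt hb⟩ < F ⟨b + 1, hb⟩) {k l : Fin n} (hkl : k < l)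
    (h : ∀ i, (k : ℕ) ≤ i → i < l → i = a ∨ i = b) : F k ≠ F l := by
  obtain ⟨k, hk⟩ := k
  obtain ⟨l, hl⟩ := l
  simp only [Fin.mk_lt_mk] at hkl h
  by_cases h1 : l = k + 1
  · subst h1
    rcases h k le_rfl (by omega) with rfl | rfl
    · exact hFa
    · exact hFb
  by_cases h2 : l = k + 2
  · subst h2
    have e1 := h k le_rfl (by omega)
    have e2 := h (k + 1) (by omega) (by omega)
    have : (k = a ∧ k + 1 = b) ∨ (k = b ∧ k + 1 = a) := by omega
    rcases this with ⟨rfl, rfl⟩ | ⟨rfl, rfl⟩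
    · obtain ⟨h3, h4⟩ := hab (Or.inl rfl)
      exact (h3.trans h4).ne
    · obtain ⟨h3, h4⟩ := hab (Or.inr rfl)
      exact (h4.trans h3).ne
  · have e1 := h k le_rfl (by omega)
    have e2 := h (k + 1) (by omega) (by omega)
    have e3 := h (k + 2) (by omega) (by omega)
    omega

theorem sum_range_eq_imp {D : ℕ → ℝ} (hD : ∀ i, 0 ≤ D i) {k l : ℕ} (hkl : k ≤ l)
    (h : ∑ i ∈ Finset.range k, D i = ∑ i ∈ Finset.range l, D i) (i : ℕ) (hk : k ≤ i) (hl : i < l) :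
    D i = 0 := by
  rw [← Finset.sum_range_add_sum_Ico D hkl, left_eq_add,
    Finset.sum_eq_zero_iff_of_nonneg fun i _ => hD i] at h
  exact h i (Finset.mem_Ico.2 ⟨hk, hl⟩)

/-- The first coordinate of the embedding descends to the cover. -/
theorem sum_range_eq_of_glued {D : ℕ → Sphere2 → ℝ}
    (hD : ∀ i x, D i x = 0 ↔ x ∈ closure (ι '' Γ.openEdges i)) {x y : Γ.CutSphere ι × Fin n}
    (h : Γ.Glued ι x y) :
    ∑ i ∈ Finset.range x.2, D i x.1.pt = ∑ i ∈ Finset.range y.2, D i y.1.pt := by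
  obtain ⟨p, k⟩ := x
  obtain ⟨q, l⟩ := y
  obtain ⟨i, hi, hf, hl⟩ := h
  change l = sheetSwap hi k at hl
  simp only at hf ⊢
  have h0 : D i p.pt = 0 := by
    refine (hD i _).2 (mem_closure_iff.2 fun U hU hpU => ?_)
    obtain ⟨a, b, -, -, h1, ⟨W, -, hW⟩, -⟩ := hf.2 ⟨U, hU⟩ hpU
    exact ⟨a.pt, hW.mem, h1⟩
  rw [← hf.1, hl, sheetSwap_val]
  split_ifs with h1 h2
  · rw [h1, Finset.sum_range_succ, h0, add_zero]
  · rw [h2, Finset.sum_range_succ, h0, add_zero]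
  · rfl

instance : LocallyConnectedSpace Sphere2 := by
  have : Fact (Module.finrank ℝ (EuclideanSpace ℝ (Fin 3)) = 2 + 1) := ⟨by simp⟩
  exact ChartedSpace.locallyConnectedSpace (EuclideanSpace ℝ (Fin 2)) _

/-- Two functions that separate the sheets separate the points of every fibre of the cover. -/
theorem mk_eq_of_eq {o : Fin Γ.numEdges → Bool} (ho : Γ.IsBraidOrientation o)
    (hS : IsClosed (ι '' Γ.support)) {D : ℕ → Sphere2 → ℝ} (hD0 : ∀ i x, 0 ≤ D i x)
    (hD : ∀ i x, D i x = 0 ↔ x ∈ closure (ι '' Γ.openEdges i))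
    {f : Γ.CutSphere ι × Fin n → ℝ}
    (hf : IsHeight (Γ := Γ) hι o (ι '' {v | v ∈ Γ.vertex ∧ ∃ half, Γ.IsBlack v half}) f)
    {x y : Γ.CutSphere ι × Fin n} (hxy : x.1.pt = y.1.pt)
    (h1 : ∑ i ∈ Finset.range x.2, D i x.1.pt = ∑ i ∈ Finset.range y.2, D i y.1.pt)
    (h2 : f x = f y) : (Quot.mk _ x : Γ.Cover ι) = Quot.mk _ y := by
  -- it suffices to compare sheets over one point of the cut sphere
  have reduce : ∀ (p : Γ.CutSphere ι), p.pt = x.1.pt → (∀ k l : Fin n, k < l →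
      (∀ i, (k : ℕ) ≤ i → i < l → p.pt ∈ closure (ι '' Γ.openEdges i)) →
      f (p, k) = f (p, l) → (Quot.mk _ (p, k) : Γ.Cover ι) = Quot.mk _ (p, l)) →
      ∀ k l : Fin n, (Quot.mk _ (p, k) : Γ.Cover ι) = Quot.mk _ x →
      (Quot.mk _ (p, l) : Γ.Cover ι) = Quot.mk _ y → (Quot.mk _ x : Γ.Cover ι) = Quot.mk _ y := by
    intro p hp hsep k l hk hl
    have g1 : f (p, k) = f (p, l) := by
      have e1 := congrArg (Quot.lift f hf.glue) hk
      have e2 := congrArg (Quot.lift f hf.glue) hl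
      exact e1.trans (h2.trans e2.symm)
    have g2 : ∑ i ∈ Finset.range k, D i p.pt = ∑ i ∈ Finset.range l, D i p.pt := by
      have e1 := congrArg (Quot.lift (fun x : Γ.CutSphere ι × Fin n =>
        ∑ i ∈ Finset.range x.2, D i x.1.pt) fun _ _ => sum_range_eq_of_glued hD) hk
      have e2 := congrArg (Quot.lift (fun x : Γ.CutSphere ι × Fin n =>
        ∑ i ∈ Finset.range x.2, D i x.1.pt) fun _ _ => sum_range_eq_of_glued hD) hl
      exact e1.trans (h1.trans e2.symm)
    rw [← hk, ← hl]
    rcases lt_trichotomy k l with h | rfl | h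
    · exact hsep k l h (fun i hi hi' => (hD i _).1
        (sum_range_eq_imp (D := fun i => D i p.pt) (fun i => hD0 i _) (le_of_lt h) g2 i hi hi')) g1
    · rfl
    · exact (hsep l k h (fun i hi hi' => (hD i _).1
        (sum_range_eq_imp (D := fun i => D i p.pt) (fun i => hD0 i _) (le_of_lt h) g2.symm i hi hi'))
        g1.symm).symm
  obtain ⟨p, k⟩ := x
  obtain ⟨q, l⟩ := y
  simp only at hxy reduce
  by_cases hpS : p.pt ∉ ι '' Γ.support
  -- Off the graph every `D i` is positive, so `g` alone separates the sheets.
  · obtain rfl : p = q := CutPoint.eq_of_notMem hS hxy hpS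
    refine reduce p rfl (fun k l hkl hcl _ => ?_) k l rfl rfl
    have hsub : ι '' Γ.openEdges k ⊆ ι '' Γ.support :=
      Set.image_mono fun w ⟨e, t, _, _, _, h⟩ => ⟨e, t, h⟩
    exact absurd (hS.closure_subset_iff.2 hsub (hcl k le_rfl hkl)) hpS
  obtain ⟨z, hz, hzp⟩ := not_not.1 hpS
  by_cases hzb : z ∈ Γ.vertex ∧ ∃ half, Γ.IsBlack z half
  -- At a black vertex there is one sector and one label. Distinct sheets with equal `g` are the two
  -- sheets of that label, and they are glued because the sector faces itself across its leg.
  · obtain ⟨-, half, hb⟩ := hzb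
    obtain ⟨φ, out, h, -⟩ := exists_isModel_of_isCyclicOrder o hb
    have hm := (h.isStarChart.sphere hι).center_mem_disc one_pos
    have hin : ∀ r : Γ.CutSphere ι, r.pt = ι z → ∀ j : Fin 1, InSector hι φ j r := fun r hr j => by
      obtain ⟨j', hj'⟩ := h.isStarChart.exists_inSector hι (a := r) (hr ▸ hm)
      rwa [Subsingleton.elim j j']
    obtain rfl : p = q := h.isStarChart.eq_of_inSector hι hzp.symm (hxy ▸ hzp.symm)
      (hin p hzp.symm 0) (hin q (hxy ▸ hzp.symm) 0)
    refine reduce p rfl (fun k l hkl hcl _ => ?_) k l rfl rfl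
    have hi : ∀ i, (k : ℕ) ≤ i → i < l → Γ.label (half 0).1 = i := fun i hi hi' => by
      have := hcl i hi hi'
      rw [← hzp] at this
      obtain ⟨j, hj⟩ := (h.mem_closure_iff hι).1 this
      rwa [Subsingleton.elim j 0] at hj
    have hk := hi k le_rfl hkl
    have hl : (l : ℕ) = k + 1 := by
      by_contra hne
      have := hi (k + 1) (by omega) (by have : (k : ℕ) < l := hkl; omega)
      omega
    refine Quot.sound ⟨Γ.label (half 0).1, Γ.label_lt _,
      (h.facing hι 0 hzp.symm hzp.symm (hin p hzp.symm _) (hin p hzp.symm _)).1, ?_⟩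
    change l = sheetSwap (Γ.label_lt _) k
    ext
    rw [sheetSwap_val, if_pos hk.symm, hl, hk]
  · obtain ⟨d, hd, φ, lab, out, c, h, hw, hlab, hlab', hout⟩ := exists_isModel_isWeight ho hz hzb
    obtain ⟨p', k', hp1, hp2, hp3⟩ := h.exists_mk_eq hι hlab hzp.symm k
    obtain ⟨q', l', hq1, hq2, hq3⟩ := h.exists_mk_eq hι hlab (hxy ▸ hzp.symm : q.pt = ι z) l
    obtain rfl : p' = q' := h.isStarChart.eq_of_inSector hι hp1 hq1 hp2 hq2
    refine reduce p' (hp1.trans hzp) (fun k l hkl hcl heq => ?_) k' l' hp3 hq3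
    have hB : p'.pt ∉ ι '' {v | v ∈ Γ.vertex ∧ ∃ half, Γ.IsBlack v half} := by
      rw [hp1, hι.injective.mem_set_image]
      exact hzb
    refine absurd heq (ne_of_adjacent_ne (F := fun l => f (p', l)) (hlab 0) (hlab (0 - 1)) ?_ ?_ ?_
      hkl fun i hi hi' => ?_)
    · cases h0 : out 0
      · exact (hf.left p' _ (hlab 0) hB (h.isLeft hι 0 hp1 (by rwa [leftSector, h0]))).ne'
      · exact (hf.right p' _ (hlab 0) hB
          (h.reverse.isLeft hι 0 hp1 (by rwa [leftSector_not, rightSector, h0]))).ne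
    · cases h0 : out (0 - 1)
      · exact (hf.right p' _ (hlab (0 - 1)) hB
          (h.reverse.isLeft hι (0 - 1) hp1 (by rwa [leftSector_not, rightSector, h0]))).ne
      · exact (hf.left p' _ (hlab (0 - 1)) hB
          (h.isLeft hι (0 - 1) hp1 (by rwa [leftSector, h0]))).ne'
    -- Leg `0` is outgoing and leg `0 - 1` incoming, so the sector between them is to the right of
    -- both, and `f` increases along the three sheets.
    · intro hadj
      obtain ⟨h0, h5⟩ := hout hadj
      exact ⟨hf.right p' _ (hlab 0) hB
          (h.reverse.isLeft hι 0 hp1 (by rwa [leftSector_not, rightSector, h0])),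
        hf.right p' _ (hlab (0 - 1)) hB
          (h.reverse.isLeft hι (0 - 1) hp1 (by rwa [leftSector_not, rightSector, h5]))⟩
    · have := hcl i hi hi'
      rw [hp1] at this
      obtain ⟨j, rfl⟩ := (h.mem_closure_iff hι).1 this
      exact hlab' j

/-! ### Compactness of the cut sphere -/

theorem isClosed_image_support (hι : Topology.IsOpenEmbedding ι) : IsClosed (ι '' Γ.support) := by
  have : Γ.support = ⋃ e, Set.range (Γ.curve e) := by
    ext w; simp [PreChart.support]
  rw [this]
  exact ((isCompact_iUnion fun e => isCompact_range (Γ.curve e).continuous).image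
    hι.continuous).isClosed

theorem exists_isStarChart {o : Fin Γ.numEdges → Bool} (ho : Γ.IsBraidOrientation o) {z : ℂ}
    (hz : z ∈ Γ.support) : ∃ (d : ℕ) (_ : NeZero d) (φ : OpenPartialHomeomorph ℂ ℂ),
      IsStarChart Γ.support z d φ := by
  by_cases hb : z ∈ Γ.vertex ∧ ∃ half, Γ.IsBlack z half
  · obtain ⟨-, half, -, φ, hφ, -⟩ := hb
    exact ⟨1, inferInstance, φ, isStarChart_of_isStarPicture hφ⟩
  · obtain ⟨d, hd, φ, lab, out, c, h, -⟩ := exists_isModel_isWeight ho hz hb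
    exact ⟨d, hd, φ, h.isStarChart⟩

theorem compactSpace_cutSphere (hι : Topology.IsOpenEmbedding ι) {o : Fin Γ.numEdges → Bool}
    (ho : Γ.IsBraidOrientation o) : CompactSpace (Γ.CutSphere ι) := by
  refine compactSpace_cutPoint fun x V hV => ?_
  by_cases hx : x ∈ ι '' Γ.support
  · obtain ⟨z, hz, rfl⟩ := hx
    obtain ⟨d, hd, φ, hφ⟩ := exists_isStarChart ho hz
    have hs := hφ.sphere hι
    obtain ⟨ρ, h0, h1, -, hle⟩ := hs.exists_disc_le hV one_pos
    exact ⟨_, hs.center_mem_disc h0, hle, hs.finite_components h0 h1⟩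
  · obtain ⟨U, h1, h2, h3⟩ := exists_nhds_of_notMem (isClosed_image_support hι) hx hV
    refine ⟨U, h1, h2, (Set.finite_singleton (U : Set Sphere2)).subset ?_⟩
    rintro W ⟨y, hy, rfl⟩
    exact h3 y hy

end ChartCover

/-! ### The embedding -/

theorem mainTheorem4 (n : ℕ) (Γ : PermutationChart n)
    (ι : ℂ → Sphere2) (hι : Topology.IsOpenEmbedding ι)
    (hΓ : ∃ o : Fin Γ.numEdges → Bool, Γ.IsBraidOrientation o) :
    ∃ Ft : Γ.Cover ι → Sphere2 × (unitInterval × unitInterval),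
      Topology.IsEmbedding Ft ∧ Prod.fst ∘ Ft = Γ.coverMap ι := by
  obtain ⟨o, ho⟩ := hΓ
  have hS := ChartCover.isClosed_image_support (Γ := Γ) hι
  have hB : IsClosed (ι '' {v | v ∈ Γ.vertex ∧ ∃ half, Γ.IsBlack v half}) :=
    ((Γ.vertex.finite_toSet.subset fun v hv => hv.1).image ι).isClosed
  obtain ⟨f, hf⟩ := ChartCover.exists_isHeight hι o hB fun x hx => by
    by_cases hxS : x ∈ ι '' Γ.support
    · obtain ⟨z, hz, rfl⟩ := hxS
      rw [hι.injective.mem_set_image] at hx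
      obtain ⟨d, hd, φ, lab, out, c, h, hw, -⟩ := ChartCover.exists_isModel_isWeight ho hz hx
      exact ⟨_, (h.isStarChart.sphere hι).center_mem_disc one_pos, h.exists_isLocalHeight hι hw⟩
    · exact ⟨⟨(ι '' Γ.support)ᶜ, hS.isOpen_compl⟩, hxS, _, ChartCover.isLocalHeight_zero hι o hS⟩
  choose D hDc hD0 hD using fun i =>
    ChartCover.exists_zeroSet (isClosed_closure (s := ι '' Γ.openEdges i))
  have hcompact := ChartCover.compactSpace_cutSphere hι ho
  let g : Γ.CutSphere ι × Fin n → ℝ := fun x => ∑ i ∈ Finset.range x.2, D i x.1.pt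
  have hg : Continuous g := continuous_prod_of_discrete_right.2 fun k =>
    (continuous_finsetSum (Finset.range k) fun i _ => (hDc i).comp CutPoint.continuous_pt :
      Continuous fun p : Γ.CutSphere ι => ∑ i ∈ Finset.range k, D i p.pt)
  -- The sigmoid is a continuous injection of the line into the unit interval, so it fits both
  -- heights into `[0,1]` without losing separation.
  let F : Γ.CutSphere ι × Fin n → Sphere2 × (unitInterval × unitInterval) := fun x =>
    (x.1.pt, unitInterval.sigmoid (g x), unitInterval.sigmoid (f x))
  have hF : ∀ x y, Γ.Glued ι x y → F x = F y := by
    intro x y h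
    have h1 : x.1.pt = y.1.pt := by obtain ⟨i, hi, h, -⟩ := h; exact h.1
    have h2 : g x = g y := ChartCover.sum_range_eq_of_glued hD h
    simp only [F, h1, h2, hf.glue x y h]
  have hFc : Continuous F := (CutPoint.continuous_pt.comp continuous_fst).prodMk
    ((unitInterval.continuous_sigmoid.comp hg).prodMk
      (unitInterval.continuous_sigmoid.comp hf.continuous))
  refine ⟨Quot.lift F hF, (Continuous.isClosedEmbedding (continuous_quot_lift hF hFc) ?_).isEmbedding, ?_⟩
  · rintro ⟨x⟩ ⟨y⟩ h
    have h' : F x = F y := h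
    simp only [F, Prod.mk.injEq, unitInterval.sigmoid_injective.eq_iff] at h'
    exact ChartCover.mk_eq_of_eq hι ho hS hD0 hD hf h'.1 h'.2.1 h'.2.2
  · funext x
    induction x using Quot.ind
    rfl
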